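/- **Graphs.** A pointed graph $\Gamma=(V\cup\{\bullet\},E)$ is a finite directed graph, loops and multiple edges allowed, with a distinguished vertex $\bullet$; the vertices in $V$ are called ordinary. Its weight is $w(\Gamma)=|E|-|V|$, and $|V(\Gamma)|=|V|+1$ is the number of all its vertices. $\Gamma$ is stable if every ordinary vertex has at least two inward and at least two outward edges, and strongly connected if there is a directed path from each vertex to every other one. An isomorphism of pointed graphs is a pair of bijections, of the ordinary vertices and of the edges, compatible with the endpoints of edges and fixing $\bullet$; $\mathrm{Aut}(\Gamma)$ is the group of automorphisms (so permutations of parallel edges and of loops at a vertex count). The number $\varphi(\Gamma)$ of strong reductions of $\Gamma$ is defined recursively, the first applicable rule being used: (i) $\varphi(\Gamma)=0$ if $\Gamma$ is not strongly connected; (ii) $\varphi(\Gamma)=l!$ if $\Gamma$ consists of $\bullet$ with $l$ loops; (iii) if an ordinary vertex $v$ has exactly one inward and one outward edge, then $\varphi(\Gamma)=\varphi(\Gamma/\{v\})$, where $\Gamma/\{v\}$ arises by smoothing out $v$ (removing $v$ and joining the two edges at $v$ into one); (iv) otherwise $\varphi(\Gamma)=\sum_{e\in E}\varphi(\Gamma-\{e\})$,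 where $\Gamma-\{e\}$ arises by deleting the edge $e$ and keeping its endpoints. **Kähler metrics.** Let $M$ be a complex manifold of dimension $d$ with a Kähler metric $g$, with components $g_{i\bar j}$ in holomorphic coordinates, and let $g^{i\bar j}$ be the inverse, $\sum_j g^{i\bar j}g_{k\bar j}=\delta_{ik}$. The complex Laplacian is $\square T=T_{/j\bar j}=\sum_{j,k}g^{j\bar k}\,T_{/j\bar k}$, where $/$ is the covariant derivative of covariant tensors; here it acts on smooth functions $T=f:M\to\mathbb C$. Holomorphic coordinates $z$ around $x\in M$ are called normal at $x$ to order $N$ if $$g_{i\bar j}(x)=\delta_{ij},\qquad \partial_{k_1}\cdots\partial_{k_r}g_{i\bar j}(x)=\partial_{\bar l_1}\cdots\partial_{\bar l_r}g_{i\bar j}(x)=0\quad(1\le r\le N).$$ In holomorphic coordinates, a pointed graph $\Gamma$ all of whose ordinary vertices have at least one inward and one outward edge represents the following differential operator on functions. Each edge carries an unbarred index at its source and a barred index at its target, contracted by $g^{i\bar j}$; each ordinary vertex with unbarred indices $i,k_1,\dots,k_r$ and barred indices $j,l_1,\dots,l_s$ stands for $\partial_{k_1}\cdots\partial_{k_r}\partial_{\bar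 l_1}\cdots\partial_{\bar l_s}g_{i\bar j}$ (by the Kähler condition the order of the indices does not matter); the vertex $\bullet$ stands for the partial derivative, with the indices there, of the function acted on; one multiplies these factors and sums over all indices. **Proposition.** Let $k,N\ge 0$ with $N\ge k-1$, let $x\in M$, and let $f:M\to\mathbb C$ be smooth. In any holomorphic coordinates around $x$ which are normal at $x$ to order $N$, $$(\square^k f)(x)=\sum_{\Gamma}(-1)^{|V(\Gamma)|-1}\,\frac{\varphi(\Gamma)}{|\mathrm{Aut}(\Gamma)|}\,(\Gamma f)(x),$$ where $\Gamma$ runs over the (finitely many) isomorphism classes of strongly connected stable pointed graphs of weight $k$. -/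

import Mathlib

open scoped Manifold ContDiff

noncomputable section

/-! ### Pointed multi-digraphs -/

/-- A pointed multi-digraph: `V` is the set of ordinary vertices, `none : Option V` is the
distinguished vertex, `E` is the set of directed edges (loops and parallel edges are allowed). -/
structure PointedGraph (V E : Type) where
  src : E → Option V
  tgt : E → Option V

namespace PointedGraph

variable {V E V' E' : Type}

open Classical in
/-- The number of outward edges. -/
def outDegree [Fintype E] (Γ : PointedGraph V E) (a : Option V) : ℕ :=
  (Finset.univ.filter fun e => Γ.src e = a).card

open Classical in
/-- The number of inward edges. -/
def inDegree [Fintype E] (Γ : PointedGraph V E) (a : Option V) : ℕ :=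
  (Finset.univ.filter fun e => Γ.tgt e = a).card

/-- Every ordinary vertex has at least two inward and at least two outward edges. -/
def IsStable [Fintype E] (Γ : PointedGraph V E) : Prop :=
  ∀ v : V, 2 ≤ Γ.inDegree (some v) ∧ 2 ≤ Γ.outDegree (some v)

/-- Any two vertices are joined by a directed path. -/
def IsStronglyConnected (Γ : PointedGraph V E) : Prop :=
  ∀ a b : Option V, Relation.ReflTransGen (fun u v => ∃ e, Γ.src e = u ∧ Γ.tgt e = v) a b

/-- The number of all vertices, the distinguished one included. -/
def numVertices [Fintype V] (_ : PointedGraph V E) : ℕ := Fintype.card (Option V)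

/-- The number of edges minus the number of ordinary vertices. -/
def weight [Fintype V] [Fintype E] (_ : PointedGraph V E) : ℤ :=
  (Fintype.card E : ℤ) - (Fintype.card V : ℤ)

/-- An isomorphism of pointed multi-digraphs: a bijection of the ordinary vertices (the
distinguished vertex is fixed) and a bijection of the edges, compatible with the endpoints. -/
@[ext]
structure Iso (Γ : PointedGraph V E) (Γ' : PointedGraph V' E') where
  vert : V ≃ V'
  edge : E ≃ E'
  src_eq : ∀ e, Γ'.src (edge e) = (Γ.src e).map vert
  tgt_eq : ∀ e, Γ'.tgt (edge e) = (Γ.tgt e).map vert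

/-- The order of the automorphism group. -/
def autCard (Γ : PointedGraph V E) : ℕ := Nat.card (Iso Γ Γ)

/-- Delete an edge and keep its endpoints. -/
def deleteEdge (Γ : PointedGraph V E) (e : E) : PointedGraph V {e' : E // e' ≠ e} where
  src e' := Γ.src e'
  tgt e' := Γ.tgt e'

open Classical in
/-- View a vertex different from `v` as a vertex of the graph without `v`
(the value at `v` itself is irrelevant). -/
def dropVertex (v : V) : Option V → Option {u : V // u ≠ v}
  | none => none
  | some u => if h : u ≠ v then some ⟨u, h⟩ else none

open Classical in
/-- Smooth out an ordinary vertex `v` which has exactly one inward edge and exactly one outward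
edge `f`, the two being different: `v` and `f` disappear, and the inward edge of `v` is prolonged
to the target of `f`. -/
def smooth (Γ : PointedGraph V E) (v : V) (f : E) :
    PointedGraph {u : V // u ≠ v} {e : E // e ≠ f} where
  src e := dropVertex v (Γ.src e)
  tgt e := if Γ.tgt e = some v then dropVertex v (Γ.tgt f) else dropVertex v (Γ.tgt e)

/-- `v` has exactly one inward and one outward edge, and `f` is the outward one. -/
def IsSmoothable [Fintype E] (Γ : PointedGraph V E) (p : V × E) : Prop :=
  Γ.outDegree (some p.1) = 1 ∧ Γ.inDegree (some p.1) = 1 ∧ Γ.src p.2 = some p.1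

open Classical in
/-- The number `φ(Γ)` of strong reductions: it is `0` if `Γ` is not strongly connected, `l!` if
`Γ` consists of the distinguished vertex with `l` loops; an ordinary vertex with one inward and one
outward edge is smoothed out; and when there is no such vertex, one sums over the removal of an
edge (the edges whose removal destroys strong connectedness contribute `0`). -/
def phi {V E : Type} [Fintype E] (Γ : PointedGraph V E) : ℕ :=
  if ¬ Γ.IsStronglyConnected then 0
  else if IsEmpty V then (Fintype.card E).factorial
  else if h : ∃ p : V × E, Γ.IsSmoothable p then
    phi (Γ.smooth (Classical.choose h).1 (Classical.choose h).2)
  else ∑ e : E, phi (Γ.deleteEdge e)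
termination_by Fintype.card E
decreasing_by
  · exact Fintype.card_subtype_lt (x := (Classical.choose h).2) (by simp)
  · exact Fintype.card_subtype_lt (x := e) (by simp)

/-- Isomorphism is an equivalence relation on graphs with `n` ordinary vertices, `m` edges. -/
instance isoSetoid (n m : ℕ) : Setoid (PointedGraph (Fin n) (Fin m)) where
  r Γ Γ' := Nonempty (Iso Γ Γ')
  iseqv :=
    { refl := fun Γ => ⟨⟨Equiv.refl _, Equiv.refl _, by simp, by simp⟩⟩
      symm := by
        rintro Γ Γ' ⟨σ⟩
        refine ⟨⟨σ.vert.symm, σ.edge.symm, fun e => ?_, fun e => ?_⟩⟩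
        · have := σ.src_eq (σ.edge.symm e)
          simp only [Equiv.apply_symm_apply] at this
          simp [this, Option.map_map]
        · have := σ.tgt_eq (σ.edge.symm e)
          simp only [Equiv.apply_symm_apply] at this
          simp [this, Option.map_map]
      trans := by
        rintro Γ Γ' Γ'' ⟨σ⟩ ⟨τ⟩
        refine ⟨⟨σ.vert.trans τ.vert, σ.edge.trans τ.edge, fun e => ?_, fun e => ?_⟩⟩
        · simp [σ.src_eq, τ.src_eq, Option.map_map]
        · simp [σ.tgt_eq, τ.tgt_eq, Option.map_map] }

/-- Isomorphism classes of finite pointed multi-digraphs, sorted by the numbers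
`(n, m)` of ordinary vertices and of edges. -/
abbrev IsoClass : Type := Σ nm : ℕ × ℕ, Quotient (isoSetoid nm.1 nm.2)

/-- A graph in the isomorphism class. -/
def IsoClass.rep (c : IsoClass) : PointedGraph (Fin c.1.1) (Fin c.1.2) := Quotient.out c.2

/-- The isomorphism classes of strongly connected stable pointed graphs of weight `k`. -/
def strongStable (k : ℕ) : Set IsoClass :=
  {c | c.rep.IsStronglyConnected ∧ c.rep.IsStable ∧ c.rep.weight = k}

theorem IsStable.two_mul_card_le [Fintype V] [Fintype E] {Γ : PointedGraph V E}
    (h : Γ.IsStable) : 2 * Fintype.card V ≤ Fintype.card E := by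
  classical
  calc 2 * Fintype.card V = ∑ _v : V, 2 := by simp [mul_comm]
    _ ≤ ∑ v : V, Γ.inDegree (some v) := Finset.sum_le_sum fun v _ => (h v).1
    _ ≤ ∑ a : Option V, Γ.inDegree a := by
        rw [Fintype.sum_option]; exact Nat.le_add_left _ _
    _ = Fintype.card E := by
        rw [← Finset.card_univ,
          Finset.card_eq_sum_card_fiberwise (f := Γ.tgt) (t := Finset.univ) (by simp)]
        refine Finset.sum_congr rfl fun a _ => ?_
        unfold inDegree
        congr 1

theorem finite_strongStable (k : ℕ) : (strongStable k).Finite := by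
  classical
  have hfin : ∀ n m : ℕ, Finite (PointedGraph (Fin n) (Fin m)) := fun n m =>
    Finite.of_injective (fun Γ => (Γ.src, Γ.tgt)) (by
      rintro ⟨a, b⟩ ⟨c, d⟩ h
      simpa using h)
  have : ∀ nm : ℕ × ℕ, Finite (Quotient (isoSetoid nm.1 nm.2)) := fun nm => by
    have := hfin nm.1 nm.2
    infer_instance
  have : ∀ nm : ℕ × ℕ, Fintype (Quotient (isoSetoid nm.1 nm.2)) := fun nm =>
    Fintype.ofFinite _
  refine Set.Finite.subset (Finset.finite_toSet
    ((Finset.range (k + 1) ×ˢ Finset.range (2 * k + 1)).sigma fun _ => Finset.univ)) ?_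
  rintro c ⟨-, h2, h3⟩
  have h4 := h2.two_mul_card_le
  simp only [weight, Fintype.card_fin] at h3 h4
  simp only [Finset.coe_sigma, Set.mem_sigma_iff, Finset.mem_coe, Finset.mem_product,
    Finset.mem_range, Finset.mem_univ, and_true]
  omega

end PointedGraph

/-! ### Kähler metrics and the complex Laplacian -/

/-- Greek indices: `Sum.inl i` is the index `i`, `Sum.inr i` is the barred index `ī`. -/
abbrev CIndex (d : ℕ) : Type := Fin d ⊕ Fin d

/-- The Wirtinger derivatives `∂/∂zᵢ = (∂/∂xᵢ - √-1 ∂/∂yᵢ) / 2` and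
`∂/∂z̄ᵢ = (∂/∂xᵢ + √-1 ∂/∂yᵢ) / 2`. -/
def wirtinger {d : ℕ} (α : CIndex d) (F : (Fin d → ℂ) → ℂ) (z : Fin d → ℂ) : ℂ :=
  match α with
  | Sum.inl i => (fderiv ℝ F z (Pi.single i 1) - Complex.I * fderiv ℝ F z (Pi.single i Complex.I)) / 2
  | Sum.inr i => (fderiv ℝ F z (Pi.single i 1) + Complex.I * fderiv ℝ F z (Pi.single i Complex.I)) / 2

/-- Iterated Wirtinger derivatives. -/
def iterWirtinger {d : ℕ} (l : List (CIndex d)) (F : (Fin d → ℂ) → ℂ) : (Fin d → ℂ) → ℂ :=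
  l.foldr wirtinger F

section Metric

variable {d : ℕ} {M : Type*} [TopologicalSpace M] [ChartedSpace (Fin d → ℂ) M]

/-- The coordinate vector `∂/∂zᵢ` of the coordinate system `φ` at the point with coordinates `z`. -/
def coordVector (φ : OpenPartialHomeomorph M (Fin d → ℂ)) (z : Fin d → ℂ) (i : Fin d) :
    TangentSpace 𝓘(ℂ, Fin d → ℂ) (φ.symm z) :=
  mfderiv 𝓘(ℂ, Fin d → ℂ) 𝓘(ℂ, Fin d → ℂ) φ.symm z (Pi.single i (1 : ℂ) : Fin d → ℂ)

variable (d M) in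
/-- A Kähler metric: a Hermitian inner product on each holomorphic tangent space, complex linear
in the first argument and conjugate linear in the second, whose components `g_{i j̄}` in any
holomorphic coordinate system are smooth functions with `∂ₖ g_{i j̄} = ∂ᵢ g_{k j̄}`. -/
structure KahlerMetric where
  form : ∀ y : M, TangentSpace 𝓘(ℂ, Fin d → ℂ) y →ₗ[ℂ]
    TangentSpace 𝓘(ℂ, Fin d → ℂ) y →ₛₗ[starRingEnd ℂ] ℂ
  conj_symm : ∀ y v w, starRingEnd ℂ (form y v w) = form y w v
  pos : ∀ y v, v ≠ 0 → 0 < (form y v v).re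
  smooth : ∀ φ ∈ IsManifold.maximalAtlas 𝓘(ℂ, Fin d → ℂ) ω M, ∀ i j : Fin d,
    ContDiffOn ℝ ∞ (fun z => form (φ.symm z) (coordVector φ z i) (coordVector φ z j)) φ.target
  kahler : ∀ φ ∈ IsManifold.maximalAtlas 𝓘(ℂ, Fin d → ℂ) ω M, ∀ z ∈ φ.target, ∀ i j k : Fin d,
    wirtinger (Sum.inl k)
        (fun z => form (φ.symm z) (coordVector φ z i) (coordVector φ z j)) z =
      wirtinger (Sum.inl i)
        (fun z => form (φ.symm z) (coordVector φ z k) (coordVector φ z j)) z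

namespace KahlerMetric

variable (g : KahlerMetric d M) (φ : OpenPartialHomeomorph M (Fin d → ℂ))

/-- The components `g_{i j̄}` in the coordinate system `φ`. -/
def comp (i j : Fin d) (z : Fin d → ℂ) : ℂ :=
  g.form (φ.symm z) (coordVector φ z i) (coordVector φ z j)

/-- The components `g^{i j̄}` of the inverse: `∑ⱼ g^{i j̄} g_{k j̄} = δᵢₖ`. -/
def invComp (i j : Fin d) (z : Fin d → ℂ) : ℂ :=
  (Matrix.of fun a b => g.comp φ a b z)⁻¹ j i

/-- The Christoffel symbols `Γ_{γ β}^δ`; only those with three unbarred or three barred indices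
are nonzero. -/
def christoffel (γ β δ : CIndex d) (z : Fin d → ℂ) : ℂ :=
  match γ, β, δ with
  | Sum.inl i, Sum.inl j, Sum.inl k =>
      ∑ l, g.invComp φ k l z * wirtinger (Sum.inl i) (g.comp φ j l) z
  | Sum.inr i, Sum.inr j, Sum.inr k =>
      ∑ l, g.invComp φ l k z * wirtinger (Sum.inr i) (g.comp φ l j) z
  | _, _, _ => 0

/-- The covariant derivative `T_{β₁…βₚ/γ}` of a covariant tensor field of rank `p`, given by its
components in the coordinate system `φ`; the new index `γ` is the last one. -/
def covDeriv {p : ℕ} (T : (Fin p → CIndex d) → (Fin d → ℂ) → ℂ)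
    (β : Fin (p + 1) → CIndex d) (z : Fin d → ℂ) : ℂ :=
  wirtinger (β (Fin.last p)) (T (Fin.init β)) z -
    ∑ i : Fin p, ∑ δ : CIndex d, g.christoffel φ (β (Fin.last p)) (β i.castSucc) δ z *
      T (Function.update (Fin.init β) i δ) z

/-- The complex Laplacian `□T = T_{/j j̄}` of a covariant tensor field of rank `p`, in
components: `(□T)_β = ∑ⱼₖ g^{j k̄} T_{β/j k̄}`. -/
def tensorLaplacian {p : ℕ} (T : (Fin p → CIndex d) → (Fin d → ℂ) → ℂ)
    (β : Fin p → CIndex d) (z : Fin d → ℂ) : ℂ :=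
  ∑ j : Fin d, ∑ k : Fin d, g.invComp φ j k z *
    g.covDeriv φ (g.covDeriv φ T)
      (Fin.snoc (α := fun _ => CIndex d)
        (Fin.snoc (α := fun _ => CIndex d) β (Sum.inl j)) (Sum.inr k)) z

/-- The complex Laplacian on functions (covariant tensor fields of rank `0`) on the manifold,
computed at each point in the preferred coordinate system there. -/
def laplacian (f : M → ℂ) (y : M) : ℂ :=
  g.tensorLaplacian (chartAt (Fin d → ℂ) y) (p := 0)
    (fun _ => f ∘ (chartAt (Fin d → ℂ) y).symm) Fin.elim0 (chartAt (Fin d → ℂ) y y)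

/-- `φ` is a holomorphic coordinate system around `x` which is normal at `x` to order `N`:
`g_{i j̄}(x) = δᵢⱼ` and `g_{i j̄ k₁…kᵣ}(x) = g_{i j̄ l̄₁…l̄ᵣ}(x) = 0` for `1 ≤ r ≤ N`. -/
structure IsNormalAt (N : ℕ) (x : M) : Prop where
  mem_atlas : φ ∈ IsManifold.maximalAtlas 𝓘(ℂ, Fin d → ℂ) ω M
  mem_source : x ∈ φ.source
  eq_delta : ∀ i j, g.comp φ i j (φ x) = if i = j then 1 else 0
  unbarred_eq_zero : ∀ (i j : Fin d) (l : List (Fin d)), 1 ≤ l.length → l.length ≤ N →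
    iterWirtinger (l.map Sum.inl) (g.comp φ i j) (φ x) = 0
  barred_eq_zero : ∀ (i j : Fin d) (l : List (Fin d)), 1 ≤ l.length → l.length ≤ N →
    iterWirtinger (l.map Sum.inr) (g.comp φ i j) (φ x) = 0

/-- The partial derivative `g_{i j̄ k₁…kᵣ l̄₁…l̄ₛ}` of the metric, given the list `i, k₁, …, kᵣ` of
its unbarred indices and the list `j, l₁, …, lₛ` of its barred indices; by the Kähler condition it
does not depend on the order within the lists. Both lists are nonempty at the
vertices of the graphs below. -/
def metricJet (a b : List (Fin d)) (z : Fin d → ℂ) : ℂ :=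
  match a, b with
  | i :: k, j :: l =>
      iterWirtinger (k.map Sum.inl ++ l.map Sum.inr) (g.comp φ i j) z
  | _, _ => 0

open Classical in
/-- The differential operator represented by a pointed graph in the coordinate system `φ`. An edge
`e` carries an unbarred index `a e` at its source and a barred index `b e` at its target, which are
contracted by `g^{i j̄}`; an ordinary vertex is the partial derivative of the metric with the
indices of the edges at that vertex; the distinguished vertex is the partial derivative, with the
indices there, of the function which the operator is applied to. -/
def graphOperator {V E : Type} [Fintype V] [Fintype E] (Γ : PointedGraph V E)
    (F : (Fin d → ℂ) → ℂ) (z : Fin d → ℂ) : ℂ :=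
  ∑ a : E → Fin d, ∑ b : E → Fin d,
    (∏ e : E, g.invComp φ (a e) (b e) z) *
    (∏ v : V, g.metricJet φ
      ((Finset.univ.filter fun e => Γ.src e = some v).toList.map a)
      ((Finset.univ.filter fun e => Γ.tgt e = some v).toList.map b) z) *
    iterWirtinger
      ((Finset.univ.filter fun e => Γ.src e = none).toList.map (fun e => Sum.inl (a e)) ++
        (Finset.univ.filter fun e => Γ.tgt e = none).toList.map (fun e => Sum.inr (b e))) F z

end KahlerMetric

end Metric

end

/-! Write g = 1 + H in the given coordinates, so that the matrix H vanishes at x. On functions the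
Laplacian is ∑ (g⁻¹)ₖⱼ ∂ⱼ∂ₖ̄, and modulo high powers of the ideal of functions vanishing at x the
inverse is ∑ (-H)ⁿ over n < B. Let (Hⁿ)ₖⱼ ∂ⱼ∂ₖ̄ act on a product of derivatives of H and f that is
encoded by a graph. By the Leibniz rule ∂ⱼ hits some vertex s and ∂ₖ̄ some vertex t, and the n
factors of Hⁿ become the interior vertices of a directed path from s to t: the graph acquires an
ear, with sign (-1)ⁿ. Hence □ᵏf at x is the signed sum of the values of all graphs built from the
bare distinguished vertex by adding k ears (`iterate_boxOperator_eq_sum`). The truncation is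
harmless for B > 2k, since each of the 2k derivations lowers the power of the ideal by at most one
(`eval_iterate_boxOperator`).

At x the unstable graphs drop out: an unstable vertex contributes an entry of H or a purely barred
or unbarred derivative of it, and the order is at most k - 1 ≤ N, because all degrees are at most
the weight k (`eval_graphValue_eq_zero`). At the vertices of stable graphs the derivatives of H are
those of g (`eval_graphValue`).

Collecting isomorphic graphs gives Γ the coefficient ∑ |Iso(T, Γ)| / |Aut Γ|, where T runs over the
ear-built graphs with multiplicity. The combinatorial core is that the numerator is φ(Γ)
(`phi_eq_sum_card_iso`). It counts the ordered ear decompositions of Γ, and these obey the rules for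
φ. A graph with such a decomposition is strongly connected. A vertex with one inward and one outward
edge is interior to an ear, so smoothing it out does not change the count (`earCount_smooth`).
Without such a vertex the last ear is a single edge, whose removal leaves a decomposition of the
rest (`earCount_deleteEdge`). Smoothing is checked on `earCount`, which lists the ears from the
first one, edge by edge; deletion is checked on the sum over isomorphisms, where the last ear can be
peeled off. `sum_card_iso_ears` identifies the two counts.

Since `laplacian` uses the preferred chart at each point, iterating it in one coordinate system also
requires its invariance under holomorphic changes of coordinates (`laplacian_eq`). -/

noncomputable section

namespace PointedGraph

variable {V E V' E' V'' E'' : Type}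

/-! ### Isomorphisms and embeddings -/

namespace Iso

variable {Γ : PointedGraph V E} {Γ' : PointedGraph V' E'} {Γ'' : PointedGraph V'' E''}

/-- The inverse isomorphism. -/
def symm (σ : Iso Γ Γ') : Iso Γ' Γ where
  vert := σ.vert.symm
  edge := σ.edge.symm
  src_eq e := by
    have := σ.src_eq (σ.edge.symm e)
    simp only [Equiv.apply_symm_apply] at this
    simp [this, Option.map_map]
  tgt_eq e := by
    have := σ.tgt_eq (σ.edge.symm e)
    simp only [Equiv.apply_symm_apply] at this
    simp [this, Option.map_map]

/-- The composition of isomorphisms. -/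
def trans (σ : Iso Γ Γ') (τ : Iso Γ' Γ'') : Iso Γ Γ'' where
  vert := σ.vert.trans τ.vert
  edge := σ.edge.trans τ.edge
  src_eq e := by simp [σ.src_eq, τ.src_eq, Option.map_map]
  tgt_eq e := by simp [σ.tgt_eq, τ.tgt_eq, Option.map_map]

variable (Γ) in
/-- The identity isomorphism. -/
def refl : Iso Γ Γ where
  vert := Equiv.refl _
  edge := Equiv.refl _
  src_eq e := by simp
  tgt_eq e := by simp

instance [Finite V] [Finite E] [Finite V'] [Finite E'] : Finite (Iso Γ Γ') :=
  Finite.of_injective (fun σ : Iso Γ Γ' => (σ.vert, σ.edge)) fun σ τ h => by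
    simp only [Prod.mk.injEq] at h
    exact Iso.ext h.1 h.2

/-- Composition with an isomorphism identifies the sets of isomorphisms. -/
def congrLeft (τ : Iso Γ Γ') : Iso Γ Γ'' ≃ Iso Γ' Γ'' where
  toFun σ := τ.symm.trans σ
  invFun σ := τ.trans σ
  left_inv σ := by ext <;> simp [trans, symm]
  right_inv σ := by ext <;> simp [trans, symm]

theorem isStronglyConnected (σ : Iso Γ Γ') (h : Γ.IsStronglyConnected) :
    Γ'.IsStronglyConnected := by
  intro a b
  have key : ∀ {a b : Option V},
      Relation.ReflTransGen (fun u v => ∃ e, Γ.src e = u ∧ Γ.tgt e = v) a b →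
      Relation.ReflTransGen (fun u v => ∃ e, Γ'.src e = u ∧ Γ'.tgt e = v)
        (a.map σ.vert) (b.map σ.vert) := by
    intro a b hab
    refine Relation.ReflTransGen.lift (fun a : Option V => a.map σ.vert) ?_ _ _ hab
    rintro u v ⟨e, rfl, rfl⟩
    exact ⟨σ.edge e, σ.src_eq e, σ.tgt_eq e⟩
  have := key (h (a.map σ.vert.symm) (b.map σ.vert.symm))
  simpa [Option.map_map] using this

theorem src_eq_some_iff (σ : Iso Γ Γ') (e : E) (v : Option V) :
    Γ'.src (σ.edge e) = v.map σ.vert ↔ Γ.src e = v := by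
  rw [σ.src_eq]
  exact (Option.map_injective σ.vert.injective).eq_iff

theorem tgt_eq_some_iff (σ : Iso Γ Γ') (e : E) (v : Option V) :
    Γ'.tgt (σ.edge e) = v.map σ.vert ↔ Γ.tgt e = v := by
  rw [σ.tgt_eq]
  exact (Option.map_injective σ.vert.injective).eq_iff

theorem outDegree_eq [Fintype E] [Fintype E'] (σ : Iso Γ Γ') (v : Option V) :
    Γ'.outDegree (v.map σ.vert) = Γ.outDegree v := by
  classical
  unfold outDegree
  symm
  refine Finset.card_equiv σ.edge fun e => ?_
  simp [σ.src_eq_some_iff]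

theorem inDegree_eq [Fintype E] [Fintype E'] (σ : Iso Γ Γ') (v : Option V) :
    Γ'.inDegree (v.map σ.vert) = Γ.inDegree v := by
  classical
  unfold inDegree
  symm
  refine Finset.card_equiv σ.edge fun e => ?_
  simp [σ.tgt_eq_some_iff]

theorem isStable [Fintype E] [Fintype E'] (σ : Iso Γ Γ') (h : Γ.IsStable) : Γ'.IsStable := by
  intro v
  have h1 := σ.outDegree_eq (some (σ.vert.symm v))
  have h2 := σ.inDegree_eq (some (σ.vert.symm v))
  simp only [Option.map_some, Equiv.apply_symm_apply] at h1 h2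
  rw [h1, h2]
  exact h _

end Iso

/-- An embedding of pointed multi-digraphs. -/
@[ext]
structure Emb (Γ : PointedGraph V E) (Γ' : PointedGraph V' E') where
  vert : V ↪ V'
  edge : E ↪ E'
  src_eq : ∀ e, Γ'.src (edge e) = (Γ.src e).map vert
  tgt_eq : ∀ e, Γ'.tgt (edge e) = (Γ.tgt e).map vert

namespace Emb

variable {Γ : PointedGraph V E} {Γ' : PointedGraph V' E'}

instance [Finite V] [Finite E] [Finite V'] [Finite E'] : Finite (Emb Γ Γ') :=
  Finite.of_injective (fun σ : Emb Γ Γ' => (σ.vert, σ.edge)) fun σ τ h => by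
    simp only [Prod.mk.injEq] at h
    exact Emb.ext h.1 h.2

instance [Finite V] [Finite E] [Finite V'] [Finite E'] : Fintype (Emb Γ Γ') :=
  Fintype.ofFinite _

/-- The vertices in the image of an embedding, the distinguished one included. -/
def vertices (j : Emb Γ Γ') : Set (Option V') := Set.range (Option.map j.vert)

/-- The edges in the image of an embedding. -/
def edges (j : Emb Γ Γ') : Set E' := Set.range j.edge

theorem none_mem_vertices (j : Emb Γ Γ') : none ∈ j.vertices := ⟨none, rfl⟩

/-- The isomorphisms are the surjective embeddings. -/
def isoEquiv : Iso Γ Γ' ≃ {j : Emb Γ Γ' // j.vertices = Set.univ ∧ j.edges = Set.univ} :=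
  Equiv.ofBijective
    (fun σ => ⟨⟨σ.vert.toEmbedding, σ.edge.toEmbedding, σ.src_eq, σ.tgt_eq⟩, by
      refine ⟨Set.range_eq_univ.2 fun a => ⟨a.map σ.vert.symm, ?_⟩,
        Set.range_eq_univ.2 σ.edge.surjective⟩
      cases a <;> simp⟩) <| by
    constructor
    · intro σ τ h
      simp only [Subtype.mk.injEq, Emb.mk.injEq] at h
      exact Iso.ext (Equiv.toEmbedding_injective h.1) (Equiv.toEmbedding_injective h.2)
    · rintro ⟨j, h1, h2⟩
      have hv : Function.Surjective j.vert := fun v => by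
        obtain ⟨a, ha⟩ := Set.range_eq_univ.1 h1 (some v)
        cases a with
        | none => simp at ha
        | some a => exact ⟨a, by simpa using ha⟩
      exact ⟨⟨Equiv.ofBijective j.vert ⟨j.vert.injective, hv⟩,
        Equiv.ofBijective j.edge ⟨j.edge.injective, Set.range_eq_univ.1 h2⟩,
        j.src_eq, j.tgt_eq⟩, by ext <;> rfl⟩

end Emb

/-! ### Adding ears -/

/-- Add to a graph a directed path with `n` new interior vertices from `s` to `t`. -/
def addEar (Γ : PointedGraph V E) (n : ℕ) (s t : Option V) :
    PointedGraph (V ⊕ Fin n) (E ⊕ Fin (n + 1)) where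
  src := Sum.elim (fun e => (Γ.src e).map Sum.inl)
    (Fin.cons (α := fun _ => Option (V ⊕ Fin n)) (s.map Sum.inl) fun i => some (Sum.inr i))
  tgt := Sum.elim (fun e => (Γ.tgt e).map Sum.inl)
    (Fin.snoc (α := fun _ => Option (V ⊕ Fin n)) (fun i => some (Sum.inr i)) (t.map Sum.inl))

section addEar

variable (Γ : PointedGraph V E) (n : ℕ) (s t : Option V)

@[simp] theorem addEar_src_inl (e : E) :
    (Γ.addEar n s t).src (Sum.inl e) = (Γ.src e).map Sum.inl := rfl

@[simp] theorem addEar_tgt_inl (e : E) :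
    (Γ.addEar n s t).tgt (Sum.inl e) = (Γ.tgt e).map Sum.inl := rfl

@[simp] theorem addEar_src_zero :
    (Γ.addEar n s t).src (Sum.inr 0) = s.map Sum.inl := rfl

@[simp] theorem addEar_src_succ (i : Fin n) :
    (Γ.addEar n s t).src (Sum.inr i.succ) = some (Sum.inr i) := rfl

@[simp] theorem addEar_tgt_last :
    (Γ.addEar n s t).tgt (Sum.inr (Fin.last n)) = t.map Sum.inl := by
  simp [addEar]

@[simp] theorem addEar_tgt_castSucc (i : Fin n) :
    (Γ.addEar n s t).tgt (Sum.inr i.castSucc) = some (Sum.inr i) := by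
  simp [addEar]

-- It suffices to reach every vertex from the distinguished one and to return: an interior vertex
-- lies on the path from `s` to `t`, whose ends are joined to all old vertices.
variable {Γ} in
theorem IsStronglyConnected.addEar (h : Γ.IsStronglyConnected) :
    (Γ.addEar n s t).IsStronglyConnected := by
  set R := fun u v => ∃ e, (Γ.addEar n s t).src e = u ∧ (Γ.addEar n s t).tgt e = v with hR
  have hold : ∀ a b : Option V,
      Relation.ReflTransGen R (a.map Sum.inl) (b.map Sum.inl) := fun a b => by
    refine Relation.ReflTransGen.lift (fun a : Option V => a.map Sum.inl) ?_ _ _ (h a b)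
    rintro u v ⟨e, rfl, rfl⟩
    exact ⟨Sum.inl e, rfl, rfl⟩
  have hfrom : ∀ (i : ℕ) (hi : i < n),
      Relation.ReflTransGen R (s.map Sum.inl) (some (Sum.inr ⟨i, hi⟩)) := by
    intro i
    induction i with
    | zero =>
      intro hi
      exact Relation.ReflTransGen.single ⟨Sum.inr 0, rfl, addEar_tgt_castSucc Γ n s t ⟨0, hi⟩⟩
    | succ i ih =>
      intro hi
      refine (ih (by omega)).tail ⟨Sum.inr (Fin.succ ⟨i, by omega⟩), rfl, ?_⟩
      exact addEar_tgt_castSucc Γ n s t ⟨i + 1, hi⟩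
  have hto : ∀ (i j : ℕ) (hi : j < n), i + j + 1 = n →
      Relation.ReflTransGen R (some (Sum.inr ⟨j, hi⟩)) (t.map Sum.inl) := by
    intro i
    induction i with
    | zero =>
      intro j hj hij
      refine Relation.ReflTransGen.single ⟨Sum.inr (Fin.succ ⟨j, hj⟩), rfl, ?_⟩
      have : Fin.succ ⟨j, hj⟩ = Fin.last n := by ext; simp; omega
      rw [this, addEar_tgt_last]
    | succ i ih =>
      intro j hj hij
      refine Relation.ReflTransGen.head (b := some (Sum.inr ⟨j + 1, by omega⟩))
        ⟨Sum.inr (Fin.succ ⟨j, hj⟩), rfl, ?_⟩ (ih (j + 1) (by omega) (by omega))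
      exact addEar_tgt_castSucc Γ n s t ⟨j + 1, by omega⟩
  have h1 : ∀ a, Relation.ReflTransGen R none a := fun a => by
    match a with
    | none => exact hold none none
    | some (Sum.inl v) => exact hold none (some v)
    | some (Sum.inr i) => exact (hold none s).trans (hfrom i i.2)
  have h2 : ∀ a, Relation.ReflTransGen R a none := fun a => by
    match a with
    | none => exact hold none none
    | some (Sum.inl v) => exact hold (some v) none
    | some (Sum.inr i) => exact (hto (n - 1 - i) i i.2 (by omega)).trans (hold t none)
  exact fun a b => (h2 a).trans (h1 b)

end addEar

/-- A finite pointed graph together with its types of vertices and edges. -/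
structure FinGraph where
  V : Type
  E : Type
  [fintypeV : Fintype V]
  [fintypeE : Fintype E]
  graph : PointedGraph V E

attribute [instance] FinGraph.fintypeV FinGraph.fintypeE

namespace FinGraph

/-- The graph which consists of the distinguished vertex only. -/
def point : FinGraph where
  V := Fin 0
  E := Fin 0
  graph := ⟨Fin.elim0, Fin.elim0⟩

/-- Add an ear to a finite graph. -/
def addEar (S : FinGraph) (n : ℕ) (s t : Option S.V) : FinGraph where
  V := S.V ⊕ Fin n
  E := S.E ⊕ Fin (n + 1)
  graph := S.graph.addEar n s t

/-- The graphs obtained from `S` by adding an ear with less than `B` interior vertices. -/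
def extensions (B : ℕ) (S : FinGraph) : Multiset FinGraph :=
  (Finset.univ : Finset (Fin B × Option S.V × Option S.V)).val.map
    fun x => S.addEar x.1 x.2.1 x.2.2

/-- The graphs obtained from `S` by successively adding `k` ears with less than `B` interior
vertices. -/
def ears (B : ℕ) : ℕ → FinGraph → Multiset FinGraph
  | 0, S => {S}
  | k + 1, S => (extensions B S).bind (ears B k)

/-- The definition strips off the first ear, which suits the count edge by edge; the Laplacian and
the deletion rule act on the last one. -/
theorem ears_succ' (B k : ℕ) (S : FinGraph) :
    ears B (k + 1) S = (ears B k S).bind (extensions B) := by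
  induction k generalizing S with
  | zero =>
    change (extensions B S).bind (fun T => {T}) = Multiset.bind {S} (extensions B)
    rw [Multiset.singleton_bind, Multiset.bind_singleton, Multiset.map_id']
  | succ k ih =>
    rw [ears]
    conv_lhs => enter [2, T]; rw [ih T]
    rw [← Multiset.bind_assoc]
    rfl

theorem sum_map_extensions {X : Type*} [AddCommMonoid X] (B : ℕ) (S : FinGraph)
    (Θ : FinGraph → X) :
    ((extensions B S).map Θ).sum =
      ∑ n : Fin B, ∑ s : Option S.V, ∑ t : Option S.V, Θ (S.addEar n s t) := by
  simp only [extensions, Multiset.map_map, Function.comp_def]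
  rw [← Finset.sum_eq_multiset_sum, Fintype.sum_prod_type]
  simp_rw [Fintype.sum_prod_type]

theorem sum_map_ears_succ {X : Type*} [AddCommMonoid X] (B k : ℕ) (S : FinGraph)
    (Θ : FinGraph → X) :
    ((ears B (k + 1) S).map Θ).sum =
      ∑ n : Fin B, ∑ s : Option S.V, ∑ t : Option S.V,
        ((ears B k (S.addEar n s t)).map Θ).sum := by
  rw [ears, Multiset.map_bind, Multiset.sum_bind, sum_map_extensions]

theorem sum_map_ears_succ' {X : Type*} [AddCommMonoid X] (B k : ℕ) (S : FinGraph)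
    (Θ : FinGraph → X) :
    ((ears B (k + 1) S).map Θ).sum =
      ((ears B k S).map fun T => ∑ n : Fin B, ∑ s : Option T.V, ∑ t : Option T.V,
        Θ (T.addEar n s t)).sum := by
  rw [ears_succ', Multiset.map_bind, Multiset.sum_bind]
  simp_rw [sum_map_extensions]

theorem isStronglyConnected_of_mem_ears {B k : ℕ} {T : FinGraph} (hT : T ∈ ears B k point) :
    T.graph.IsStronglyConnected := by
  induction k generalizing T with
  | zero =>
    rw [ears, Multiset.mem_singleton] at hT
    subst hT
    intro a b
    match a, b with
    | none, none => exact Relation.ReflTransGen.refl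
    | some i, _ => exact i.elim0
    | _, some i => exact i.elim0
  | succ k ih =>
    rw [ears_succ', Multiset.mem_bind] at hT
    obtain ⟨S, hS, hT⟩ := hT
    obtain ⟨x, -, rfl⟩ := Multiset.mem_map.1 hT
    exact (ih hS).addEar _ _ _

/-- An ear with `n` interior vertices has `n + 1` edges, so each ear raises the weight by one. -/
theorem card_edges_of_mem_ears {B k : ℕ} {T : FinGraph} (hT : T ∈ ears B k point) :
    Fintype.card T.E = Fintype.card T.V + k := by
  induction k generalizing T with
  | zero =>
    rw [ears, Multiset.mem_singleton] at hT
    subst hT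
    rfl
  | succ k ih =>
    rw [ears_succ', Multiset.mem_bind] at hT
    obtain ⟨S, hS, hT⟩ := hT
    obtain ⟨x, -, rfl⟩ := Multiset.mem_map.1 hT
    have := ih hS
    change Fintype.card (S.E ⊕ Fin (x.1 + 1)) = Fintype.card (S.V ⊕ Fin x.1) + (k + 1)
    simp only [Fintype.card_sum, Fintype.card_fin]
    omega

end FinGraph

/-! ### Counting ear decompositions edge by edge -/

open Classical in
/-- The number of ways to exhaust the graph with `k` directed ears which have `m` edges
altogether, listed edge by edge. Here `W` is the set of the vertices of the ears which are
completed, `X` the set of all the vertices reached so far, `A` the set of the edges used so far, and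
the next edge has to start in `S`. -/
def earCount [Fintype E] (Γ : PointedGraph V E) :
    ℕ → ℕ → Set (Option V) → Set (Option V) → Set (Option V) → Set E → ℕ
  | 0, 0, _, _, X, A => if X = Set.univ ∧ A = Set.univ then 1 else 0
  | _ + 1, 0, _, _, _, _ => 0
  | 0, _ + 1, _, _, _, _ => 0
  | k + 1, m + 1, S, W, X, A => ∑ e : E,
      if e ∉ A ∧ Γ.src e ∈ S then
        if Γ.tgt e ∈ W then earCount Γ k m X X X (insert e A)
        else if Γ.tgt e ∉ X then
          earCount Γ (k + 1) m {Γ.tgt e} W (insert (Γ.tgt e) X) (insert e A)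
        else 0
      else 0

/-- `q` is a path which starts in `S`, ends in `W`, avoids the edges in `A`, and whose
interior vertices are distinct and do not belong to `X`. -/
structure IsEar (Γ : PointedGraph V E) (S W X : Set (Option V)) (A : Set E) {n : ℕ}
    (q : Fin (n + 1) → E) : Prop where
  src_zero : Γ.src (q 0) ∈ S
  tgt_last : Γ.tgt (q (Fin.last n)) ∈ W
  src_succ : ∀ i : Fin n, Γ.src (q i.succ) = Γ.tgt (q i.castSucc)
  tgt_notMem : ∀ i : Fin n, Γ.tgt (q i.castSucc) ∉ X
  tgt_injective : Function.Injective fun i : Fin n => Γ.tgt (q i.castSucc)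
  injective : Function.Injective q
  notMem : ∀ i, q i ∉ A

/-- The interior vertices of a path. -/
def interior (Γ : PointedGraph V E) {n : ℕ} (q : Fin (n + 1) → E) : Set (Option V) :=
  Set.range fun i : Fin n => Γ.tgt (q i.castSucc)

section earCount

variable (Γ : PointedGraph V E)

theorem isEar_const_iff {S W X : Set (Option V)} {A : Set E} (e : E) :
    Γ.IsEar S W X A (n := 0) (fun _ => e) ↔ (e ∉ A ∧ Γ.src e ∈ S) ∧ Γ.tgt e ∈ W :=
  ⟨fun h => ⟨⟨h.notMem 0, h.src_zero⟩, h.tgt_last⟩, fun h =>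
    ⟨h.1.2, h.2, fun i => i.elim0, fun i => i.elim0, fun i => i.elim0,
      fun i j _ => Subsingleton.elim (α := Fin 1) i j, fun _ => h.1.1⟩⟩

/-- After `e` the path must go on from the target of `e`, and this vertex and this edge become
forbidden. The set `W` of possible end points stays, since the ear is still open. -/
theorem isEar_cons_iff {S W X : Set (Option V)} {A : Set E} {n : ℕ} (e : E)
    (q : Fin (n + 1) → E) :
    Γ.IsEar S W X A (Fin.cons e q : Fin (n + 2) → E) ↔
      (e ∉ A ∧ Γ.src e ∈ S) ∧ Γ.tgt e ∉ X ∧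
        Γ.IsEar {Γ.tgt e} W (insert (Γ.tgt e) X) (insert e A) q := by
  constructor
  · intro h
    have hsucc := h.src_succ
    have hinj := h.injective
    have htinj := h.tgt_injective
    refine ⟨⟨h.notMem 0, h.src_zero⟩, h.tgt_notMem 0, ⟨?_, ?_, ?_, ?_, ?_, ?_, ?_⟩⟩
    · simpa using hsucc 0
    · simpa using h.tgt_last
    · intro i
      simpa using hsucc i.succ
    · intro i
      rw [Set.mem_insert_iff, not_or]
      refine ⟨fun hi => ?_, by simpa using h.tgt_notMem i.succ⟩
      have := @htinj i.succ 0 (by simpa using hi)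
      exact Fin.succ_ne_zero i this
    · intro i j hij
      have := @htinj i.succ j.succ (by simpa using hij)
      simpa using this
    · intro i j hij
      have := @hinj i.succ j.succ (by simpa using hij)
      simpa using this
    · intro i
      rw [Set.mem_insert_iff, not_or]
      refine ⟨fun hi => ?_, by simpa using h.notMem i.succ⟩
      have := @hinj i.succ 0 (by simpa using hi)
      exact Fin.succ_ne_zero i this
  · rintro ⟨⟨h1, h2⟩, h3, h⟩
    refine ⟨by simpa using h2, by simpa using h.tgt_last, ?_, ?_, ?_, ?_, ?_⟩
    · intro i
      cases i using Fin.cases with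
      | zero => simpa using h.src_zero
      | succ i => simpa using h.src_succ i
    · intro i
      cases i using Fin.cases with
      | zero => simpa using h3
      | succ i =>
        have := h.tgt_notMem i
        rw [Set.mem_insert_iff, not_or] at this
        simpa using this.2
    · have hz : ∀ i : Fin n, Γ.tgt (q i.castSucc) ≠ Γ.tgt e := fun i hi =>
        h.tgt_notMem i (by rw [hi]; exact Set.mem_insert _ _)
      intro i j hij
      cases i using Fin.cases with
      | zero =>
        cases j using Fin.cases with
        | zero => rfl
        | succ j => exact absurd (by simpa using hij.symm) (hz j)
      | succ i =>
        cases j using Fin.cases with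
        | zero => exact absurd (by simpa using hij) (hz i)
        | succ j => exact congrArg _ (h.tgt_injective (by simpa using hij))
    · rw [Fin.cons_injective_iff]
      refine ⟨?_, h.injective⟩
      rintro ⟨i, hi⟩
      exact h.notMem i (by rw [hi]; exact Set.mem_insert _ _)
    · intro i
      cases i using Fin.cases with
      | zero => simpa using h1
      | succ i =>
        have := h.notMem i
        rw [Set.mem_insert_iff, not_or] at this
        simpa using this.2

variable [Fintype E]

theorem earCount_zero_left (m : ℕ) (S W X : Set (Option V)) (A : Set E)
    [Decidable (m = 0 ∧ X = Set.univ ∧ A = Set.univ)] :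
    Γ.earCount 0 m S W X A = if m = 0 ∧ X = Set.univ ∧ A = Set.univ then 1 else 0 := by
  cases m with
  | zero => simp [earCount]
  | succ m => simp [earCount]

-- The recursion is unrolled until the current ear closes and is grouped by that ear `q`, which uses
-- `n + 1` of the `m` remaining edges. By `W ⊆ X`, closing the ear and reaching a new vertex are
-- exclusive alternatives.
open Classical in
theorem earCount_succ_eq_sum (k m : ℕ) (S W X : Set (Option V)) (A : Set E) (hWX : W ⊆ X) :
    Γ.earCount (k + 1) m S W X A =
      ∑ n ∈ Finset.range m, ∑ q : Fin (n + 1) → E,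
        if Γ.IsEar S W X A q then
          Γ.earCount k (m - 1 - n) (X ∪ Γ.interior q) (X ∪ Γ.interior q) (X ∪ Γ.interior q)
            (A ∪ Set.range q)
        else 0 := by
  induction m generalizing S X A with
  | zero => simp [earCount]
  | succ m ih =>
    -- An ear with one edge closes at once (`h0`); a longer one is a first edge `e` followed by an
    -- ear for the updated sets (`h1`).
    rw [Finset.sum_range_succ', earCount]
    have h0 : (∑ q : Fin (0 + 1) → E,
        if Γ.IsEar S W X A q then
          Γ.earCount k (m + 1 - 1 - 0) (X ∪ Γ.interior q) (X ∪ Γ.interior q) (X ∪ Γ.interior q)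
            (A ∪ Set.range q)
        else 0) = ∑ e : E, if (e ∉ A ∧ Γ.src e ∈ S) ∧ Γ.tgt e ∈ W then
          Γ.earCount k m X X X (insert e A) else 0 := by
      refine (Fintype.sum_equiv (Equiv.funUnique (Fin 1) E).symm _ _ fun e => ?_).symm
      have he : (Equiv.funUnique (Fin 1) E).symm e = fun _ => e := rfl
      rw [he]
      have hi : Γ.interior (n := 0) (fun _ => e) = ∅ := Set.range_eq_empty _
      rw [hi]
      refine if_congr (Γ.isEar_const_iff e).symm ?_ rfl
      rw [Set.union_empty, Set.range_const, Set.union_singleton]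
      rfl
    have h1 : ∀ n, (∑ q : Fin (n + 1 + 1) → E,
        if Γ.IsEar S W X A q then
          Γ.earCount k (m + 1 - 1 - (n + 1)) (X ∪ Γ.interior q) (X ∪ Γ.interior q)
            (X ∪ Γ.interior q) (A ∪ Set.range q)
        else 0) = ∑ e : E, if (e ∉ A ∧ Γ.src e ∈ S) ∧ Γ.tgt e ∉ X then
          ∑ q : Fin (n + 1) → E,
          if Γ.IsEar {Γ.tgt e} W (insert (Γ.tgt e) X) (insert e A) q then
            Γ.earCount k (m - 1 - n) (insert (Γ.tgt e) X ∪ Γ.interior q)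
              (insert (Γ.tgt e) X ∪ Γ.interior q) (insert (Γ.tgt e) X ∪ Γ.interior q)
              (insert e A ∪ Set.range q)
          else 0 else 0 := by
      intro n
      rw [← Fintype.sum_equiv (Fin.consEquiv (fun _ : Fin (n + 2) => E)) _ _ (fun _ => rfl),
        Fintype.sum_prod_type]
      refine Finset.sum_congr rfl fun e _ => ?_
      by_cases hc : (e ∉ A ∧ Γ.src e ∈ S) ∧ Γ.tgt e ∉ X
      · rw [if_pos hc]
        refine Finset.sum_congr rfl fun q _ => ?_
        have hcons : (Fin.consEquiv (fun _ : Fin (n + 2) => E)) (e, q) =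
          (Fin.cons e q : Fin (n + 2) → E) := rfl
        rw [hcons]
        have hi : X ∪ Γ.interior (Fin.cons e q : Fin (n + 2) → E) =
            insert (Γ.tgt e) X ∪ Γ.interior q := by
          ext a
          simp only [interior, Set.mem_union, Set.mem_range, Fin.exists_fin_succ, Set.mem_insert_iff]
          simp only [Fin.castSucc_zero, Fin.cons_zero, ← Fin.succ_castSucc, Fin.cons_succ]
          tauto
        have hr : A ∪ Set.range (Fin.cons e q : Fin (n + 2) → E) = insert e A ∪ Set.range q := by
          rw [Fin.range_cons]
          ext a
          simp only [Set.mem_union, Set.mem_insert_iff]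
          tauto
        have hm : m + 1 - 1 - (n + 1) = m - 1 - n := by omega
        rw [hi, hr, hm]
        refine if_congr ?_ rfl rfl
        rw [isEar_cons_iff]
        tauto
      · rw [if_neg hc]
        refine Finset.sum_eq_zero fun q _ => if_neg fun h => hc ?_
        have := (Γ.isEar_cons_iff e q).1 h
        exact ⟨this.1, this.2.1⟩
    rw [h0]
    simp_rw [h1]
    rw [Finset.sum_comm, ← Finset.sum_add_distrib]
    refine Finset.sum_congr rfl fun e _ => ?_
    by_cases hc : e ∉ A ∧ Γ.src e ∈ S
    · by_cases hW : Γ.tgt e ∈ W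
      · simp [hc, hW, hWX hW]
      · by_cases hX : Γ.tgt e ∈ X
        · simp [hc, hW, hX]
        · simp only [hc, hW, hX, not_false_eq_true, and_self, if_true, if_false, add_zero,
            and_false]
          exact ih _ _ _ (hWX.trans (Set.subset_insert _ _))
    · simp [hc]

end earCount

end PointedGraph

namespace PointedGraph

variable {V E V' E' V'' E'' : Type}

/-! ### Ear decompositions as embeddings of ear-built graphs -/

section bridge

variable {Γ₀ : PointedGraph V E} {Γ : PointedGraph V' E'} {n : ℕ} {s t : Option V}

namespace Emb

/-- The restriction of an embedding of a graph with an added ear to the original graph. -/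
def restrict (j : Emb (Γ₀.addEar n s t) Γ) : Emb Γ₀ Γ where
  vert := ⟨fun v => j.vert (Sum.inl v), fun _ _ h => Sum.inl_injective (j.vert.injective h)⟩
  edge := ⟨fun e => j.edge (Sum.inl e), fun _ _ h => Sum.inl_injective (j.edge.injective h)⟩
  src_eq e := by
    have := j.src_eq (Sum.inl e)
    rw [addEar_src_inl, Option.map_map] at this
    exact this
  tgt_eq e := by
    have := j.tgt_eq (Sum.inl e)
    rw [addEar_tgt_inl, Option.map_map] at this
    exact this

/-- The image of the added ear. -/
def ear (j : Emb (Γ₀.addEar n s t) Γ) (i : Fin (n + 1)) : E' := j.edge (Sum.inr i)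

theorem src_ear_zero (j : Emb (Γ₀.addEar n s t) Γ) :
    Γ.src (j.ear 0) = s.map j.restrict.vert := by
  have := j.src_eq (Sum.inr 0)
  rw [addEar_src_zero, Option.map_map] at this
  exact this

theorem tgt_ear_last (j : Emb (Γ₀.addEar n s t) Γ) :
    Γ.tgt (j.ear (Fin.last n)) = t.map j.restrict.vert := by
  have := j.tgt_eq (Sum.inr (Fin.last n))
  rw [addEar_tgt_last, Option.map_map] at this
  exact this

theorem tgt_ear_castSucc (j : Emb (Γ₀.addEar n s t) Γ) (i : Fin n) :
    Γ.tgt (j.ear i.castSucc) = some (j.vert (Sum.inr i)) := by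
  have := j.tgt_eq (Sum.inr i.castSucc)
  rwa [addEar_tgt_castSucc] at this

theorem src_ear_succ (j : Emb (Γ₀.addEar n s t) Γ) (i : Fin n) :
    Γ.src (j.ear i.succ) = some (j.vert (Sum.inr i)) := by
  have := j.src_eq (Sum.inr i.succ)
  rwa [addEar_src_succ] at this

theorem isEar_ear (j : Emb (Γ₀.addEar n s t) Γ) :
    Γ.IsEar j.restrict.vertices j.restrict.vertices j.restrict.vertices j.restrict.edges
      j.ear where
  src_zero := ⟨s, j.src_ear_zero.symm⟩
  tgt_last := ⟨t, j.tgt_ear_last.symm⟩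
  src_succ i := by rw [j.src_ear_succ, j.tgt_ear_castSucc]
  tgt_notMem i := by
    rw [j.tgt_ear_castSucc]
    rintro ⟨a, ha⟩
    cases a with
    | none => simp at ha
    | some a =>
      have : j.vert (Sum.inl a) = j.vert (Sum.inr i) := Option.some_injective _ ha
      simpa using j.vert.injective this
  tgt_injective i i' h := by
    simp only [j.tgt_ear_castSucc, Option.some.injEq] at h
    simpa using j.vert.injective h
  injective i i' h := by simpa using j.edge.injective h
  notMem i := by
    rintro ⟨a, ha⟩
    have : j.edge (Sum.inl a) = j.edge (Sum.inr i) := ha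
    simpa using j.edge.injective this

theorem vertices_eq (j : Emb (Γ₀.addEar n s t) Γ) :
    j.vertices = j.restrict.vertices ∪ Γ.interior j.ear := by
  ext a
  simp only [vertices, interior, j.tgt_ear_castSucc, Set.mem_union, Set.mem_range]
  constructor
  · rintro ⟨b, rfl⟩
    match b with
    | none => exact Or.inl ⟨none, rfl⟩
    | some (Sum.inl v) => exact Or.inl ⟨some v, rfl⟩
    | some (Sum.inr i) => exact Or.inr ⟨i, rfl⟩
  · rintro (⟨b, rfl⟩ | ⟨i, rfl⟩)
    · exact ⟨b.map Sum.inl, by rw [Option.map_map]; rfl⟩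
    · exact ⟨some (Sum.inr i), rfl⟩

theorem edges_eq (j : Emb (Γ₀.addEar n s t) Γ) :
    j.edges = j.restrict.edges ∪ Set.range j.ear := by
  ext a
  simp only [edges, Set.mem_union, Set.mem_range, Sum.exists]
  rfl

/-- The ends of the path supply `s` and `t`. Its interior vertices are ordinary, because the
distinguished vertex lies in the image of every embedding, and the disjointness conditions in
`IsEar` make the extended maps injective. -/
theorem exists_of_isEar (j : Emb Γ₀ Γ) (q : Fin (n + 1) → E')
    (hq : Γ.IsEar j.vertices j.vertices j.vertices j.edges q) :
    ∃ s t, ∃ j' : Emb (Γ₀.addEar n s t) Γ, j'.restrict = j ∧ j'.ear = q := by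
  obtain ⟨s, hs⟩ := hq.src_zero
  obtain ⟨t, ht⟩ := hq.tgt_last
  have hr : ∀ i : Fin n, ∃ r, Γ.tgt (q i.castSucc) = some r := fun i => by
    cases h : Γ.tgt (q i.castSucc) with
    | none => exact absurd (h ▸ j.none_mem_vertices) (hq.tgt_notMem i)
    | some r => exact ⟨r, rfl⟩
  choose r hr using hr
  refine ⟨s, t, ⟨⟨Sum.elim j.vert r, ?_⟩, ⟨Sum.elim j.edge q, ?_⟩, ?_, ?_⟩, ?_, ?_⟩
  · refine j.vert.injective.sumElim ?_ ?_
    · intro i i' h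
      refine hq.tgt_injective ?_
      simp only [hr, h]
    · intro a i h
      refine hq.tgt_notMem i ?_
      rw [hr, ← h]
      exact ⟨some a, rfl⟩
  · refine j.edge.injective.sumElim hq.injective ?_
    intro a i h
    exact hq.notMem i ⟨a, h⟩
  · rintro (e | i)
    · simp only [Function.Embedding.coeFn_mk, Sum.elim_inl, addEar_src_inl, Option.map_map,
        j.src_eq]
      rfl
    · cases i using Fin.cases with
      | zero =>
        simp only [Function.Embedding.coeFn_mk, Sum.elim_inr, addEar_src_zero, Option.map_map,
          ← hs]
        rfl
      | succ i =>
        simp only [Function.Embedding.coeFn_mk, Sum.elim_inr, addEar_src_succ, Option.map_some,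
          hq.src_succ, hr]
  · rintro (e | i)
    · simp only [Function.Embedding.coeFn_mk, Sum.elim_inl, addEar_tgt_inl, Option.map_map,
        j.tgt_eq]
      rfl
    · cases i using Fin.lastCases with
      | last =>
        simp only [Function.Embedding.coeFn_mk, Sum.elim_inr, addEar_tgt_last, Option.map_map,
          ← ht]
        rfl
      | cast i =>
        simp only [Function.Embedding.coeFn_mk, Sum.elim_inr, addEar_tgt_castSucc,
          Option.map_some, hr]
  · ext <;> rfl
  · rfl

end Emb

-- Over all `s` and `t` together, an embedding of the enlarged graph amounts to an embedding `j` of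
-- the old one and an ear `q` of `Γ` attached to its image; the ends of `q` determine `s` and `t` by
-- injectivity.
open Classical in
theorem sum_emb_addEar [Fintype V] [Fintype E] [Fintype V'] [Fintype E']
    (Γ₀ : PointedGraph V E) (Γ : PointedGraph V' E') (n : ℕ)
    (g : Set (Option V') → Set E' → ℕ) :
    ∑ s, ∑ t, ∑ j : Emb (Γ₀.addEar n s t) Γ, g j.vertices j.edges =
      ∑ j : Emb Γ₀ Γ, ∑ q : Fin (n + 1) → E',
        if Γ.IsEar j.vertices j.vertices j.vertices j.edges q then
          g (j.vertices ∪ Γ.interior q) (j.edges ∪ Set.range q) else 0 := by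
  have hR := Fintype.sum_prod_type' fun (j : Emb Γ₀ Γ) (q : Fin (n + 1) → E') =>
    if Γ.IsEar j.vertices j.vertices j.vertices j.edges q then
      g (j.vertices ∪ Γ.interior q) (j.edges ∪ Set.range q) else 0
  rw [← hR, ← Finset.sum_filter]
  simp_rw [← Fintype.sum_sigma']
  refine Finset.sum_bij (fun x _ => (x.2.2.restrict, x.2.2.ear)) ?_ ?_ ?_ ?_
  · rintro ⟨s, t, j⟩ -
    simpa using j.isEar_ear
  · rintro ⟨s, t, j⟩ - ⟨s', t', j'⟩ - h
    simp only [Prod.mk.injEq] at h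
    obtain ⟨h1, h2⟩ := h
    have hs : s = s' := by
      have := j.src_ear_zero
      rw [h1, h2, j'.src_ear_zero] at this
      exact (Option.map_injective j'.restrict.vert.injective this).symm
    have ht : t = t' := by
      have := j.tgt_ear_last
      rw [h1, h2, j'.tgt_ear_last] at this
      exact (Option.map_injective j'.restrict.vert.injective this).symm
    subst hs ht
    have : j = j' := by
      ext a
      · rcases a with a | i
        · exact DFunLike.congr_fun (congrArg Emb.vert h1) a
        · have := j.tgt_ear_castSucc i
          rw [h2, j'.tgt_ear_castSucc i] at this
          exact (Option.some_injective _ this).symm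
      · rcases a with a | i
        · exact DFunLike.congr_fun (congrArg Emb.edge h1) a
        · exact congrFun h2 i
    rw [this]
  · rintro ⟨j, q⟩ hq
    obtain ⟨s, t, j', h1, h2⟩ := j.exists_of_isEar q (by simpa using hq)
    exact ⟨⟨s, t, j'⟩, Finset.mem_univ _, by rw [← h1, ← h2]⟩
  · rintro ⟨s, t, j⟩ -
    simp only
    rw [j.vertices_eq, j.edges_eq]

/-- Both sides count the ways to extend an embedded copy of `S` to the whole of `Γ` by `k`
successive ears. An arbitrary `S` is needed for the induction, which splits off the first ear. The
bound `B` loses nothing, as no ear in `Γ` has more than `B` edges. -/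
theorem sum_card_iso_ears (Γ : PointedGraph V' E') [Fintype V'] [Fintype E'] {B : ℕ}
    (hB : Fintype.card E' ≤ B) (k : ℕ) (S : FinGraph) :
    ((S.ears B k).map fun T => Nat.card (Iso T.graph Γ)).sum =
      ∑ j : Emb S.graph Γ, Γ.earCount k (Fintype.card E' - Fintype.card S.E)
        j.vertices j.vertices j.vertices j.edges := by
  classical
  induction k generalizing S with
  | zero =>
    simp only [FinGraph.ears, Multiset.map_singleton, Multiset.sum_singleton]
    rw [Nat.card_congr Emb.isoEquiv, Nat.card_eq_fintype_card, Fintype.card_subtype,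
      Finset.card_filter]
    refine Finset.sum_congr rfl fun j _ => ?_
    rw [earCount_zero_left]
    refine if_congr ⟨fun h => ⟨?_, h⟩, fun h => h.2⟩ rfl rfl
    rw [Fintype.card_of_bijective ⟨j.edge.injective, Set.range_eq_univ.1 h.2⟩, Nat.sub_self]
  | succ k ih =>
    rw [FinGraph.sum_map_ears_succ]
    simp_rw [ih]
    have hstep : ∀ n : ℕ, (∑ s, ∑ t, ∑ j : Emb (S.addEar n s t).graph Γ,
        Γ.earCount k (Fintype.card E' - Fintype.card (S.addEar n s t).E)
          j.vertices j.vertices j.vertices j.edges) =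
        ∑ j : Emb S.graph Γ, ∑ q : Fin (n + 1) → E',
          if Γ.IsEar j.vertices j.vertices j.vertices j.edges q then
            Γ.earCount k (Fintype.card E' - Fintype.card S.E - 1 - n)
              (j.vertices ∪ Γ.interior q) (j.vertices ∪ Γ.interior q)
              (j.vertices ∪ Γ.interior q) (j.edges ∪ Set.range q) else 0 := by
      intro n
      rw [← sum_emb_addEar S.graph Γ n fun X A =>
        Γ.earCount k (Fintype.card E' - Fintype.card S.E - 1 - n) X X X A]
      refine Finset.sum_congr rfl fun s _ => Finset.sum_congr rfl fun t _ => ?_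
      have : Fintype.card E' - Fintype.card (S.addEar n s t).E =
          Fintype.card E' - Fintype.card S.E - 1 - n := by
        change Fintype.card E' - Fintype.card (S.E ⊕ Fin (n + 1)) = _
        simp only [Fintype.card_sum, Fintype.card_fin]
        omega
      rw [this]
      rfl
    rw [Finset.sum_congr rfl fun (n : Fin B) _ => hstep n, Finset.sum_comm]
    refine Finset.sum_congr rfl fun j _ => ?_
    rw [earCount_succ_eq_sum _ _ _ _ _ _ _ subset_rfl, Fin.sum_univ_eq_sum_range (fun n =>
      ∑ q : Fin (n + 1) → E', if Γ.IsEar j.vertices j.vertices j.vertices j.edges q then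
            Γ.earCount k (Fintype.card E' - Fintype.card S.E - 1 - n)
              (j.vertices ∪ Γ.interior q) (j.vertices ∪ Γ.interior q)
              (j.vertices ∪ Γ.interior q) (j.edges ∪ Set.range q) else 0) B]
    -- The two ranges of ear lengths differ only by vanishing terms: the edges of `S` and of the ear
    -- inject together into those of `Γ`, so the ear cannot be longer than the number of edges left.
    symm
    refine Finset.sum_subset (fun n hn => ?_) fun n _ hn => Finset.sum_eq_zero fun q _ =>
      if_neg fun hq => hn ?_
    · rw [Finset.mem_range] at hn ⊢
      omega
    · have hinj : Function.Injective (Sum.elim j.edge q) :=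
        j.edge.injective.sumElim hq.injective fun a i h => hq.notMem i ⟨a, h⟩
      have := Fintype.card_le_of_injective _ hinj
      simp only [Fintype.card_sum, Fintype.card_fin] at this
      rw [Finset.mem_range]
      omega

/-- The point embeds uniquely. -/
def Emb.point (Γ : PointedGraph V' E') : Emb FinGraph.point.graph Γ where
  vert := ⟨Fin.elim0, fun i => i.elim0⟩
  edge := ⟨Fin.elim0, fun i => i.elim0⟩
  src_eq i := i.elim0
  tgt_eq i := i.elim0

theorem sum_card_iso_ears_point (Γ : PointedGraph V' E') [Fintype V'] [Fintype E'] {B : ℕ}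
    (hB : Fintype.card E' ≤ B) (k : ℕ) :
    ((FinGraph.point.ears B k).map fun T => Nat.card (Iso T.graph Γ)).sum =
      Γ.earCount k (Fintype.card E') {none} {none} {none} ∅ := by
  rw [sum_card_iso_ears Γ hB]
  have huniq : ∀ j : Emb FinGraph.point.graph Γ, j = Emb.point Γ := fun j => by
    ext i <;> exact Fin.elim0 i
  rw [Finset.sum_eq_single_of_mem (Emb.point Γ) (Finset.mem_univ _)
    fun j _ hj => absurd (huniq j) hj]
  have h1 : (Emb.point Γ).vertices = {none} := by
    ext a
    constructor
    · rintro ⟨b, rfl⟩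
      match b with
      | none => rfl
      | some i => exact i.elim0
    · rintro rfl
      exact ⟨none, rfl⟩
  have h2 : (Emb.point Γ).edges = ∅ := by
    ext a
    constructor
    · rintro ⟨i, -⟩
      exact i.elim0
    · exact fun h => h.elim
  rw [h1, h2]
  congr 1

end bridge

end PointedGraph

namespace PointedGraph

variable {V E V' E' V'' E'' : Type}

/-! ### Degrees -/

/-- A path to a second vertex has to leave `a`. The second vertex is essential: the bare
distinguished vertex is strongly connected and has no edges. -/
theorem IsStronglyConnected.one_le_outDegree [Fintype E] [Nonempty V] {Γ : PointedGraph V E}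
    (h : Γ.IsStronglyConnected) (a : Option V) : 1 ≤ Γ.outDegree a := by
  classical
  obtain ⟨b, hb⟩ := exists_ne a
  rcases Relation.ReflTransGen.cases_head (h a b) with hab | ⟨c, ⟨e, he, -⟩, -⟩
  · exact absurd hab hb.symm
  · exact Finset.card_pos.2 ⟨e, by simpa using he⟩

theorem IsStronglyConnected.one_le_inDegree [Fintype E] [Nonempty V] {Γ : PointedGraph V E}
    (h : Γ.IsStronglyConnected) (a : Option V) : 1 ≤ Γ.inDegree a := by
  classical
  obtain ⟨b, hb⟩ := exists_ne a
  rcases Relation.ReflTransGen.cases_tail (h b a) with hab | ⟨c, -, ⟨e, -, he⟩⟩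
  · exact absurd hab hb.symm
  · exact Finset.card_pos.2 ⟨e, by simpa using he⟩

theorem sum_outDegree [Fintype V] [Fintype E] (Γ : PointedGraph V E) :
    ∑ a, Γ.outDegree a = Fintype.card E := by
  classical
  rw [← Finset.card_univ,
    Finset.card_eq_sum_card_fiberwise (f := Γ.src) (t := Finset.univ) (by simp)]
  refine Finset.sum_congr rfl fun a _ => ?_
  unfold outDegree
  congr 1

theorem sum_inDegree [Fintype V] [Fintype E] (Γ : PointedGraph V E) :
    ∑ a, Γ.inDegree a = Fintype.card E := by
  classical
  rw [← Finset.card_univ,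
    Finset.card_eq_sum_card_fiberwise (f := Γ.tgt) (t := Finset.univ) (by simp)]
  refine Finset.sum_congr rfl fun a _ => ?_
  unfold inDegree
  congr 1

theorem outDegree_eq_one_iff [Fintype E] {Γ : PointedGraph V E} {a : Option V} :
    Γ.outDegree a = 1 ↔ ∃ e, ∀ x, Γ.src x = a ↔ x = e := by
  classical
  rw [outDegree, Finset.card_eq_one]
  refine exists_congr fun e => ?_
  rw [Finset.ext_iff]
  simp

theorem inDegree_eq_one_iff [Fintype E] {Γ : PointedGraph V E} {a : Option V} :
    Γ.inDegree a = 1 ↔ ∃ e, ∀ x, Γ.tgt x = a ↔ x = e := by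
  classical
  rw [inDegree, Finset.card_eq_one]
  refine exists_congr fun e => ?_
  rw [Finset.ext_iff]
  simp

/-! ### Smoothing out a vertex -/

theorem earCount_zero_of_ne_univ [Fintype E] (Γ : PointedGraph V E) (k : ℕ)
    (S W X : Set (Option V)) {A : Set E} (hA : A ≠ Set.univ) : Γ.earCount k 0 S W X A = 0 := by
  cases k <;> simp [earCount, hA]

theorem map_val_dropVertex {v : V} {a : Option V} (ha : a ≠ some v) :
    (dropVertex v a).map Subtype.val = a := by
  match a with
  | none => rfl
  | some u =>
    have hu : u ≠ v := fun h => ha (by rw [h])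
    simp [dropVertex, hu]

section smooth

variable [Fintype E] {Γ : PointedGraph V E} {v : V} {e f : E} [Fintype {x : E // x ≠ f}]

-- An ear that enters `v` by `e` has to leave it by `f` at once, so the two edges are traversed
-- together and correspond to the edge `e` of the smoothed graph. The hypotheses on the sets exclude
-- the state between `e` and `f`: `v` is reached, and `f` is used, exactly when `e` is used. The
-- term `if e ∈ A then 0 else 1` is the extra edge that `Γ` still has to spend.
open Classical in
theorem earCount_smooth_aux (hs : ∀ x, Γ.src x = some v ↔ x = f)
    (ht : ∀ x, Γ.tgt x = some v ↔ x = e) (hef : e ≠ f) (m k : ℕ) (S W X : Set (Option V))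
    (A : Set E) (hX : some v ∈ X ↔ e ∈ A) (hA : f ∈ A ↔ e ∈ A) (hS : some v ∈ S → e ∈ A)
    (hW : some v ∈ W → e ∈ A) :
    Γ.earCount k (m + if e ∈ A then 0 else 1) S W X A =
      (Γ.smooth v f).earCount k m (Option.map Subtype.val ⁻¹' S) (Option.map Subtype.val ⁻¹' W)
        (Option.map Subtype.val ⁻¹' X) (Subtype.val ⁻¹' A) := by
  have hinj : Function.Injective (Option.map (Subtype.val : {u : V // u ≠ v} → V)) :=
    Option.map_injective Subtype.val_injective
  have hsrc : ∀ x : {x // x ≠ f}, ((Γ.smooth v f).src x).map Subtype.val = Γ.src x := fun x =>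
    map_val_dropVertex fun h => x.2 ((hs x).1 h)
  have htf : Γ.tgt f ≠ some v := fun h => hef ((ht f).1 h).symm
  have htgt : ∀ x : {x // x ≠ f}, x.1 ≠ e →
      ((Γ.smooth v f).tgt x).map Subtype.val = Γ.tgt x := fun x hx => by
    have h : Γ.tgt x ≠ some v := fun h => hx ((ht x).1 h)
    simp only [smooth, h, if_false]
    exact map_val_dropVertex h
  have htgte : ((Γ.smooth v f).tgt ⟨e, hef⟩).map Subtype.val = Γ.tgt f := by
    simp only [smooth, (ht e).2 rfl, if_true]
    exact map_val_dropVertex htf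
  have hpre : ∀ (a : Option {u : V // u ≠ v}) (Y : Set (Option V)),
      insert a (Option.map Subtype.val ⁻¹' Y) =
        Option.map Subtype.val ⁻¹' (insert (a.map Subtype.val) Y) := fun a Y => by
    ext b
    simp only [Set.mem_insert_iff, Set.mem_preimage, hinj.eq_iff]
  have hpre' : ∀ a : Option {u : V // u ≠ v},
      ({a} : Set _) = Option.map Subtype.val ⁻¹' {a.map Subtype.val} := fun a => by
    ext b
    simp only [Set.mem_preimage, Set.mem_singleton_iff, hinj.eq_iff]
  have hprev : ∀ Y : Set (Option V),
      (Option.map Subtype.val ⁻¹' (insert (some v) Y) : Set (Option {u : V // u ≠ v})) =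
        Option.map Subtype.val ⁻¹' Y := fun Y => by
    ext b
    match b with
    | none => simp
    | some u => simp [u.2]
  have hpreE : ∀ (x : {x // x ≠ f}) (Y : Set E),
      insert x (Subtype.val ⁻¹' Y) = (Subtype.val ⁻¹' (insert x.1 Y) : Set {x // x ≠ f}) :=
    fun x Y => by
      ext b
      simp [Subtype.ext_iff]
  have hpreEf : ∀ Y : Set E,
      (Subtype.val ⁻¹' (insert f Y) : Set {x // x ≠ f}) = Subtype.val ⁻¹' Y := fun Y => by
    ext b
    simp [b.2]
  induction m generalizing k S W X A with
  | zero =>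
    by_cases he : e ∈ A
    · rw [if_pos he]
      cases k with
      | succ k => simp [earCount]
      | zero =>
        rw [earCount_zero_left, earCount_zero_left]
        refine if_congr (and_congr_right fun _ => and_congr ?_ ?_) rfl rfl
        · constructor
          · rintro rfl
            rfl
          · intro h
            rw [Set.eq_univ_iff_forall] at h ⊢
            intro a
            by_cases ha : a = some v
            · exact ha ▸ hX.2 he
            · have := h (dropVertex v a)
              rwa [Set.mem_preimage, map_val_dropVertex ha] at this
        · constructor
          · rintro rfl
            rfl
          · intro h
            rw [Set.eq_univ_iff_forall] at h ⊢
            intro a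
            by_cases ha : a = f
            · exact ha ▸ hA.2 he
            · exact h ⟨a, ha⟩
    -- A single step remains while both `e` and `f` are unused, so both sides vanish.
    · rw [if_neg he, earCount_zero_of_ne_univ]
      · cases k with
        | zero => rfl
        | succ k =>
          have hne : ∀ x, insert x A ≠ Set.univ := fun x h => by
            have h1 : e ∈ insert x A := h ▸ Set.mem_univ _
            have h2 : f ∈ insert x A := h ▸ Set.mem_univ _
            rw [Set.mem_insert_iff, or_iff_left he] at h1
            rw [Set.mem_insert_iff, or_iff_left (fun h => he (hA.1 h))] at h2
            exact hef (h1.trans h2.symm)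
          rw [earCount]
          refine Finset.sum_eq_zero fun x _ => ?_
          simp [earCount_zero_of_ne_univ, hne]
      · intro h
        have : (⟨e, hef⟩ : {x // x ≠ f}) ∈ (Subtype.val ⁻¹' A : Set {x // x ≠ f}) :=
          h ▸ Set.mem_univ _
        exact he this
  | succ m ih =>
    cases k with
    | zero =>
      rw [Nat.add_right_comm]
      rfl
    | succ k =>
      have hsum : ∀ F : E → ℕ, ∑ x, F x = F f + ∑ x : {x : E // x ≠ f}, F x := fun F => by
        rw [Fintype.sum_eq_add_sum_subtype_ne F f]
        congr!
      rw [Nat.add_right_comm, earCount, earCount, hsum]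
      -- In such a state `f` cannot be the next edge: standing at `v` means that `e`, and therefore
      -- `f`, has been used.
      have hf0 : ¬ (f ∉ A ∧ Γ.src f ∈ S) := fun h =>
        h.1 (hA.2 (hS ((hs f).2 rfl ▸ h.2)))
      rw [if_neg hf0, zero_add]
      refine Finset.sum_congr rfl fun x _ => ?_
      have hc : (x.1 ∉ A ∧ Γ.src x ∈ S) ↔ (x ∉ (Subtype.val ⁻¹' A : Set {x // x ≠ f}) ∧
          (Γ.smooth v f).src x ∈ (Option.map Subtype.val ⁻¹' S : Set (Option {u // u ≠ v}))) := by
        rw [Set.mem_preimage, Set.mem_preimage, hsrc]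
      by_cases hx : x.1 ∉ A ∧ Γ.src x ∈ S
      swap
      · rw [if_neg hx, if_neg (mt hc.2 hx)]
      rw [if_pos hx, if_pos (hc.1 hx)]
      by_cases hxe : x.1 = e
      · have he : e ∉ A := hxe ▸ hx.1
        obtain rfl : x = ⟨e, hef⟩ := Subtype.ext hxe
        have htv : Γ.tgt e = some v := (ht e).2 rfl
        simp only [htv, mt hW he, mt hX.1 he, if_false, not_false_eq_true, if_true, he]
        -- After `e` the only admissible start is `v`, so the next edge is `f`. This second step
        -- spends the extra edge and restores the invariant.
        rw [earCount, Finset.sum_eq_single_of_mem f (Finset.mem_univ _)]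
        swap
        · intro y _ hy
          refine if_neg fun h => hy ((hs y).1 h.2)
        have hfA : f ∉ insert e A := by
          rw [Set.mem_insert_iff, not_or]
          exact ⟨hef.symm, mt hA.1 he⟩
        rw [if_pos ⟨hfA, (hs f).2 rfl⟩]
        have hi1 : Γ.tgt f ∈ insert (some v) X ↔ Γ.tgt f ∈ X := by
          rw [Set.mem_insert_iff, or_iff_right htf]
        have he' : e ∈ insert f (insert e A) := by simp
        rw [hpreE, ← hpreEf]
        simp only [Set.mem_preimage, htgte, hi1]
        split_ifs with h1 h2
        · have := ih k (insert (some v) X) (insert (some v) X) (insert (some v) X)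
            (insert f (insert e A)) (by simp) (by simp) (by simp) (by simp)
          rw [if_pos he', add_zero, hprev] at this
          exact this
        · rfl
        · have := ih (k + 1) {Γ.tgt f} W (insert (Γ.tgt f) (insert (some v) X))
            (insert f (insert e A)) (by simp) (by simp) (by simp) (by simp)
          rw [if_pos he', add_zero] at this
          rw [this, hpre', hpre, htgte, ← hprev (insert _ X), Set.insert_comm]
      · have htx : Γ.tgt x ≠ some v := fun h => hxe ((ht x).1 h)
        have hAe : e ∈ insert x.1 A ↔ e ∈ A := by
          rw [Set.mem_insert_iff, or_iff_right (Ne.symm hxe)]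
        have hAf : f ∈ insert x.1 A ↔ f ∈ A := by
          rw [Set.mem_insert_iff, or_iff_right (Ne.symm x.2)]
        have hif : (if e ∈ A then 0 else 1) =
            @ite ℕ (e ∈ insert x.1 A) (Classical.propDecidable _) 0 1 := by
          by_cases h : e ∈ A
          · rw [if_pos h, if_pos (hAe.2 h)]
          · rw [if_neg h, if_neg (mt hAe.1 h)]
        rw [hpreE, hif]
        simp only [Set.mem_preimage, htgt x hxe]
        by_cases h1 : Γ.tgt x ∈ W
        · rw [if_pos h1, if_pos h1]
          exact ih k X X X (insert x.1 A) (by rw [hAe, hX]) (by rw [hAe, hAf, hA])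
            (by rw [hAe, hX]; exact id) (by rw [hAe, hX]; exact id)
        · rw [if_neg h1, if_neg h1]
          by_cases h2 : Γ.tgt x ∈ X
          · rw [if_neg (not_not.2 h2), if_neg (not_not.2 h2)]
          · rw [if_pos h2, if_pos h2, hpre', hpre, htgt x hxe]
            refine ih (k + 1) {Γ.tgt x} W (insert (Γ.tgt x) X) (insert x.1 A) ?_
              (by rw [hAe, hAf, hA]) (fun h => absurd h htx.symm) (by rw [hAe]; exact hW)
            rw [hAe, Set.mem_insert_iff, or_iff_right htx.symm, hX]

/-- The `Fintype` instance on the remaining edges is arbitrary, so that the equation also fits the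
instance inside `phi`. -/
theorem earCount_smooth (hs : ∀ x, Γ.src x = some v ↔ x = f)
    (ht : ∀ x, Γ.tgt x = some v ↔ x = e) (hef : e ≠ f) (m k : ℕ) :
    Γ.earCount k (m + 1) {none} {none} {none} ∅ =
      (Γ.smooth v f).earCount k m {none} {none} {none} ∅ := by
  classical
  have := earCount_smooth_aux hs ht hef m k {none} {none} {none} ∅ (by simp) (by simp) (by simp)
    (by simp)
  have h0 : (Option.map Subtype.val ⁻¹' {none} : Set (Option {u : V // u ≠ v})) = {none} := by
    ext a
    cases a <;> simp
  rw [h0] at this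
  simpa using this

end smooth

/-! ### Deleting an edge -/

section delete

variable [Fintype E]

/-- The isomorphisms onto the graph without the edge `e` are the embeddings which only miss `e`. -/
def isoDeleteEdgeEquiv {Γ₀ : PointedGraph V' E'} {Γ : PointedGraph V E} (e : E) :
    Iso Γ₀ (Γ.deleteEdge e) ≃
      {j : Emb Γ₀ Γ // j.vertices = Set.univ ∧ j.edges = {e}ᶜ} :=
  Equiv.ofBijective
    (fun σ => ⟨⟨σ.vert.toEmbedding,
        ⟨fun x => (σ.edge x).1, Subtype.val_injective.comp σ.edge.injective⟩,
        σ.src_eq, σ.tgt_eq⟩, by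
      refine ⟨Set.range_eq_univ.2 fun a => ⟨a.map σ.vert.symm, ?_⟩, ?_⟩
      · cases a <;> simp
      · ext x
        simp only [Emb.edges, Function.Embedding.coeFn_mk, Set.mem_range, Set.mem_compl_iff,
          Set.mem_singleton_iff]
        exact ⟨fun ⟨y, hy⟩ => hy ▸ (σ.edge y).2, fun h => ⟨σ.edge.symm ⟨x, h⟩, by simp⟩⟩⟩) <| by
    constructor
    · intro σ τ h
      have h' := Subtype.ext_iff.1 h
      refine Iso.ext (Equiv.toEmbedding_injective (congrArg Emb.vert h'))
        (Equiv.ext fun x => Subtype.ext ?_)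
      exact DFunLike.congr_fun (congrArg Emb.edge h') x
    · rintro ⟨j, h1, h2⟩
      have hv : Function.Surjective j.vert := fun v => by
        obtain ⟨a, ha⟩ := Set.range_eq_univ.1 h1 (some v)
        cases a with
        | none => simp at ha
        | some a => exact ⟨a, by simpa using ha⟩
      have he : ∀ x, j.edge x ≠ e := fun x => by
        have : j.edge x ∈ j.edges := ⟨x, rfl⟩
        rw [h2] at this
        exact this
      refine ⟨⟨Equiv.ofBijective j.vert ⟨j.vert.injective, hv⟩,
        Equiv.ofBijective (fun x => ⟨j.edge x, he x⟩) ⟨fun x y hxy => ?_, fun x => ?_⟩,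
        j.src_eq, j.tgt_eq⟩, by ext <;> rfl⟩
      · exact j.edge.injective (Subtype.ext_iff.1 hxy)
      · have : x.1 ∈ j.edges := h2 ▸ x.2
        obtain ⟨y, hy⟩ := this
        exact ⟨y, Subtype.ext hy⟩

/-- An ear without interior vertices is one edge. Its image is some edge `e` of `Γ`, and the rest of
the isomorphism is one onto `Γ` without `e`. -/
theorem sum_card_iso_addEar_zero [Fintype V] (S : FinGraph) (Γ : PointedGraph V E) :
    ∑ s, ∑ t, Nat.card (Iso (S.addEar 0 s t).graph Γ) =
      ∑ e : E, Nat.card (Iso S.graph (Γ.deleteEdge e)) := by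
  classical
  have h := sum_emb_addEar S.graph Γ 0 fun X A => if X = Set.univ ∧ A = Set.univ then 1 else 0
  have hl : ∀ s t, Nat.card (Iso (S.addEar 0 s t).graph Γ) =
      ∑ j : Emb (S.graph.addEar 0 s t) Γ,
        if j.vertices = Set.univ ∧ j.edges = Set.univ then 1 else 0 := fun s t => by
    rw [← Finset.card_filter, ← Fintype.card_subtype, ← Nat.card_eq_fintype_card]
    exact Nat.card_congr Emb.isoEquiv
  simp_rw [hl]
  rw [h, Finset.sum_congr rfl fun j _ => (Fintype.sum_equiv (Equiv.funUnique (Fin 1) E).symm _ _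
    fun e => rfl).symm, Finset.sum_comm]
  refine Finset.sum_congr rfl fun e _ => ?_
  rw [Nat.card_congr (isoDeleteEdgeEquiv e), Nat.card_eq_fintype_card, Fintype.card_subtype,
    Finset.card_filter]
  refine Finset.sum_congr rfl fun j _ => ?_
  have he : (Equiv.funUnique (Fin 1) E).symm e = fun _ => e := rfl
  have hi : Γ.interior (n := 0) (fun _ => e) = ∅ := Set.range_eq_empty _
  rw [he]
  rw [hi, Set.union_empty, Set.range_const, ← ite_and]
  refine if_congr ?_ rfl rfl
  rw [isEar_const_iff, Set.union_singleton]
  constructor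
  · rintro ⟨⟨⟨h1, -⟩, -⟩, h2, h3⟩
    refine ⟨h2, ?_⟩
    ext x
    rw [Set.mem_compl_iff, Set.mem_singleton_iff]
    constructor
    · rintro hx rfl
      exact h1 hx
    · intro hx
      have : x ∈ insert e j.edges := h3 ▸ Set.mem_univ x
      exact this.resolve_left hx
  · rintro ⟨h1, h2⟩
    rw [h1, h2]
    simp [Set.insert_eq]

/-- The first interior vertex of the ear has just the two edges of the ear next to it. -/
theorem isSmoothable_of_iso_addEar {S : FinGraph} {Γ : PointedGraph V E} {n : ℕ}
    {s t : Option S.V} (σ : Iso (S.addEar (n + 1) s t).graph Γ) :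
    ∃ p : V × E, Γ.IsSmoothable p := by
  have ho : (S.graph.addEar (n + 1) s t).outDegree (some (Sum.inr 0)) = 1 := by
    rw [outDegree_eq_one_iff]
    refine ⟨Sum.inr (Fin.succ 0), ?_⟩
    rintro (x | x)
    · simp
    · cases x using Fin.cases with
      | zero => simp
      | succ i =>
        rw [addEar_src_succ, Option.some_inj, Sum.inr.injEq, Sum.inr.injEq, Fin.succ_inj]
  have hi : (S.graph.addEar (n + 1) s t).inDegree (some (Sum.inr 0)) = 1 := by
    rw [inDegree_eq_one_iff]
    refine ⟨Sum.inr (Fin.castSucc 0), ?_⟩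
    rintro (x | x)
    · simp
    · cases x using Fin.lastCases with
      | last => simp [Fin.ext_iff]
      | cast i => simp
  refine ⟨(σ.vert (Sum.inr 0), σ.edge (Sum.inr (Fin.succ 0))), ?_, ?_, ?_⟩
  · exact (σ.outDegree_eq (some (Sum.inr 0))).trans ho
  · exact (σ.inDegree_eq (some (Sum.inr 0))).trans hi
  · exact σ.src_eq _

/-- Both sides become sums over isomorphisms from ear-built graphs, where the last ear is visible.
Its interior vertices would be smoothable in `Γ`, so it is a single edge. -/
theorem earCount_deleteEdge [Fintype V] (Γ : PointedGraph V E) (h : ¬ ∃ p : V × E, Γ.IsSmoothable p)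
    {m : ℕ} (hm : Fintype.card E = m + 1) (k : ℕ)
    [∀ e : E, Fintype {x : E // x ≠ e}] :
    Γ.earCount (k + 1) (m + 1) {none} {none} {none} ∅ =
      ∑ e : E, (Γ.deleteEdge e).earCount k m {none} {none} {none} ∅ := by
  classical
  have hcard : ∀ e : E, Fintype.card {x : E // x ≠ e} = m := fun e => by
    have := Fintype.card_subtype_compl (fun x : E => x = e)
    simp only [Fintype.card_unique] at this
    rwa [hm, Nat.add_sub_cancel] at this
  have h1 := sum_card_iso_ears_point Γ (B := m + 1) hm.le (k + 1)
  rw [hm] at h1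
  have h2 : ∀ e : E, _ := fun e => sum_card_iso_ears_point (Γ.deleteEdge e) (B := m + 1)
    (by rw [hcard]; omega) k
  simp_rw [hcard] at h2
  simp_rw [← h2]
  rw [← h1, FinGraph.sum_map_ears_succ', ← Multiset.sum_map_sum]
  congr 1
  refine Multiset.map_congr rfl fun T _ => ?_
  rw [Finset.sum_eq_single_of_mem (0 : Fin (m + 1)) (Finset.mem_univ _)]
  · exact sum_card_iso_addEar_zero T Γ
  · rintro ⟨n, hn⟩ - hne
    obtain ⟨n, rfl⟩ := Nat.exists_eq_succ_of_ne_zero (fun h0 : n = 0 => hne (Fin.ext h0))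
    refine Finset.sum_eq_zero fun s _ => Finset.sum_eq_zero fun t _ => ?_
    rw [Nat.card_eq_zero]
    exact Or.inl ⟨fun σ => h (isSmoothable_of_iso_addEar σ)⟩

end delete

/-! ### The number of strong reductions counts ear decompositions -/

theorem earCount_eq_zero [Fintype V] [Fintype E] {Γ : PointedGraph V E}
    (h : ¬ Γ.IsStronglyConnected) (k : ℕ) :
    Γ.earCount k (Fintype.card E) {none} {none} {none} ∅ = 0 := by
  rw [← sum_card_iso_ears_point Γ le_rfl, Multiset.sum_eq_zero]
  intro x hx
  obtain ⟨T, hT, rfl⟩ := Multiset.mem_map.1 hx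
  rw [Nat.card_eq_zero]
  exact Or.inl ⟨fun σ => h (σ.isStronglyConnected (FinGraph.isStronglyConnected_of_mem_ears hT))⟩

theorem IsStronglyConnected.card_lt [Fintype V] [Fintype E] [Nonempty V] {Γ : PointedGraph V E}
    (h : Γ.IsStronglyConnected) : Fintype.card V < Fintype.card E := by
  rw [← Γ.sum_outDegree, Nat.lt_iff_add_one_le, ← Fintype.card_option, ← Finset.card_univ,
    Finset.card_eq_sum_ones]
  exact Finset.sum_le_sum fun a _ => h.one_le_outDegree a

/-- If the inward and the outward edge coincided, they would be a loop, and no path could lead from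
the vertex to the distinguished one. -/
theorem IsSmoothable.exists_inward [Fintype E] {Γ : PointedGraph V E} {p : V × E}
    (hp : Γ.IsSmoothable p) (h : Γ.IsStronglyConnected) :
    (∀ x, Γ.src x = some p.1 ↔ x = p.2) ∧
      ∃ e, (∀ x, Γ.tgt x = some p.1 ↔ x = e) ∧ e ≠ p.2 := by
  obtain ⟨h1, h2, h3⟩ := hp
  obtain ⟨f, hf⟩ := outDegree_eq_one_iff.1 h1
  obtain ⟨e, he⟩ := inDegree_eq_one_iff.1 h2
  obtain rfl : p.2 = f := (hf _).1 h3
  refine ⟨hf, e, he, ?_⟩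
  rintro rfl
  have key : ∀ b, Relation.ReflTransGen (fun u v => ∃ e, Γ.src e = u ∧ Γ.tgt e = v)
      (some p.1) b → b = some p.1 := by
    intro b hb
    induction hb with
    | refl => rfl
    | tail _ hbc ih =>
      obtain ⟨x, hx, rfl⟩ := hbc
      rw [ih] at hx
      exact (he x).2 ((hf x).1 hx)
  simpa using key none (h _ _)

/-- Induction on the number of edges along the rules that define `phi`, each of which is an identity
for the count. Smoothing preserves the weight `k`; deletion lowers it by one. -/
theorem phi_eq_earCount [Fintype V] [Fintype E] (Γ : PointedGraph V E) {k : ℕ}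
    (hk : Fintype.card E = Fintype.card V + k) :
    Γ.phi = Γ.earCount k (Fintype.card E) {none} {none} {none} ∅ := by
  classical
  obtain ⟨m, hm⟩ : ∃ m, Fintype.card E = m := ⟨_, rfl⟩
  induction m generalizing V E k with
  | zero =>
    by_cases hsc : Γ.IsStronglyConnected
    · have hV : Fintype.card V = 0 := by omega
      have hVe : IsEmpty V := Fintype.card_eq_zero_iff.1 hV
      have hEe : IsEmpty E := Fintype.card_eq_zero_iff.1 hm
      obtain rfl : k = 0 := by omega
      rw [phi, if_neg (not_not.2 hsc), if_pos hVe, hm, earCount_zero_left, if_pos]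
      · rfl
      · refine ⟨rfl, ?_, Subsingleton.elim _ _⟩
        ext a
        cases a with
        | none => simp
        | some v => exact hVe.elim v
    · rw [phi, if_pos hsc, earCount_eq_zero hsc]
  | succ m ih =>
    by_cases hsc : Γ.IsStronglyConnected
    swap
    · rw [phi, if_pos hsc, earCount_eq_zero hsc]
    rw [phi, if_neg (not_not.2 hsc)]
    have hcard : ∀ e : E, Fintype.card {x : E // x ≠ e} = m := fun e => by
      have := Fintype.card_subtype_compl (fun x : E => x = e)
      simp only [Fintype.card_unique] at this
      rwa [hm, Nat.add_sub_cancel] at this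
    by_cases hV : IsEmpty V
    · rw [if_pos hV, hm]
      have hV0 : Fintype.card V = 0 := Fintype.card_eq_zero_iff.2 hV
      obtain rfl : k = m + 1 := by omega
      -- Loops only: with no ordinary vertex there is nothing to smooth out, so the deletion rule
      -- yields the factor `m + 1` of the factorial.
      rw [earCount_deleteEdge Γ (fun ⟨p, _⟩ => hV.elim p.1) hm m]
      have : ∀ e : E, (Γ.deleteEdge e).earCount m m {none} {none} {none} ∅ = m.factorial := by
        intro e
        have h1 := ih (k := m) (Γ.deleteEdge e) (by rw [hcard, hV0, zero_add]) (hcard e)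
        rw [hcard] at h1
        rw [← h1, phi, if_neg (not_not.2 _), if_pos hV, hcard]
        intro a b
        match a, b with
        | none, none => exact Relation.ReflTransGen.refl
        | some i, _ => exact hV.elim i
        | _, some i => exact hV.elim i
      rw [Finset.sum_congr rfl fun e _ => this e, Finset.sum_const, Finset.card_univ, hm,
        smul_eq_mul, Nat.factorial_succ]
    · rw [if_neg hV]
      rw [not_isEmpty_iff] at hV
      split_ifs with hp
      · obtain ⟨hs, e, ht, hef⟩ := (Classical.choose_spec hp).exists_inward hsc
        rw [hm, earCount_smooth hs ht hef]
        have hV' : Fintype.card {u : V // u ≠ (Classical.choose hp).1} = Fintype.card V - 1 := by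
          have := Fintype.card_subtype_compl (fun x : V => x = (Classical.choose hp).1)
          simp only [Fintype.card_unique] at this
          exact this
        have hVpos : 0 < Fintype.card V := Fintype.card_pos
        have := ih (k := k) (Γ.smooth (Classical.choose hp).1 (Classical.choose hp).2)
          (by rw [hcard, hV']; omega) (hcard _)
        rw [hcard] at this
        rw [← this]
      · have hlt := hsc.card_lt
        -- A strongly connected graph with an ordinary vertex has positive weight, so there is a
        -- last ear to remove.
        obtain ⟨k, rfl⟩ := Nat.exists_eq_succ_of_ne_zero (show k ≠ 0 by omega)
        rw [hm, earCount_deleteEdge Γ hp hm k]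
        refine Finset.sum_congr rfl fun e _ => ?_
        have := ih (k := k) (Γ.deleteEdge e) (by rw [hcard]; omega) (hcard e)
        rw [hcard] at this
        rw [← this]

/-- The number of strong reductions is the number of isomorphisms from the graphs which are
built by adding ears. -/
theorem phi_eq_sum_card_iso [Fintype V] [Fintype E] (Γ : PointedGraph V E) {k B : ℕ}
    (hk : Fintype.card E = Fintype.card V + k) (hB : Fintype.card E ≤ B) :
    Γ.phi = ((FinGraph.point.ears B k).map fun T => Nat.card (Iso T.graph Γ)).sum := by
  rw [sum_card_iso_ears_point Γ hB, phi_eq_earCount Γ hk]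

end PointedGraph

namespace PointedGraph

variable {V E : Type}

/-! ### Sums over isomorphism classes -/

theorem IsoClass.eq_of_iso {c c' : IsoClass} (σ : Iso c.rep c'.rep) : c = c' := by
  obtain ⟨⟨n, m⟩, q⟩ := c
  obtain ⟨⟨n', m'⟩, q'⟩ := c'
  obtain rfl : n = n' := by simpa using Fintype.card_congr σ.vert
  obtain rfl : m = m' := by simpa using Fintype.card_congr σ.edge
  have : q = q' := by
    rw [← Quotient.out_eq q, ← Quotient.out_eq q']
    exact Quotient.sound ⟨σ⟩
  rw [this]

theorem exists_iso_rep [Fintype V] [Fintype E] (Γ : PointedGraph V E) :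
    ∃ c : IsoClass, Nonempty (Iso Γ c.rep) := by
  let a := Fintype.equivFin V
  let b := Fintype.equivFin E
  let Γ' : PointedGraph (Fin (Fintype.card V)) (Fin (Fintype.card E)) :=
    ⟨fun e => (Γ.src (b.symm e)).map a, fun e => (Γ.tgt (b.symm e)).map a⟩
  have σ : Iso Γ Γ' := ⟨a, b, fun e => by simp [Γ'], fun e => by simp [Γ']⟩
  obtain ⟨τ⟩ : Nonempty (Iso (Quotient.out (⟦Γ'⟧ : Quotient (isoSetoid _ _))) Γ') :=
    Quotient.mk_out Γ'
  exact ⟨⟨(_, _), ⟦Γ'⟧⟩, ⟨σ.trans τ.symm⟩⟩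

theorem weight_eq_iff [Fintype V] [Fintype E] (Γ : PointedGraph V E) (k : ℕ) :
    Γ.weight = k ↔ Fintype.card E = Fintype.card V + k := by
  unfold weight
  omega

theorem autCard_pos [Finite V] [Finite E] (Γ : PointedGraph V E) : 0 < Γ.autCard := by
  have : Nonempty (Iso Γ Γ) := ⟨Iso.refl Γ⟩
  exact Nat.card_pos

/-- Only the class of `Γ` contributes, and for its representative the isomorphisms from `Γ` are as
many as the automorphisms. This distributes a term attached to a single graph over the classes and
creates the denominators `autCard`. -/
theorem sum_strongStable_card_iso [Fintype V] [Fintype E] (Γ : PointedGraph V E) {k : ℕ}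
    (hsc : Γ.IsStronglyConnected) (hst : Γ.IsStable)
    (hk : Fintype.card E = Fintype.card V + k) (Θ : IsoClass → ℂ) (x : ℂ)
    (hx : ∀ c : IsoClass, Iso Γ c.rep → Θ c = x) :
    ∑ c ∈ (finite_strongStable k).toFinset,
      (Nat.card (Iso Γ c.rep) : ℂ) / (c.rep.autCard : ℂ) * Θ c = x := by
  obtain ⟨c, ⟨σ⟩⟩ := exists_iso_rep Γ
  have hc : c ∈ (finite_strongStable k).toFinset := by
    rw [Set.Finite.mem_toFinset]
    refine ⟨σ.isStronglyConnected hsc, σ.isStable hst, ?_⟩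
    rw [weight_eq_iff, ← Fintype.card_congr σ.vert, ← Fintype.card_congr σ.edge, hk]
  rw [Finset.sum_eq_single_of_mem c hc]
  · rw [hx c σ, Nat.card_congr σ.congrLeft]
    have : (c.rep.autCard : ℂ) ≠ 0 := Nat.cast_ne_zero.2 (autCard_pos _).ne'
    unfold autCard at this ⊢
    rw [div_self this, one_mul]
  · intro c' _ hne
    have : Nat.card (Iso Γ c'.rep) = 0 := by
      rw [Nat.card_eq_zero]
      exact Or.inl ⟨fun τ => hne (IsoClass.eq_of_iso (τ.symm.trans σ))⟩
    rw [this]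
    simp

/-- The sum of an isomorphism invariant, supported on the stable graphs, over the graphs which are
built by adding `k` ears, is a sum over the strongly connected stable graphs of weight `k`. -/
theorem sum_ears_eq_sum_strongStable {k B : ℕ} (hB : 2 * k ≤ B) (Θ : FinGraph → ℂ)
    (hΘ : ∀ S T : FinGraph, Iso S.graph T.graph → Θ S = Θ T)
    (h0 : ∀ T ∈ FinGraph.point.ears B k, ¬ T.graph.IsStable → Θ T = 0) :
    ((FinGraph.point.ears B k).map Θ).sum =
      ∑ c ∈ (finite_strongStable k).toFinset,
        (c.rep.phi : ℂ) / (c.rep.autCard : ℂ) * Θ ⟨_, _, c.rep⟩ := by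
  have h1 : ∀ T ∈ FinGraph.point.ears B k, Θ T = ∑ c ∈ (finite_strongStable k).toFinset,
      (Nat.card (Iso T.graph c.rep) : ℂ) / (c.rep.autCard : ℂ) * Θ ⟨_, _, c.rep⟩ := by
    intro T hT
    by_cases hst : T.graph.IsStable
    · exact (sum_strongStable_card_iso T.graph (FinGraph.isStronglyConnected_of_mem_ears hT) hst
        (FinGraph.card_edges_of_mem_ears hT) (fun c => Θ ⟨_, _, c.rep⟩) _
        fun c σ => (hΘ T ⟨_, _, c.rep⟩ σ).symm).symm
    · rw [h0 T hT hst, Finset.sum_eq_zero]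
      intro c hc
      rw [Set.Finite.mem_toFinset] at hc
      have : Nat.card (Iso T.graph c.rep) = 0 := by
        rw [Nat.card_eq_zero]
        exact Or.inl ⟨fun σ => hst (σ.symm.isStable hc.2.1)⟩
      rw [this]
      simp
  rw [Multiset.map_congr rfl h1, Multiset.sum_map_sum]
  refine Finset.sum_congr rfl fun c hc => ?_
  rw [Set.Finite.mem_toFinset] at hc
  have hk := (weight_eq_iff _ _).1 hc.2.2
  have hcE := hc.2.1.two_mul_card_le
  rw [Multiset.sum_map_mul_right]
  congr 1
  -- Stability gives 2|V| ≤ |E| = |V| + k, hence |E| ≤ 2k ≤ B.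
  rw [phi_eq_sum_card_iso c.rep hk (B := B) (by omega)]
  simp_rw [div_eq_mul_inv]
  rw [Multiset.sum_map_mul_right, Nat.cast_multiset_sum, Multiset.map_map]
  rfl

end PointedGraph

/-! ### Derivations of products -/

section Leibniz

variable {R A : Type*} [CommRing R] [CommRing A] [Algebra R A]

/-- With the case distinction inside, each summand is again a product over the same index set, so a
second derivation can choose its factor independently. -/
theorem Derivation.finset_prod {ι : Type*} [DecidableEq ι] (D : Derivation R A A) (s : Finset ι)
    (u : ι → A) :
    D (∏ y ∈ s, u y) = ∑ x ∈ s, ∏ y ∈ s, if y = x then D (u y) else u y := by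
  induction s using Finset.induction with
  | empty => simp
  | insert a s ha ih =>
    rw [Finset.prod_insert ha, D.leibniz, ih, Finset.sum_insert ha, Finset.prod_insert ha,
      if_pos rfl, smul_eq_mul, smul_eq_mul, Finset.mul_sum, add_comm]
    congr 1
    · rw [mul_comm]
      congr 1
      refine Finset.prod_congr rfl fun y hy => ?_
      rw [if_neg fun h : y = a => ha (h ▸ hy)]
    · refine Finset.sum_congr rfl fun x hx => ?_
      rw [Finset.prod_insert ha, if_neg fun h : a = x => ha (h ▸ hx)]

/-- By the Leibniz rule only one of the `n + 1` factors is differentiated. -/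
theorem Derivation.apply_mem_ideal_pow (D : Derivation R A A) (I : Ideal A) (n : ℕ) {x : A}
    (hx : x ∈ I ^ (n + 1)) : D x ∈ I ^ n := by
  induction n generalizing x with
  | zero => simp
  | succ n ih =>
    rw [pow_succ] at hx
    refine Submodule.mul_induction_on hx (fun a ha b hb => ?_) fun a b ha hb => ?_
    · rw [D.leibniz, smul_eq_mul, smul_eq_mul]
      refine add_mem (Ideal.mul_mem_right _ _ ha) ?_
      rw [pow_succ, mul_comm b]
      exact Ideal.mul_mem_mul (ih ha) hb
    · rw [map_add]
      exact add_mem ha hb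

theorem Matrix.pow_apply_mem_ideal_pow {ι : Type*} [Fintype ι] [DecidableEq ι] (I : Ideal A)
    {M : Matrix ι ι A} (hM : ∀ i j, M i j ∈ I) (n : ℕ) (i j : ι) : (M ^ n) i j ∈ I ^ n := by
  induction n generalizing i j with
  | zero => simp
  | succ n ih =>
    rw [pow_succ M, Matrix.mul_apply, pow_succ I]
    exact Ideal.sum_mem _ fun l _ => Ideal.mul_mem_mul (ih i l) (hM l j)

end Leibniz

/-- The sum over the paths of length `n` of the products of the entries of a matrix. -/
theorem Matrix.sum_path_mul {A ι : Type*} [CommRing A] [Fintype ι] [DecidableEq ι]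
    (H : Matrix ι ι A) (n : ℕ) (Φ : ι → ι → A) :
    ∑ q : Fin (n + 1) → ι, (∏ i : Fin n, H (q i.succ) (q i.castSucc)) * Φ (q 0) (q (Fin.last n)) =
      ∑ j, ∑ k, (H ^ n) k j * Φ j k := by
  induction n generalizing Φ with
  | zero =>
    rw [← Fintype.sum_equiv (Equiv.funUnique (Fin 1) ι).symm _ _ fun e => rfl]
    refine Finset.sum_congr rfl fun j _ => ?_
    rw [Finset.sum_eq_single_of_mem j (Finset.mem_univ _)]
    · simp
    · intro k _ hk
      simp [Matrix.one_apply_ne hk]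
  | succ n ih =>
    rw [← Fintype.sum_equiv (Fin.consEquiv (fun _ : Fin (n + 2) => ι)) _ _ (fun _ => rfl),
      Fintype.sum_prod_type, Finset.sum_comm]
    have h := ih fun l k => ∑ j, H l j * Φ j k
    have hl : ∀ q : Fin (n + 1) → ι,
        ∑ j : ι, (∏ i : Fin (n + 1), H ((Fin.consEquiv (fun _ : Fin (n + 2) => ι)) (j, q) i.succ)
          ((Fin.consEquiv (fun _ : Fin (n + 2) => ι)) (j, q) i.castSucc)) *
          Φ ((Fin.consEquiv (fun _ : Fin (n + 2) => ι)) (j, q) 0)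
            ((Fin.consEquiv (fun _ : Fin (n + 2) => ι)) (j, q) (Fin.last (n + 1))) =
        (∏ i : Fin n, H (q i.succ) (q i.castSucc)) * ∑ j, H (q 0) j * Φ j (q (Fin.last n)) := by
      intro q
      rw [Finset.mul_sum]
      refine Finset.sum_congr rfl fun j _ => ?_
      have hc : (Fin.consEquiv (fun _ : Fin (n + 2) => ι)) (j, q) =
        (Fin.cons j q : Fin (n + 2) → ι) := rfl
      rw [hc, Fin.prod_univ_succ, ← Fin.succ_last]
      simp only [Fin.cons_succ, Fin.castSucc_zero, Fin.cons_zero, ← Fin.succ_castSucc]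
      ring
    rw [Finset.sum_congr rfl fun q _ => hl q, h, Finset.sum_comm]
    simp_rw [pow_succ, Matrix.mul_apply, Finset.mul_sum, Finset.sum_mul]
    rw [Finset.sum_comm]
    conv_rhs =>
      rw [Finset.sum_comm]
    simp_rw [← mul_assoc]
    rw [Finset.sum_comm]
    refine Finset.sum_congr rfl fun k _ => ?_
    rw [Finset.sum_comm]

/-! ### Graphs as differential operators over a ring with commuting derivations -/

section Jet

variable {A : Type*} [CommRing A] [Algebra ℂ A] {d : ℕ} (D : CIndex d → Derivation ℂ A A)

/-- Iterated derivations. -/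
def iterDeriv (l : List (CIndex d)) (F : A) : A := l.foldr (fun α x => D α x) F

@[simp] theorem iterDeriv_nil (F : A) : iterDeriv D [] F = F := rfl

@[simp] theorem iterDeriv_cons (α : CIndex d) (l : List (CIndex d)) (F : A) :
    iterDeriv D (α :: l) F = D α (iterDeriv D l F) := rfl

theorem iterDeriv_append (l l' : List (CIndex d)) (F : A) :
    iterDeriv D (l ++ l') F = iterDeriv D l (iterDeriv D l' F) := by
  simp [iterDeriv]

/-- The derivative `H_{i j̄ k₁…kᵣ l̄₁…l̄ₛ}` of the matrix `H`, given the list `i, k₁, …, kᵣ` of its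
unbarred indices and the list `j, l₁, …, lₛ` of its barred indices. -/
def matrixJet (H : Matrix (Fin d) (Fin d) A) (a b : List (Fin d)) : A :=
  match a, b with
  | i :: k, j :: l => iterDeriv D (k.map Sum.inl ++ l.map Sum.inr) (H i j)
  | _, _ => 0

/-- The derivations commute, and `H` satisfies the Kähler condition. -/
structure IsKahlerMatrix (H : Matrix (Fin d) (Fin d) A) : Prop where
  comm : ∀ α β F, D α (D β F) = D β (D α F)
  unbarred : ∀ i j k, D (Sum.inl k) (H i j) = D (Sum.inl i) (H k j)
  barred : ∀ i j k, D (Sum.inr k) (H i j) = D (Sum.inr j) (H i k)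

variable {D} {H : Matrix (Fin d) (Fin d) A}

namespace IsKahlerMatrix

theorem iterDeriv_perm (h : IsKahlerMatrix D H) {l l' : List (CIndex d)} (hl : l.Perm l')
    (F : A) : iterDeriv D l F = iterDeriv D l' F := by
  induction hl with
  | nil => rfl
  | cons α _ ih => rw [iterDeriv_cons, iterDeriv_cons, ih]
  | swap α β l => simp only [iterDeriv_cons, h.comm]
  | trans _ _ ih₁ ih₂ => rw [ih₁, ih₂]

/-- Beyond the commutation of derivations, only the swap of the first two indices matters: it
exchanges an index of `H` with that of a derivative, which is the Kähler condition. -/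
theorem matrixJet_perm_left (h : IsKahlerMatrix D H) {a a' : List (Fin d)} (ha : a.Perm a')
    (b : List (Fin d)) : matrixJet D H a b = matrixJet D H a' b := by
  cases b with
  | nil => cases a <;> cases a' <;> rfl
  | cons j l =>
    induction ha with
    | nil => rfl
    | cons i hk _ => exact h.iterDeriv_perm ((hk.map _).append_right _) _
    | swap i i' k =>
      change iterDeriv D (Sum.inl i :: (k.map Sum.inl ++ l.map Sum.inr)) (H i' j) =
        iterDeriv D (Sum.inl i' :: (k.map Sum.inl ++ l.map Sum.inr)) (H i j)
      rw [h.iterDeriv_perm (List.perm_append_singleton _ _).symm,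
        h.iterDeriv_perm (List.perm_append_singleton _ (k.map Sum.inl ++ l.map Sum.inr)).symm,
        iterDeriv_append _ _ [_], iterDeriv_append _ _ [_]]
      simp only [iterDeriv_cons, iterDeriv_nil]
      rw [h.unbarred]
    | trans _ _ ih₁ ih₂ => rw [ih₁, ih₂]

theorem matrixJet_perm_right (h : IsKahlerMatrix D H) (a : List (Fin d)) {b b' : List (Fin d)}
    (hb : b.Perm b') : matrixJet D H a b = matrixJet D H a b' := by
  cases a with
  | nil => rfl
  | cons i k =>
    induction hb with
    | nil => rfl
    | cons j hl _ => exact h.iterDeriv_perm ((hl.map _).append_left _) _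
    | swap j j' l =>
      change iterDeriv D (k.map Sum.inl ++ Sum.inr j :: l.map Sum.inr) (H i j') =
        iterDeriv D (k.map Sum.inl ++ Sum.inr j' :: l.map Sum.inr) (H i j)
      rw [h.iterDeriv_perm (List.perm_middle.trans (List.perm_append_singleton _ _).symm),
        h.iterDeriv_perm (List.perm_middle.trans (List.perm_append_singleton (Sum.inr j')
          (k.map Sum.inl ++ l.map Sum.inr)).symm),
        iterDeriv_append _ _ [_], iterDeriv_append _ _ [_]]
      simp only [iterDeriv_cons, iterDeriv_nil]
      rw [h.barred]
    | trans _ _ ih₁ ih₂ => rw [ih₁, ih₂]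

/-- The list must be nonempty: on `[]` the jet has the default value `0`, whereas appending an index
may give a nonzero entry of `H`. -/
theorem deriv_matrixJet_inl (h : IsKahlerMatrix D H) {a : List (Fin d)} (ha : a ≠ [])
    (b : List (Fin d)) (p : Fin d) :
    D (Sum.inl p) (matrixJet D H a b) = matrixJet D H (a ++ [p]) b := by
  obtain ⟨i, k, rfl⟩ := List.exists_cons_of_ne_nil ha
  cases b with
  | nil => exact map_zero _
  | cons j l =>
    change iterDeriv D (Sum.inl p :: (k.map Sum.inl ++ l.map Sum.inr)) (H i j) =
      iterDeriv D ((k ++ [p]).map Sum.inl ++ l.map Sum.inr) (H i j)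
    refine h.iterDeriv_perm ?_ _
    rw [List.map_append, List.append_assoc]
    exact List.perm_middle.symm

theorem deriv_matrixJet_inr (h : IsKahlerMatrix D H) (a : List (Fin d)) {b : List (Fin d)}
    (hb : b ≠ []) (p : Fin d) :
    D (Sum.inr p) (matrixJet D H a b) = matrixJet D H a (b ++ [p]) := by
  obtain ⟨j, l, rfl⟩ := List.exists_cons_of_ne_nil hb
  cases a with
  | nil => exact map_zero _
  | cons i k =>
    change iterDeriv D (Sum.inr p :: (k.map Sum.inl ++ l.map Sum.inr)) (H i j) =
      iterDeriv D (k.map Sum.inl ++ (l ++ [p]).map Sum.inr) (H i j)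
    refine h.iterDeriv_perm ?_ _
    rw [List.map_append, ← List.append_assoc]
    exact (List.perm_append_singleton _ _).symm

end IsKahlerMatrix

end Jet

namespace PointedGraph

variable {V E V' E' : Type}

/-! ### Labels of the edges at a vertex -/

section labels

variable {ι : Type*} [Fintype E] [Fintype E'] (Γ : PointedGraph V E)

open Classical in
/-- The labels of the outward edges of a vertex. -/
def outLabels (p : E → ι) (y : Option V) : List ι :=
  (Finset.univ.filter fun e => Γ.src e = y).toList.map p

open Classical in
/-- The labels of the inward edges of a vertex. -/
def inLabels (p : E → ι) (y : Option V) : List ι :=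
  (Finset.univ.filter fun e => Γ.tgt e = y).toList.map p

theorem length_outLabels (p : E → ι) (y : Option V) :
    (Γ.outLabels p y).length = Γ.outDegree y := by
  simp [outLabels, outDegree]

theorem length_inLabels (p : E → ι) (y : Option V) :
    (Γ.inLabels p y).length = Γ.inDegree y := by
  simp [inLabels, inDegree]

theorem coe_toList_map_filter (P : E → Prop) [DecidablePred P] (p : E → ι) :
    (((Finset.univ.filter P).toList.map p : List ι) : Multiset ι) =
      ∑ e, if P e then {p e} else 0 := by
  rw [← Finset.sum_filter, Finset.sum_eq_multiset_sum, ← Multiset.map_coe, Finset.coe_toList]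
  have := Multiset.sum_map_singleton ((Finset.univ.filter P).val.map p)
  rw [Multiset.map_map] at this
  exact this.symm

/-- The order of the list is unspecified. As a multiset it is a sum over the edges, which can be
reindexed by isomorphisms and splits along an added ear. -/
theorem coe_outLabels [DecidableEq (Option V)] (p : E → ι) (y : Option V) :
    (Γ.outLabels p y : Multiset ι) = ∑ e, if Γ.src e = y then {p e} else 0 := by
  unfold outLabels
  rw [coe_toList_map_filter]
  congr!

theorem coe_inLabels [DecidableEq (Option V)] (p : E → ι) (y : Option V) :
    (Γ.inLabels p y : Multiset ι) = ∑ e, if Γ.tgt e = y then {p e} else 0 := by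
  unfold inLabels
  rw [coe_toList_map_filter]
  congr!

variable {Γ} in
theorem Iso.outLabels_perm {Γ' : PointedGraph V' E'} (σ : Iso Γ Γ') (p : E' → ι)
    (y : Option V) : (Γ'.outLabels p (y.map σ.vert)).Perm (Γ.outLabels (p ∘ σ.edge) y) := by
  classical
  rw [← Multiset.coe_eq_coe, coe_outLabels, coe_outLabels]
  refine (Fintype.sum_equiv σ.edge _ _ fun e => ?_).symm
  exact if_congr (σ.src_eq_some_iff e y).symm rfl rfl

variable {Γ} in
theorem Iso.inLabels_perm {Γ' : PointedGraph V' E'} (σ : Iso Γ Γ') (p : E' → ι)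
    (y : Option V) : (Γ'.inLabels p (y.map σ.vert)).Perm (Γ.inLabels (p ∘ σ.edge) y) := by
  classical
  rw [← Multiset.coe_eq_coe, coe_inLabels, coe_inLabels]
  refine (Fintype.sum_equiv σ.edge _ _ fun e => ?_).symm
  exact if_congr (σ.tgt_eq_some_iff e y).symm rfl rfl

variable (n : ℕ) (s t : Option V) (p : E → ι) (q : Fin (n + 1) → ι)

theorem map_inl_eq_iff {α β : Type*} {a b : Option α} :
    a.map (Sum.inl : α → α ⊕ β) = b.map Sum.inl ↔ a = b :=
  (Option.map_injective Sum.inl_injective).eq_iff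

theorem some_inr_ne_map_inl {α β : Type*} (a : Option α) (b : β) :
    some (Sum.inr b) ≠ a.map (Sum.inl : α → α ⊕ β) := by
  cases a <;> simp

theorem outLabels_addEar_inl [DecidableEq (Option V)] (y : Option V) :
    ((Γ.addEar n s t).outLabels (Sum.elim p q) (y.map Sum.inl)).Perm
      (Γ.outLabels p y ++ if y = s then [q 0] else []) := by
  classical
  rw [← Multiset.coe_eq_coe, ← Multiset.coe_add, coe_outLabels, coe_outLabels,
    Fintype.sum_sum_type, Fin.sum_univ_succ]
  simp only [addEar_src_inl, addEar_src_zero, addEar_src_succ, Sum.elim_inl, Sum.elim_inr,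
    map_inl_eq_iff, some_inr_ne_map_inl, if_false, Finset.sum_const_zero, add_zero]
  congr 1
  by_cases h : y = s
  · simp [h]
  · simp [h, Ne.symm h]

theorem inLabels_addEar_inl [DecidableEq (Option V)] (y : Option V) :
    ((Γ.addEar n s t).inLabels (Sum.elim p q) (y.map Sum.inl)).Perm
      (Γ.inLabels p y ++ if y = t then [q (Fin.last n)] else []) := by
  classical
  rw [← Multiset.coe_eq_coe, ← Multiset.coe_add, coe_inLabels, coe_inLabels,
    Fintype.sum_sum_type, Fin.sum_univ_castSucc]
  simp only [addEar_tgt_inl, addEar_tgt_last, addEar_tgt_castSucc, Sum.elim_inl, Sum.elim_inr,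
    map_inl_eq_iff, some_inr_ne_map_inl, if_false, Finset.sum_const_zero, zero_add]
  congr 1
  by_cases h : y = t
  · simp [h]
  · simp [h, Ne.symm h]

theorem outLabels_addEar_inr (i : Fin n) :
    (Γ.addEar n s t).outLabels (Sum.elim p q) (some (Sum.inr i)) = [q i.succ] := by
  classical
  rw [← List.perm_singleton, ← Multiset.coe_eq_coe, coe_outLabels,
    Fintype.sum_sum_type, Fin.sum_univ_succ]
  simp only [addEar_src_inl, addEar_src_zero, addEar_src_succ, Sum.elim_inl, Sum.elim_inr,
    (some_inr_ne_map_inl _ _).symm, if_false, Finset.sum_const_zero, zero_add, Option.some.injEq,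
    Sum.inr.injEq]
  simp

theorem inLabels_addEar_inr (i : Fin n) :
    (Γ.addEar n s t).inLabels (Sum.elim p q) (some (Sum.inr i)) = [q i.castSucc] := by
  classical
  rw [← List.perm_singleton, ← Multiset.coe_eq_coe, coe_inLabels,
    Fintype.sum_sum_type, Fin.sum_univ_castSucc]
  simp only [addEar_tgt_inl, addEar_tgt_last, addEar_tgt_castSucc, Sum.elim_inl, Sum.elim_inr,
    (some_inr_ne_map_inl _ _).symm, if_false, Finset.sum_const_zero, zero_add, Option.some.injEq,
    Sum.inr.injEq]
  simp

end labels

end PointedGraph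

theorem Fintype.sum_sum_arrow {α β ι M : Type*} [AddCommMonoid M]
    {_ : Fintype (α ⊕ β → ι)} [Fintype (α → ι)] [Fintype (β → ι)] (G : (α ⊕ β → ι) → M) :
    ∑ r, G r = ∑ p : α → ι, ∑ q : β → ι, G (Sum.elim p q) :=
  (Fintype.sum_equiv (Equiv.sumArrowEquivProdArrow α β ι).symm
    (fun x : (α → ι) × (β → ι) => G (Sum.elim x.1 x.2)) G fun _ => rfl).symm.trans
    (Fintype.sum_prod_type _)

/-! ### Values of graphs, and the effect of adding an ear -/

namespace PointedGraph

variable {V E V' E' : Type} {A : Type*} [CommRing A] [Algebra ℂ A] {d : ℕ}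
  (D : CIndex d → Derivation ℂ A A) (H : Matrix (Fin d) (Fin d) A) (F : A)

/-- The factor of a vertex in the differential operator represented by a graph: a derivative of
`H` at the ordinary vertices, a derivative of `F` at the distinguished one. -/
def nodeValue [Fintype E] (Γ : PointedGraph V E) (p : E → Fin d) : Option V → A
  | none => iterDeriv D ((Γ.outLabels p none).map Sum.inl ++ (Γ.inLabels p none).map Sum.inr) F
  | some v => matrixJet D H (Γ.outLabels p (some v)) (Γ.inLabels p (some v))

open Classical in
/-- The differential operator represented by a graph, where the edges stand for the contraction with
the identity matrix. -/
def graphValue [Fintype V] [Fintype E] (Γ : PointedGraph V E) : A :=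
  ∑ p : E → Fin d, ∏ y : Option V, Γ.nodeValue D H F p y

variable {D H}

-- The start of the ear gives its vertex one more unbarred label and the end one more barred label,
-- that is, one more derivative each. If `s = t`, both act on the same factor.
open Classical in
theorem nodeValue_addEar_inl [Fintype E] (h : IsKahlerMatrix D H) {Γ : PointedGraph V E}
    (hΓ : ∀ v : V, 1 ≤ Γ.outDegree (some v) ∧ 1 ≤ Γ.inDegree (some v)) (n : ℕ)
    (s t : Option V) (p : E → Fin d) (q : Fin (n + 1) → Fin d) (y : Option V) :
    (Γ.addEar n s t).nodeValue D H F (Sum.elim p q) (y.map Sum.inl) =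
      if y = t then D (Sum.inr (q (Fin.last n)))
        (if y = s then D (Sum.inl (q 0)) (Γ.nodeValue D H F p y) else Γ.nodeValue D H F p y)
      else (if y = s then D (Sum.inl (q 0)) (Γ.nodeValue D H F p y)
        else Γ.nodeValue D H F p y) := by
  have ho := Γ.outLabels_addEar_inl n s t p q y
  have hi := Γ.inLabels_addEar_inl n s t p q y
  match y with
  | none =>
    change iterDeriv D (((Γ.addEar n s t).outLabels (Sum.elim p q)
      ((none : Option V).map Sum.inl)).map Sum.inl ++ ((Γ.addEar n s t).inLabels (Sum.elim p q)
      ((none : Option V).map Sum.inl)).map Sum.inr) F = _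
    rw [h.iterDeriv_perm ((ho.map Sum.inl).append (hi.map Sum.inr))]
    simp only [nodeValue]
    split_ifs
    · rw [← iterDeriv_cons, ← iterDeriv_cons]
      refine h.iterDeriv_perm ?_ _
      simp only [List.map_append, List.map_cons, List.map_nil]
      rw [← List.append_assoc]
      refine (List.perm_append_singleton _ _).trans (List.Perm.cons _ ?_)
      rw [List.append_assoc]
      exact List.perm_middle
    · rw [← iterDeriv_cons]
      refine h.iterDeriv_perm ?_ _
      simp only [List.map_append, List.map_cons, List.map_nil, List.append_nil]
      rw [List.append_assoc]
      exact List.perm_middle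
    · rw [← iterDeriv_cons]
      refine h.iterDeriv_perm ?_ _
      simp only [List.map_append, List.map_cons, List.map_nil, List.append_nil]
      rw [← List.append_assoc]
      exact List.perm_append_singleton _ _
    · simp
  | some v =>
    have ho0 : Γ.outLabels p (some v) ≠ [] := by
      rw [← List.length_pos_iff, length_outLabels]
      exact (hΓ v).1
    have hi0 : Γ.inLabels p (some v) ≠ [] := by
      rw [← List.length_pos_iff, length_inLabels]
      exact (hΓ v).2
    change matrixJet D H ((Γ.addEar n s t).outLabels (Sum.elim p q) ((some v).map Sum.inl))
      ((Γ.addEar n s t).inLabels (Sum.elim p q) ((some v).map Sum.inl)) = _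
    rw [h.matrixJet_perm_left ho, h.matrixJet_perm_right _ hi]
    simp only [nodeValue]
    split_ifs
    · rw [h.deriv_matrixJet_inl ho0, h.deriv_matrixJet_inr _ hi0]
    · rw [List.append_nil, h.deriv_matrixJet_inl ho0]
    · rw [List.append_nil, h.deriv_matrixJet_inr _ hi0]
    · rw [List.append_nil, List.append_nil]

theorem nodeValue_addEar_inr [Fintype E] (Γ : PointedGraph V E) (n : ℕ)
    (s t : Option V) (p : E → Fin d) (q : Fin (n + 1) → Fin d) (i : Fin n) :
    (Γ.addEar n s t).nodeValue D H F (Sum.elim p q) (some (Sum.inr i)) =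
      H (q i.succ) (q i.castSucc) := by
  rw [nodeValue, outLabels_addEar_inr, inLabels_addEar_inr]
  rfl

/-- The sum over `s` and `t` is the Leibniz rule applied twice: `s` is the vertex hit by the
unbarred derivative, `t` the one hit by the barred derivative. The interior vertices of the ear
contribute undifferentiated entries of `H`, and the summation over the labels between them forms `H
^ n`. -/
theorem sum_graphValue_addEar [Fintype V] [Fintype E] (h : IsKahlerMatrix D H)
    {Γ : PointedGraph V E}
    (hΓ : ∀ v : V, 1 ≤ Γ.outDegree (some v) ∧ 1 ≤ Γ.inDegree (some v)) (n : ℕ) :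
    ∑ s, ∑ t, (Γ.addEar n s t).graphValue D H F =
      ∑ j, ∑ k, (H ^ n) k j * D (Sum.inr k) (D (Sum.inl j) (Γ.graphValue D H F)) := by
  classical
  have hleib : ∀ (p : E → Fin d) (a b : Fin d),
      D (Sum.inr b) (D (Sum.inl a) (∏ y, Γ.nodeValue D H F p y)) =
      ∑ s, ∑ t, ∏ y, if y = t then D (Sum.inr b)
        (if y = s then D (Sum.inl a) (Γ.nodeValue D H F p y) else Γ.nodeValue D H F p y)
      else (if y = s then D (Sum.inl a) (Γ.nodeValue D H F p y)
        else Γ.nodeValue D H F p y) := by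
    intro p a b
    rw [Derivation.finset_prod, map_sum]
    simp_rw [Derivation.finset_prod]
  have hval : ∀ s t, (Γ.addEar n s t).graphValue D H F =
      ∑ p : E → Fin d, ∑ q : Fin (n + 1) → Fin d,
        (∏ i : Fin n, H (q i.succ) (q i.castSucc)) *
        ∏ y, if y = t then D (Sum.inr (q (Fin.last n)))
        (if y = s then D (Sum.inl (q 0)) (Γ.nodeValue D H F p y) else Γ.nodeValue D H F p y)
      else (if y = s then D (Sum.inl (q 0)) (Γ.nodeValue D H F p y)
        else Γ.nodeValue D H F p y) := by
    intro s t
    rw [graphValue, Fintype.sum_sum_arrow]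
    refine Finset.sum_congr rfl fun p _ => Finset.sum_congr rfl fun q _ => ?_
    rw [Fintype.prod_option, Fintype.prod_sum_type]
    simp_rw [nodeValue_addEar_inr]
    simp_rw [← nodeValue_addEar_inl F h hΓ n s t p q]
    rw [Fintype.prod_option]
    simp only [Option.map_none, Option.map_some]
    ring
  simp_rw [hval]
  rw [← Matrix.sum_path_mul H n fun a b =>
    D (Sum.inr b) (D (Sum.inl a) (Γ.graphValue D H F))]
  simp_rw [graphValue, map_sum, hleib, Finset.mul_sum]
  refine (Finset.sum_congr rfl fun s _ => Finset.sum_comm).trans ?_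
  refine Finset.sum_comm.trans ?_
  refine (Finset.sum_congr rfl fun p _ => Finset.sum_congr rfl fun s _ =>
    Finset.sum_comm).trans ?_
  refine (Finset.sum_congr rfl fun p _ => Finset.sum_comm).trans ?_
  exact Finset.sum_comm

theorem Iso.graphValue_eq [Fintype V] [Fintype E] [Fintype V'] [Fintype E']
    (h : IsKahlerMatrix D H) {Γ : PointedGraph V E} {Γ' : PointedGraph V' E'} (σ : Iso Γ Γ') :
    Γ.graphValue D H F = Γ'.graphValue D H F := by
  classical
  rw [graphValue, graphValue]
  refine (Fintype.sum_equiv (σ.edge.arrowCongr (Equiv.refl _)).symm _ _ fun p => ?_).symm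
  refine (Fintype.prod_equiv (Equiv.optionCongr σ.vert) _ _ fun y => ?_).symm
  have ho := σ.outLabels_perm p y
  have hi := σ.inLabels_perm p y
  match y with
  | none => exact (h.iterDeriv_perm ((ho.map _).append (hi.map _)) _).symm
  | some v =>
    exact ((h.matrixJet_perm_left ho _).trans (h.matrixJet_perm_right _ hi)).symm

end PointedGraph

/-! ### Powers of the Laplacian -/

section Laplacian

variable {A : Type*} [CommRing A] [Algebra ℂ A] {d : ℕ}
  (D : CIndex d → Derivation ℂ A A)

/-- The operator `∑ P_{k j} ∂_j ∂_k̄`. -/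
def boxOperator (P : Matrix (Fin d) (Fin d) A) (F : A) : A :=
  ∑ j, ∑ k, P k j * D (Sum.inr k) (D (Sum.inl j) F)

theorem boxOperator_add (P : Matrix (Fin d) (Fin d) A) (F G : A) :
    boxOperator D P (F + G) = boxOperator D P F + boxOperator D P G := by
  simp [boxOperator, mul_add, Finset.sum_add_distrib]

theorem boxOperator_smul (P : Matrix (Fin d) (Fin d) A) (c : ℂ) (F : A) :
    boxOperator D P (c • F) = c • boxOperator D P F := by
  simp [boxOperator, Finset.smul_sum]

theorem boxOperator_sub (P : Matrix (Fin d) (Fin d) A) (F G : A) :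
    boxOperator D P (F - G) = boxOperator D P F - boxOperator D P G := by
  simp [boxOperator, mul_sub, Finset.sum_sub_distrib]

theorem boxOperator_sum {ι : Type*} (s : Finset ι) (P : ι → Matrix (Fin d) (Fin d) A) (F : A) :
    boxOperator D (∑ n ∈ s, P n) F = ∑ n ∈ s, boxOperator D (P n) F := by
  simp only [boxOperator, Matrix.sum_apply, Finset.sum_mul]
  refine Eq.trans ?_ Finset.sum_comm
  exact Finset.sum_congr rfl fun j _ => Finset.sum_comm

theorem boxOperator_multiset_sum (P : Matrix (Fin d) (Fin d) A) (s : Multiset A) :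
    boxOperator D P s.sum = (s.map (boxOperator D P)).sum := by
  induction s using Multiset.induction_on with
  | empty => simp [boxOperator]
  | cons a s ih => rw [Multiset.sum_cons, boxOperator_add, ih, Multiset.map_cons,
      Multiset.sum_cons]

/-- Each application differentiates the previous error twice, which costs at most two powers of `I`,
and adds a new error with coefficients in `I ^ B`. -/
theorem iterate_boxOperator_sub_mem (I : Ideal A) {B : ℕ} {P Q : Matrix (Fin d) (Fin d) A}
    (hPQ : ∀ i j, P i j - Q i j ∈ I ^ B) (F : A) (k : ℕ) :
    (boxOperator D P)^[k] F - (boxOperator D Q)^[k] F ∈ I ^ (B - 2 * k) := by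
  induction k with
  | zero => simp
  | succ k ih =>
    rw [Function.iterate_succ_apply', Function.iterate_succ_apply']
    set X := (boxOperator D P)^[k] F
    set Y := (boxOperator D Q)^[k] F
    have h1 : boxOperator D P X - boxOperator D Q Y =
        boxOperator D P (X - Y) + boxOperator D (P - Q) Y := by
      rw [boxOperator_sub]
      simp only [boxOperator, Matrix.sub_apply, sub_mul, Finset.sum_sub_distrib]
      ring
    rw [h1]
    refine add_mem ?_ ?_
    · refine Ideal.sum_mem _ fun j _ => Ideal.sum_mem _ fun k' _ => Ideal.mul_mem_left _ _ ?_
      -- Here the truncated subtraction makes the required exponent `0`, and the claim is empty.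
      by_cases hB : B - 2 * k ≤ 1
      · rw [show B - 2 * (k + 1) = 0 by omega]
        simp
      · refine Derivation.apply_mem_ideal_pow _ _ _ (Derivation.apply_mem_ideal_pow _ _ _ ?_)
        convert ih using 2
        omega
    · refine Ideal.sum_mem _ fun j _ => Ideal.sum_mem _ fun k' _ => Ideal.mul_mem_right _ _ ?_
      exact Ideal.pow_le_pow_right (Nat.sub_le _ _) (hPQ _ _)

variable {D} {H : Matrix (Fin d) (Fin d) A}

open PointedGraph

/-- This is exact for every truncation `B`. An ear with `n` interior vertices comes from `(-H) ^ n`,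
so its sign is accounted for by the number of new ordinary vertices. -/
theorem iterate_boxOperator_eq_sum (h : IsKahlerMatrix D H) (B : ℕ) (F : A) (k : ℕ) :
    (boxOperator D (∑ n ∈ Finset.range B, (-H) ^ n))^[k] F =
      ((FinGraph.point.ears B k).map fun T =>
        (-1 : ℂ) ^ Fintype.card T.V • T.graph.graphValue D H F).sum := by
  induction k with
  | zero =>
    simp only [Function.iterate_zero, id_eq, FinGraph.ears, Multiset.map_singleton,
      Multiset.sum_singleton]
    have hV : Fintype.card FinGraph.point.V = 0 := rfl
    have : IsEmpty FinGraph.point.E := inferInstanceAs (IsEmpty (Fin 0))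
    have : IsEmpty FinGraph.point.V := inferInstanceAs (IsEmpty (Fin 0))
    rw [hV, pow_zero, one_smul, graphValue, Fintype.sum_unique, Fintype.prod_option]
    simp [nodeValue, outLabels, inLabels]
  | succ k ih =>
    rw [Function.iterate_succ_apply', ih, boxOperator_multiset_sum, Multiset.map_map,
      FinGraph.sum_map_ears_succ']
    congr 1
    refine Multiset.map_congr rfl fun T hT => ?_
    rw [Function.comp_apply, boxOperator_smul]
    -- Strong connectedness provides an edge in each direction at every ordinary vertex, as the
    -- Leibniz rule for graphs requires.
    have hsc := FinGraph.isStronglyConnected_of_mem_ears hT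
    have hT' : ∀ v : T.V, 1 ≤ T.graph.outDegree (some v) ∧ 1 ≤ T.graph.inDegree (some v) :=
      fun v => by
        have : Nonempty T.V := ⟨v⟩
        exact ⟨hsc.one_le_outDegree _, hsc.one_le_inDegree _⟩
    have hn : ∀ n : Fin B, ∑ s, ∑ t, (-1 : ℂ) ^ Fintype.card (T.addEar n s t).V •
        (T.addEar n s t).graph.graphValue D H F =
        (-1 : ℂ) ^ Fintype.card T.V • boxOperator D ((-H) ^ (n : ℕ)) (T.graph.graphValue D H F) := by
      intro n
      have hcard : ∀ s t, Fintype.card (T.addEar n s t).V = Fintype.card T.V + n := fun s t => by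
        change Fintype.card (T.V ⊕ Fin n) = _
        simp
      simp_rw [hcard, ← Finset.smul_sum, pow_add, mul_smul]
      congr 1
      have := sum_graphValue_addEar F h hT' n
      refine (congrArg (fun x => (-1 : ℂ) ^ (n : ℕ) • x) this).trans ?_
      rw [boxOperator]
      rcases Nat.even_or_odd (n : ℕ) with he | ho
      · rw [he.neg_one_pow, he.neg_pow, one_smul]
      · rw [ho.neg_one_pow, ho.neg_pow]
        simp
    rw [Finset.sum_congr rfl fun n _ => hn n, ← Finset.smul_sum]
    congr 1
    rw [boxOperator_sum, ← Fin.sum_univ_eq_sum_range fun n =>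
      boxOperator D ((-H) ^ n) (T.graph.graphValue D H F)]

/-- The exact inverse `P` differs from the geometric sum by `P * (-H) ^ B`, with entries in the
`B`-th power of the kernel of `ev`. After `k` applications the exponent is still at least `B - 2 * k
≥ 1`, so `ev` does not see the difference. -/
theorem eval_iterate_boxOperator (h : IsKahlerMatrix D H) (ev : A →ₐ[ℂ] ℂ)
    (hev : ∀ i j, ev (H i j) = 0) {P : Matrix (Fin d) (Fin d) A} (hP : P * (1 + H) = 1)
    {B k : ℕ} (hB : 2 * k < B) (F : A) :
    ev ((boxOperator D P)^[k] F) =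
      ((FinGraph.point.ears B k).map fun T =>
        (-1 : ℂ) ^ Fintype.card T.V * ev (T.graph.graphValue D H F)).sum := by
  have hH : ∀ i j, (-H) i j ∈ RingHom.ker ev := fun i j => by
    rw [RingHom.mem_ker, Matrix.neg_apply, map_neg, hev, neg_zero]
  have hgeom : P - ∑ n ∈ Finset.range B, (-H) ^ n = P * (-H) ^ B := by
    have h1 := mul_neg_geom_sum (-H) B
    rw [sub_neg_eq_add] at h1
    have h2 := congrArg (P * ·) h1
    simp only [← mul_assoc, hP, one_mul, mul_sub, mul_one] at h2
    rw [h2, sub_sub_cancel]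
  have hmem := iterate_boxOperator_sub_mem D (RingHom.ker ev) (B := B) (P := P)
    (Q := ∑ n ∈ Finset.range B, (-H) ^ n) (fun i j => by
      rw [← Matrix.sub_apply, hgeom, Matrix.mul_apply]
      exact Ideal.sum_mem _ fun l _ => Ideal.mul_mem_left _ _
        (Matrix.pow_apply_mem_ideal_pow _ hH _ _ _)) F k
  have hmem' := Ideal.pow_le_pow_right (show 1 ≤ B - 2 * k by omega) hmem
  rw [pow_one, RingHom.mem_ker, map_sub, sub_eq_zero] at hmem'
  rw [hmem', iterate_boxOperator_eq_sum h, map_multiset_sum, Multiset.map_map]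
  congr 1
  refine Multiset.map_congr rfl fun T _ => ?_
  simp

end Laplacian

/-! ### Wirtinger derivatives -/

section Wirtinger

variable {d : ℕ}

/-- The coefficient of the derivative in the imaginary direction. -/
def wirtingerCoeff (α : CIndex d) : ℂ := Sum.elim (fun _ => -Complex.I) (fun _ => Complex.I) α

/-- The real direction. -/
def wirtingerRe (α : CIndex d) : Fin d → ℂ := Pi.single (Sum.elim id id α) 1

/-- The imaginary direction. -/
def wirtingerIm (α : CIndex d) : Fin d → ℂ := Pi.single (Sum.elim id id α) Complex.I

/-- A single formula for both types of index, so that the rules of calculus need no case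
distinction. -/
theorem wirtinger_eq (α : CIndex d) (F : (Fin d → ℂ) → ℂ) (z : Fin d → ℂ) :
    wirtinger α F z = (fderiv ℝ F z (wirtingerRe α) +
      wirtingerCoeff α * fderiv ℝ F z (wirtingerIm α)) / 2 := by
  cases α <;> simp [wirtinger, wirtingerRe, wirtingerIm, wirtingerCoeff, sub_eq_add_neg]

theorem Filter.EventuallyEq.wirtinger_eq {F G : (Fin d → ℂ) → ℂ} {z : Fin d → ℂ}
    (h : F =ᶠ[nhds z] G) (α : CIndex d) : wirtinger α F z = wirtinger α G z := by
  rw [_root_.wirtinger_eq, _root_.wirtinger_eq, h.fderiv_eq]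

theorem wirtinger_const (α : CIndex d) (c : ℂ) (z : Fin d → ℂ) :
    wirtinger α (fun _ => c) z = 0 := by
  simp [wirtinger_eq]

theorem wirtinger_add (α : CIndex d) {F G : (Fin d → ℂ) → ℂ} {z : Fin d → ℂ}
    (hF : DifferentiableAt ℝ F z) (hG : DifferentiableAt ℝ G z) :
    wirtinger α (fun z => F z + G z) z = wirtinger α F z + wirtinger α G z := by
  simp only [wirtinger_eq, fderiv_fun_add hF hG, add_apply]
  ring

theorem wirtinger_mul (α : CIndex d) {F G : (Fin d → ℂ) → ℂ} {z : Fin d → ℂ}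
    (hF : DifferentiableAt ℝ F z) (hG : DifferentiableAt ℝ G z) :
    wirtinger α (fun z => F z * G z) z = F z * wirtinger α G z + G z * wirtinger α F z := by
  simp only [wirtinger_eq, fderiv_fun_mul hF hG, add_apply,
    smul_apply, smul_eq_mul]
  ring

theorem wirtinger_const_mul (α : CIndex d) {F : (Fin d → ℂ) → ℂ} {z : Fin d → ℂ} (c : ℂ)
    (hF : DifferentiableAt ℝ F z) :
    wirtinger α (fun z => c * F z) z = c * wirtinger α F z := by
  rw [wirtinger_mul α (differentiableAt_const c) hF, wirtinger_const, mul_zero, add_zero]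

theorem wirtinger_sum {ι : Type*} (α : CIndex d) (s : Finset ι) {F : ι → (Fin d → ℂ) → ℂ}
    {z : Fin d → ℂ} (hF : ∀ i ∈ s, DifferentiableAt ℝ (F i) z) :
    wirtinger α (fun z => ∑ i ∈ s, F i z) z = ∑ i ∈ s, wirtinger α (F i) z := by
  simp only [wirtinger_eq, fderiv_fun_sum hF, sum_apply]
  rw [Finset.mul_sum, ← Finset.sum_add_distrib, Finset.sum_div]

theorem ContDiffOn.fderiv_apply_const {F : (Fin d → ℂ) → ℂ} {U : Set (Fin d → ℂ)} (hU : IsOpen U)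
    (hF : ContDiffOn ℝ ∞ F U) (v : Fin d → ℂ) :
    ContDiffOn ℝ ∞ (fun z => fderiv ℝ F z v) U :=
  (hF.fderiv_of_isOpen hU le_rfl).clm_apply contDiffOn_const

theorem ContDiffOn.wirtinger {F : (Fin d → ℂ) → ℂ} {U : Set (Fin d → ℂ)} (hU : IsOpen U)
    (hF : ContDiffOn ℝ ∞ F U) (α : CIndex d) : ContDiffOn ℝ ∞ (wirtinger α F) U := by
  have : _root_.wirtinger α F = fun z => (fderiv ℝ F z (wirtingerRe α) +
      wirtingerCoeff α * fderiv ℝ F z (wirtingerIm α)) / 2 := funext fun z => wirtinger_eq α F z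
  rw [this]
  exact ((hF.fderiv_apply_const hU _).add
    (contDiffOn_const.mul (hF.fderiv_apply_const hU _))).div_const 2

theorem fderiv_fderiv_apply_comm {F : (Fin d → ℂ) → ℂ} {z : Fin d → ℂ}
    (hF : ContDiffAt ℝ ∞ F z) (v w : Fin d → ℂ) :
    fderiv ℝ (fun z => fderiv ℝ F z v) z w = fderiv ℝ (fun z => fderiv ℝ F z w) z v := by
  have hd : DifferentiableAt ℝ (fderiv ℝ F) z :=
    (hF.fderiv_right (m := ∞) le_rfl).differentiableAt (by simp)
  have key : ∀ v w, fderiv ℝ (fun z => fderiv ℝ F z v) z w = fderiv ℝ (fderiv ℝ F) z w v := by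
    intro v w
    rw [fderiv_clm_apply hd (differentiableAt_const v)]
    simp
  rw [key, key]
  have hs : IsSymmSndFDerivAt ℝ F z := hF.isSymmSndFDerivAt <| by
    rw [minSmoothness_of_isRCLikeNormedField]
    exact WithTop.coe_le_coe.2 le_top
  exact hs.eq w v

theorem wirtinger_comm {F : (Fin d → ℂ) → ℂ} {z : Fin d → ℂ}
    (hF : ContDiffAt ℝ ∞ F z) (α β : CIndex d) :
    wirtinger α (wirtinger β F) z = wirtinger β (wirtinger α F) z := by
  have hd : ∀ v, DifferentiableAt ℝ (fun z => fderiv ℝ F z v) z := fun v =>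
    ((hF.fderiv_right (m := ∞) le_rfl).differentiableAt (by simp)).clm_apply
      (differentiableAt_const v)
  have key : ∀ α β : CIndex d, wirtinger α (wirtinger β F) z =
      (wirtinger α (fun z => fderiv ℝ F z (wirtingerRe β)) z +
        wirtingerCoeff β * wirtinger α (fun z => fderiv ℝ F z (wirtingerIm β)) z) / 2 := by
    intro α β
    have : wirtinger β F = fun z => (1 / 2) * (fderiv ℝ F z (wirtingerRe β) +
      wirtingerCoeff β * fderiv ℝ F z (wirtingerIm β)) :=
      funext fun z => by rw [wirtinger_eq]; ring
    rw [this, wirtinger_const_mul, wirtinger_add, wirtinger_const_mul]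
    · ring
    · exact hd _
    · exact hd _
    · exact (hd _).const_mul _
    · exact (hd _).add ((hd _).const_mul _)
  rw [key, key]
  simp only [wirtinger_eq α, wirtinger_eq β]
  rw [fderiv_fderiv_apply_comm hF (wirtingerRe β) (wirtingerRe α),
    fderiv_fderiv_apply_comm hF (wirtingerRe β) (wirtingerIm α),
    fderiv_fderiv_apply_comm hF (wirtingerIm β) (wirtingerRe α),
    fderiv_fderiv_apply_comm hF (wirtingerIm β) (wirtingerIm α)]
  ring

theorem iterWirtinger_cons (α : CIndex d) (l : List (CIndex d)) (F : (Fin d → ℂ) → ℂ) :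
    iterWirtinger (α :: l) F = wirtinger α (iterWirtinger l F) := rfl

theorem wirtinger_star (F : (Fin d → ℂ) → ℂ) {z : Fin d → ℂ} (hF : DifferentiableAt ℝ F z)
    (i : Fin d) :
    wirtinger (Sum.inr i) (fun z => starRingEnd ℂ (F z)) z =
      starRingEnd ℂ (wirtinger (Sum.inl i) F z) := by
  have h : HasFDerivAt (fun z => starRingEnd ℂ (F z))
      ((Complex.conjCLE : ℂ →L[ℝ] ℂ).comp (fderiv ℝ F z)) z :=
    (Complex.conjCLE : ℂ →L[ℝ] ℂ).hasFDerivAt.comp z hF.hasFDerivAt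
  simp [wirtinger, h.fderiv, map_ofNat]

end Wirtinger

/-! ### The algebra of smooth functions on an open set -/

section SmoothAlgebra

variable {d : ℕ} (U : TopologicalSpace.Opens (Fin d → ℂ))

/-- The extension by zero. -/
def extendZero (F : U → ℂ) : (Fin d → ℂ) → ℂ := Function.extend Subtype.val F 0

variable {U}

theorem extendZero_apply (F : U → ℂ) {z : Fin d → ℂ} (hz : z ∈ U) :
    extendZero U F z = F ⟨z, hz⟩ :=
  Subtype.val_injective.extend_apply F 0 ⟨z, hz⟩

theorem extendZero_restrict_eqOn (f : (Fin d → ℂ) → ℂ) :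
    Set.EqOn (extendZero U fun u => f u) f U := fun _ hz => extendZero_apply _ hz

variable (U) in
/-- The algebra of the smooth functions on `U`. -/
def smoothAlgebra : Subalgebra ℂ (U → ℂ) where
  carrier := {F | ContDiffOn ℝ ∞ (extendZero U F) U}
  mul_mem' {F G} hF hG := (ContDiffOn.mul hF hG).congr fun z hz => by
    rw [extendZero_apply _ hz, extendZero_apply _ hz, extendZero_apply _ hz, Pi.mul_apply]
  add_mem' {F G} hF hG := (ContDiffOn.add hF hG).congr fun z hz => by
    rw [extendZero_apply _ hz, extendZero_apply _ hz, extendZero_apply _ hz, Pi.add_apply]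
  algebraMap_mem' c := (contDiffOn_const (c := c)).congr fun z hz => by
    rw [extendZero_apply _ hz]
    rfl

/-- The restriction of a smooth function. -/
def smoothRestrict (f : (Fin d → ℂ) → ℂ) (hf : ContDiffOn ℝ ∞ f U) : smoothAlgebra U :=
  ⟨fun u => f u, hf.congr (extendZero_restrict_eqOn f)⟩

theorem smoothAlgebra_contDiffAt (F : smoothAlgebra U) {z : Fin d → ℂ} (hz : z ∈ U) :
    ContDiffAt ℝ ∞ (extendZero U F.1) z :=
  ContDiffOn.contDiffAt F.2 (U.isOpen.mem_nhds hz)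

theorem smoothAlgebra_differentiableAt (F : smoothAlgebra U) {z : Fin d → ℂ} (hz : z ∈ U) :
    DifferentiableAt ℝ (extendZero U F.1) z :=
  (smoothAlgebra_contDiffAt F hz).differentiableAt (by simp)

theorem eventuallyEq_of_eqOn {f g : (Fin d → ℂ) → ℂ} (h : Set.EqOn f g U) {z : Fin d → ℂ}
    (hz : z ∈ U) : f =ᶠ[nhds z] g :=
  Filter.eventuallyEq_of_mem (U.isOpen.mem_nhds hz) h

variable (U) in
/-- The Wirtinger derivatives as derivations. -/
def wirtingerDerivation (α : CIndex d) : Derivation ℂ (smoothAlgebra U) (smoothAlgebra U) :=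
  Derivation.mk'
    { toFun := fun F => smoothRestrict (wirtinger α (extendZero U F.1))
        (ContDiffOn.wirtinger U.isOpen F.2 α)
      map_add' := fun F G => Subtype.ext <| funext fun u => by
        change wirtinger α (extendZero U (F + G).1) u =
          wirtinger α (extendZero U F.1) u + wirtinger α (extendZero U G.1) u
        rw [← wirtinger_add α (smoothAlgebra_differentiableAt F u.2)
          (smoothAlgebra_differentiableAt G u.2)]
        refine (eventuallyEq_of_eqOn (U := U) (fun z hz => ?_) u.2).wirtinger_eq α
        simp only [extendZero_apply _ hz]
        rfl
      map_smul' := fun c F => Subtype.ext <| funext fun u => by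
        change wirtinger α (extendZero U (c • F).1) u = c * wirtinger α (extendZero U F.1) u
        rw [← wirtinger_const_mul α c (smoothAlgebra_differentiableAt F u.2)]
        refine (eventuallyEq_of_eqOn (U := U) (fun z hz => ?_) u.2).wirtinger_eq α
        simp only [extendZero_apply _ hz]
        rfl }
    fun F G => Subtype.ext <| funext fun u => by
      change wirtinger α (extendZero U (F * G).1) u =
        F.1 u * wirtinger α (extendZero U G.1) u + G.1 u * wirtinger α (extendZero U F.1) u
      rw [← extendZero_apply F.1 u.2, ← extendZero_apply G.1 u.2,
        ← wirtinger_mul α (smoothAlgebra_differentiableAt F u.2)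
          (smoothAlgebra_differentiableAt G u.2)]
      refine (eventuallyEq_of_eqOn (U := U) (fun z hz => ?_) u.2).wirtinger_eq α
      simp only [extendZero_apply _ hz]
      rfl

theorem wirtingerDerivation_apply (α : CIndex d) (F : smoothAlgebra U) (u : U) :
    (wirtingerDerivation U α F).1 u = wirtinger α (extendZero U F.1) u := rfl

theorem wirtingerDerivation_comm (α β : CIndex d) (F : smoothAlgebra U) :
    wirtingerDerivation U α (wirtingerDerivation U β F) =
      wirtingerDerivation U β (wirtingerDerivation U α F) := by
  have key : ∀ α β : CIndex d, ∀ u : U,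
      (wirtingerDerivation U α (wirtingerDerivation U β F)).1 u =
        wirtinger α (wirtinger β (extendZero U F.1)) u := fun α β u => by
    rw [wirtingerDerivation_apply]
    exact (eventuallyEq_of_eqOn (U := U) (fun z hz => extendZero_apply _ hz)
      u.2).wirtinger_eq α
  refine Subtype.ext (funext fun u => ?_)
  rw [key, key, wirtinger_comm (smoothAlgebra_contDiffAt F u.2)]

/-- Differentiation is local and `U` is open, so the extension by zero has no influence on the
values in `U`. -/
theorem iterDeriv_wirtingerDerivation (l : List (CIndex d)) (f : (Fin d → ℂ) → ℂ)
    (hf : ContDiffOn ℝ ∞ f U) (u : U) :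
    (iterDeriv (wirtingerDerivation U) l (smoothRestrict f hf)).1 u = iterWirtinger l f u := by
  induction l generalizing u with
  | nil => rfl
  | cons α l ih =>
    rw [iterDeriv_cons, wirtingerDerivation_apply, iterWirtinger_cons]
    exact (eventuallyEq_of_eqOn (U := U) (fun z hz => by
      rw [extendZero_apply _ hz, ih]) u.2).wirtinger_eq α

variable (U) in
/-- The evaluation at a point of `U`. -/
def smoothEval (u : U) : smoothAlgebra U →ₐ[ℂ] ℂ :=
  (Pi.evalAlgHom ℂ (fun _ : U => ℂ) u).comp (smoothAlgebra U).val

theorem smoothEval_apply (u : U) (F : smoothAlgebra U) : smoothEval U u F = F.1 u := rfl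

end SmoothAlgebra

/-! ### Wirtinger derivatives and holomorphic maps -/

section Holomorphic

variable {d : ℕ}

/-- The holomorphic Jacobian matrix `∂σₐ/∂zᵢ`. -/
def jacobian (σ : (Fin d → ℂ) → Fin d → ℂ) (w : Fin d → ℂ) : Matrix (Fin d) (Fin d) ℂ :=
  Matrix.of fun i a => fderiv ℂ σ w (Pi.single i 1) a

theorem single_I (i : Fin d) :
    (Pi.single i Complex.I : Fin d → ℂ) = Complex.I • Pi.single i 1 := by
  rw [← Pi.single_smul, smul_eq_mul, mul_one]

theorem eq_sum_smul_single (u : Fin d → ℂ) :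
    u = ∑ a, u a • (Pi.single a 1 : Fin d → ℂ) := by
  ext b
  simp [Finset.sum_apply, Pi.single_apply]

theorem realLinear_apply_smul (L : (Fin d → ℂ) →L[ℝ] ℂ) (c : ℂ) (v : Fin d → ℂ) :
    L (c • v) = c.re * L v + c.im * L (Complex.I • v) := by
  have : c • v = c.re • v + c.im • (Complex.I • v) := by
    ext b
    simp only [Pi.smul_apply, Pi.add_apply, Complex.real_smul, smul_eq_mul]
    conv_lhs => rw [← Complex.re_add_im c]
    ring
  rw [this, map_add, map_smul, map_smul, Complex.real_smul, Complex.real_smul]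

/-- For a real linear `L` the map `u ↦ L u - i L (i u)` is complex linear, hence determined by its
values on the basis; with the opposite sign it is conjugate linear. -/
theorem realLinear_inl (L : (Fin d → ℂ) →L[ℝ] ℂ) (u : Fin d → ℂ) :
    L u - Complex.I * L (Complex.I • u) =
      ∑ a, u a * (L (Pi.single a 1) - Complex.I * L (Complex.I • Pi.single a 1)) := by
  conv_lhs => rw [eq_sum_smul_single u]
  rw [Finset.smul_sum, map_sum, map_sum, Finset.mul_sum, ← Finset.sum_sub_distrib]
  refine Finset.sum_congr rfl fun a _ => ?_
  rw [smul_smul, realLinear_apply_smul L (u a), realLinear_apply_smul L (Complex.I * u a)]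
  conv_rhs => rw [← Complex.re_add_im (u a)]
  simp only [Complex.mul_re, Complex.mul_im, Complex.I_re, Complex.I_im]
  push_cast
  linear_combination ((u a).im * L (Complex.I • Pi.single a 1)) * Complex.I_sq

theorem realLinear_inr (L : (Fin d → ℂ) →L[ℝ] ℂ) (u : Fin d → ℂ) :
    L u + Complex.I * L (Complex.I • u) =
      ∑ a, starRingEnd ℂ (u a) *
        (L (Pi.single a 1) + Complex.I * L (Complex.I • Pi.single a 1)) := by
  conv_lhs => rw [eq_sum_smul_single u]
  rw [Finset.smul_sum, map_sum, map_sum, Finset.mul_sum, ← Finset.sum_add_distrib]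
  refine Finset.sum_congr rfl fun a _ => ?_
  rw [smul_smul, realLinear_apply_smul L (u a), realLinear_apply_smul L (Complex.I * u a)]
  have hc : starRingEnd ℂ (u a) = (u a).re - (u a).im * Complex.I := by
    apply Complex.ext <;> simp
  rw [hc]
  simp only [Complex.mul_re, Complex.mul_im, Complex.I_re, Complex.I_im]
  push_cast
  linear_combination ((u a).im * L (Complex.I • Pi.single a 1)) * Complex.I_sq

variable {G : (Fin d → ℂ) → ℂ} {σ : (Fin d → ℂ) → Fin d → ℂ} {w : Fin d → ℂ}

theorem fderiv_comp_holomorphic (hG : DifferentiableAt ℝ G (σ w)) (hσ : DifferentiableAt ℂ σ w)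
    (v : Fin d → ℂ) :
    fderiv ℝ (fun z => G (σ z)) w v = fderiv ℝ G (σ w) (fderiv ℂ σ w v) := by
  have h := hG.hasFDerivAt.comp w (hσ.hasFDerivAt.restrictScalars ℝ)
  exact congrArg (fun L : (Fin d → ℂ) →L[ℝ] ℂ => L v) h.fderiv

theorem wirtinger_inl_comp (hG : DifferentiableAt ℝ G (σ w)) (hσ : DifferentiableAt ℂ σ w)
    (i : Fin d) :
    wirtinger (Sum.inl i) (fun z => G (σ z)) w =
      ∑ a, jacobian σ w i a * wirtinger (Sum.inl a) G (σ w) := by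
  simp only [wirtinger, fderiv_comp_holomorphic hG hσ, single_I, map_smul]
  rw [realLinear_inl, Finset.sum_div]
  exact Finset.sum_congr rfl fun a _ => mul_div_assoc _ _ _

theorem wirtinger_inr_comp (hG : DifferentiableAt ℝ G (σ w)) (hσ : DifferentiableAt ℂ σ w)
    (i : Fin d) :
    wirtinger (Sum.inr i) (fun z => G (σ z)) w =
      ∑ a, starRingEnd ℂ (jacobian σ w i a) * wirtinger (Sum.inr a) G (σ w) := by
  simp only [wirtinger, fderiv_comp_holomorphic hG hσ, single_I, map_smul]
  rw [realLinear_inr, Finset.sum_div]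
  exact Finset.sum_congr rfl fun a _ => mul_div_assoc _ _ _

theorem wirtinger_inr_of_holomorphic (hG : DifferentiableAt ℂ G w) (i : Fin d) :
    wirtinger (Sum.inr i) G w = 0 := by
  have h := (hG.hasFDerivAt.restrictScalars ℝ).fderiv
  simp only [wirtinger, h, single_I, ContinuousLinearMap.coe_restrictScalars', map_smul,
    smul_eq_mul]
  rw [← mul_assoc, Complex.I_mul_I]
  simp

/-- The Jacobian is holomorphic, so the barred derivative annihilates it and no first derivatives of
`G` appear. -/
theorem wirtinger_wirtinger_comp {U : Set (Fin d → ℂ)} (hU : IsOpen U)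
    (hG : ContDiffOn ℝ ∞ G U) (hw : σ w ∈ U) (hσ : ContDiffAt ℂ ω σ w) (j k : Fin d) :
    wirtinger (Sum.inr k) (wirtinger (Sum.inl j) fun z => G (σ z)) w =
      ∑ a, ∑ b, jacobian σ w j a * (starRingEnd ℂ (jacobian σ w k b) *
        wirtinger (Sum.inr b) (wirtinger (Sum.inl a) G) (σ w)) := by
  have hev : wirtinger (Sum.inl j) (fun z => G (σ z)) =ᶠ[nhds w]
      fun z => ∑ a, jacobian σ z j a * wirtinger (Sum.inl a) G (σ z) := by
    have h1 : ∀ᶠ z in nhds w, σ z ∈ U :=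
      hσ.continuousAt.eventually_mem (hU.mem_nhds hw)
    have h2 : ∀ᶠ z in nhds w, ContDiffAt ℂ ω σ z := hσ.eventually (by simp)
    filter_upwards [h1, h2] with z hz1 hz2
    exact wirtinger_inl_comp ((hG.contDiffAt (hU.mem_nhds hz1)).differentiableAt (by simp))
      (hz2.differentiableAt (by simp)) j
  have hJ : ∀ a, DifferentiableAt ℂ (fun z => jacobian σ z j a) w := fun a => by
    have h1 : DifferentiableAt ℂ (fderiv ℂ σ) w :=
      (hσ.fderiv_right (m := ω) le_rfl).differentiableAt (by simp)
    have h2 := h1.clm_apply (differentiableAt_const (Pi.single j (1 : ℂ) : Fin d → ℂ))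
    exact differentiableAt_pi.1 h2 a
  have hW : ∀ a, DifferentiableAt ℝ (wirtinger (Sum.inl a) G) (σ w) := fun a =>
    ((hG.wirtinger hU (Sum.inl a)).contDiffAt (hU.mem_nhds hw)).differentiableAt (by simp)
  have hσd : DifferentiableAt ℂ σ w := hσ.differentiableAt (by simp)
  have hWc : ∀ a, DifferentiableAt ℝ (fun z => wirtinger (Sum.inl a) G (σ z)) w := fun a =>
    (hW a).comp w (hσd.restrictScalars ℝ)
  have hsum := wirtinger_sum (Sum.inr k) Finset.univ (z := w)
    (F := fun a z => jacobian σ z j a * wirtinger (Sum.inl a) G (σ z))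
    fun a _ => ((hJ a).restrictScalars ℝ).mul (hWc a)
  rw [hev.wirtinger_eq, hsum]
  refine Finset.sum_congr rfl fun a _ => ?_
  rw [wirtinger_mul _ ((hJ a).restrictScalars ℝ) (hWc a), wirtinger_inr_of_holomorphic (hJ a),
    mul_zero, add_zero, wirtinger_inr_comp (hW a) hσd, Finset.mul_sum]

end Holomorphic

/-! ### The Laplacian in holomorphic coordinates -/

namespace KahlerMetric

variable {d : ℕ} {M : Type*} [TopologicalSpace M] [ChartedSpace (Fin d → ℂ) M]
  (g : KahlerMetric d M)

/-- The Christoffel symbols with mixed lower indices vanish, so the second covariant derivative is a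
plain one. -/
theorem tensorLaplacian_function (φ : OpenPartialHomeomorph M (Fin d → ℂ))
    (F : (Fin d → ℂ) → ℂ) (β : Fin 0 → CIndex d) (z : Fin d → ℂ) :
    g.tensorLaplacian φ (p := 0) (fun _ => F) β z =
      ∑ j, ∑ k, g.invComp φ j k z * wirtinger (Sum.inr k) (wirtinger (Sum.inl j) F) z := by
  unfold tensorLaplacian
  refine Finset.sum_congr rfl fun j _ => Finset.sum_congr rfl fun k _ => ?_
  congr 1
  have hinner : ∀ γ : Fin 1 → CIndex d, g.covDeriv φ (p := 0) (fun _ => F) γ =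
      wirtinger (γ (Fin.last 0)) F := fun γ => by
    funext z
    simp [covDeriv]
  have hch : ∀ δ, g.christoffel φ (Sum.inr k) (Sum.inl j) δ z = 0 := fun δ => by
    cases δ <;> rfl
  rw [covDeriv]
  simp only [hinner]
  simp [hch, Fin.snoc]

variable {φ ψ : OpenPartialHomeomorph M (Fin d → ℂ)}

theorem transition_contDiffAt (hφ : φ ∈ IsManifold.maximalAtlas 𝓘(ℂ, Fin d → ℂ) ω M)
    (hψ : ψ ∈ IsManifold.maximalAtlas 𝓘(ℂ, Fin d → ℂ) ω M) {w : Fin d → ℂ}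
    (hw : w ∈ ψ.target) (hw' : ψ.symm w ∈ φ.source) :
    ContDiffAt ℂ ω (fun z => φ (ψ.symm z)) w := by
  rw [← contMDiffAt_iff_contDiffAt]
  exact (contMDiffAt_of_mem_maximalAtlas hφ hw').comp w
    (contMDiffAt_symm_of_mem_maximalAtlas hψ hw)

theorem mdifferentiable_of_mem_maximalAtlas
    (hφ : φ ∈ IsManifold.maximalAtlas 𝓘(ℂ, Fin d → ℂ) ω M) :
    φ.MDifferentiable 𝓘(ℂ, Fin d → ℂ) 𝓘(ℂ, Fin d → ℂ) :=
  ⟨(contMDiffOn_of_mem_maximalAtlas hφ).mdifferentiableOn (by simp),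
    (contMDiffOn_symm_of_mem_maximalAtlas hφ).mdifferentiableOn (by simp)⟩

/-- The Hermitian form on the model space. -/
def modelForm (y : M) : (Fin d → ℂ) →ₗ[ℂ] (Fin d → ℂ) →ₛₗ[starRingEnd ℂ] ℂ := g.form y

theorem modelForm_sum_smul (y : M) (c c' : Fin d → ℂ) (u u' : Fin d → Fin d → ℂ) :
    g.modelForm y (∑ a, c a • u a) (∑ b, c' b • u' b) =
      ∑ a, ∑ b, c a * (starRingEnd ℂ (c' b) * g.modelForm y (u a) (u' b)) := by
  simp only [map_sum, map_smul, map_smulₛₗ, LinearMap.sum_apply, LinearMap.smul_apply,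
    smul_eq_mul, Finset.mul_sum]
  rw [Finset.sum_comm]
  exact Finset.sum_congr rfl fun a _ => Finset.sum_congr rfl fun b _ => by ring

/-- The derivative of the inverse of a coordinate system as a map of the model space. -/
def symmDeriv (φ : OpenPartialHomeomorph M (Fin d → ℂ)) (z : Fin d → ℂ) :
    (Fin d → ℂ) →L[ℂ] (Fin d → ℂ) :=
  mfderiv 𝓘(ℂ, Fin d → ℂ) 𝓘(ℂ, Fin d → ℂ) φ.symm z

/-- The coordinate vectors as vectors of the model space. -/
def modelCoordVector (φ : OpenPartialHomeomorph M (Fin d → ℂ)) (z : Fin d → ℂ) (i : Fin d) :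
    Fin d → ℂ := symmDeriv φ z (Pi.single i 1)

theorem symmDeriv_apply (φ : OpenPartialHomeomorph M (Fin d → ℂ)) (z v : Fin d → ℂ) :
    symmDeriv φ z v = ∑ a, v a • modelCoordVector φ z a := by
  conv_lhs => rw [eq_sum_smul_single v, map_sum]
  exact Finset.sum_congr rfl fun a _ => map_smul _ _ _

theorem comp_eq_modelForm (i j : Fin d) (z : Fin d → ℂ) :
    g.comp φ i j z = g.modelForm (φ.symm z) (modelCoordVector φ z i) (modelCoordVector φ z j) :=
  rfl

theorem modelCoordVector_transition (hφ : φ ∈ IsManifold.maximalAtlas 𝓘(ℂ, Fin d → ℂ) ω M)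
    (hψ : ψ ∈ IsManifold.maximalAtlas 𝓘(ℂ, Fin d → ℂ) ω M) {w : Fin d → ℂ}
    (hw : w ∈ ψ.target) (hw' : ψ.symm w ∈ φ.source) (i : Fin d) :
    modelCoordVector ψ w i =
      ∑ a, jacobian (fun z => φ (ψ.symm z)) w i a •
        modelCoordVector φ (φ (ψ.symm w)) a := by
  set σ := fun z => φ (ψ.symm z) with hσ
  have hev : ψ.symm =ᶠ[nhds w] φ.symm ∘ σ := by
    have h1 : ∀ᶠ z in nhds w, ψ.symm z ∈ φ.source :=
      (ψ.continuousAt_symm hw).eventually_mem (φ.open_source.mem_nhds hw')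
    filter_upwards [h1] with z hz
    exact (φ.left_inv hz).symm
  have hσd : DifferentiableAt ℂ σ w :=
    (transition_contDiffAt hφ hψ hw hw').differentiableAt (by simp)
  have hφd := (mdifferentiable_of_mem_maximalAtlas hφ).mdifferentiableAt_symm
    (φ.map_source hw')
  have h2 : mfderiv 𝓘(ℂ, Fin d → ℂ) 𝓘(ℂ, Fin d → ℂ) (φ.symm ∘ σ) w =
      (mfderiv 𝓘(ℂ, Fin d → ℂ) 𝓘(ℂ, Fin d → ℂ) φ.symm (σ w)).comp
        (mfderiv 𝓘(ℂ, Fin d → ℂ) 𝓘(ℂ, Fin d → ℂ) σ w) :=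
    mfderiv_comp w hφd hσd.mdifferentiableAt
  have h3 : symmDeriv ψ w = (symmDeriv φ (σ w)).comp (fderiv ℂ σ w) := by
    have h4 := hev.mfderiv_eq (I := 𝓘(ℂ, Fin d → ℂ)) (I' := 𝓘(ℂ, Fin d → ℂ))
    rw [h2, mfderiv_eq_fderiv] at h4
    exact h4
  rw [modelCoordVector, h3, ContinuousLinearMap.comp_apply, symmDeriv_apply]
  rfl

theorem comp_transition (hφ : φ ∈ IsManifold.maximalAtlas 𝓘(ℂ, Fin d → ℂ) ω M)
    (hψ : ψ ∈ IsManifold.maximalAtlas 𝓘(ℂ, Fin d → ℂ) ω M) {w : Fin d → ℂ}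
    (hw : w ∈ ψ.target) (hw' : ψ.symm w ∈ φ.source) :
    (Matrix.of fun i j => g.comp ψ i j w) =
      jacobian (fun z => φ (ψ.symm z)) w *
        (Matrix.of fun a b => g.comp φ a b (φ (ψ.symm w))) *
        (jacobian (fun z => φ (ψ.symm z)) w).conjTranspose := by
  ext i j
  have hpt : ψ.symm w = φ.symm (φ (ψ.symm w)) := (φ.left_inv hw').symm
  rw [Matrix.of_apply, comp_eq_modelForm, modelCoordVector_transition hφ hψ hw hw',
    modelCoordVector_transition hφ hψ hw hw', modelForm_sum_smul, Matrix.mul_apply]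
  simp only [Matrix.mul_apply, Matrix.of_apply, Matrix.conjTranspose_apply, comp_eq_modelForm,
    ← hpt, Finset.sum_mul]
  rw [Finset.sum_comm]
  refine Finset.sum_congr rfl fun b _ => Finset.sum_congr rfl fun a _ => ?_
  rw [starRingEnd_apply]
  ring

/-- A left null vector of the matrix consists of the coefficients of a tangent vector of length
zero. By positivity that vector is zero, and the coordinate vectors are independent. -/
theorem det_comp_ne_zero (hφ : φ ∈ IsManifold.maximalAtlas 𝓘(ℂ, Fin d → ℂ) ω M)
    {z : Fin d → ℂ} (hz : z ∈ φ.target) : (Matrix.of fun i j => g.comp φ i j z).det ≠ 0 := by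
  intro h0
  obtain ⟨v, hv, hv0⟩ := Matrix.exists_vecMul_eq_zero_iff.2 h0
  have hX : modelForm g (φ.symm z) (∑ a, v a • modelCoordVector φ z a)
      (∑ a, v a • modelCoordVector φ z a) = 0 := by
    rw [modelForm_sum_smul, Finset.sum_comm]
    refine Finset.sum_eq_zero fun b _ => ?_
    have := congrFun hv0 b
    simp only [Matrix.vecMul, dotProduct, Matrix.of_apply, comp_eq_modelForm,
      Pi.zero_apply] at this
    calc _ = starRingEnd ℂ (v b) * ∑ a, v a * g.modelForm (φ.symm z) (modelCoordVector φ z a)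
          (modelCoordVector φ z b) := by
          rw [Finset.mul_sum]
          exact Finset.sum_congr rfl fun a _ => by ring
      _ = 0 := by rw [this, mul_zero]
  have hinj := (mdifferentiable_of_mem_maximalAtlas hφ).symm.mfderiv_injective (x := z) hz
  have hne : symmDeriv φ z v ≠ 0 := fun h =>
    hv (hinj (h.trans (map_zero (symmDeriv φ z)).symm))
  rw [← symmDeriv_apply] at hX
  have := g.pos (φ.symm z) _ hne
  exact absurd (this.trans_eq (congrArg Complex.re hX)) (lt_irrefl _)

/-- The Laplacian in arbitrary holomorphic coordinates. -/
theorem laplacian_eq [IsManifold 𝓘(ℂ, Fin d → ℂ) ω M]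
    (hφ : φ ∈ IsManifold.maximalAtlas 𝓘(ℂ, Fin d → ℂ) ω M) (h : M → ℂ)
    (hh : ContDiffOn ℝ ∞ (h ∘ φ.symm) φ.target) {z : Fin d → ℂ} (hz : z ∈ φ.target) :
    g.laplacian h (φ.symm z) = ∑ j, ∑ k, g.invComp φ j k z *
      wirtinger (Sum.inr k) (wirtinger (Sum.inl j) (h ∘ φ.symm)) z := by
  set y := φ.symm z with hy
  set ψ := chartAt (Fin d → ℂ) y with hψdef
  have hψ : ψ ∈ IsManifold.maximalAtlas 𝓘(ℂ, Fin d → ℂ) ω M :=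
    IsManifold.chart_mem_maximalAtlas y
  have hyψ : y ∈ ψ.source := mem_chart_source _ y
  set w := ψ y with hwdef
  have hw : w ∈ ψ.target := ψ.map_source hyψ
  have hwy : ψ.symm w = y := ψ.left_inv hyψ
  have hyφ : y ∈ φ.source := φ.map_target hz
  have hw' : ψ.symm w ∈ φ.source := hwy ▸ hyφ
  have hσw : φ (ψ.symm w) = z := by rw [hwy, hy, φ.right_inv hz]
  set σ := fun z => φ (ψ.symm z) with hσ
  have hσw' : σ w = z := hσw
  have hev : (h ∘ ψ.symm) =ᶠ[nhds w] fun z => (h ∘ φ.symm) (σ z) := by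
    have h1 : ∀ᶠ z in nhds w, ψ.symm z ∈ φ.source :=
      (ψ.continuousAt_symm hw).eventually_mem (φ.open_source.mem_nhds hw')
    filter_upwards [h1] with z hz
    simp only [Function.comp_apply, hσ, φ.left_inv hz]
  have hev2 : ∀ j, wirtinger (Sum.inl j) (h ∘ ψ.symm) =ᶠ[nhds w]
      wirtinger (Sum.inl j) fun z => (h ∘ φ.symm) (σ z) := fun j =>
    hev.eventuallyEq_nhds.mono fun z hz => hz.wirtinger_eq _
  have hWW : ∀ j k, wirtinger (Sum.inr k) (wirtinger (Sum.inl j) (h ∘ ψ.symm)) w =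
      ∑ a, ∑ b, jacobian σ w j a * (starRingEnd ℂ (jacobian σ w k b) *
        wirtinger (Sum.inr b) (wirtinger (Sum.inl a) (h ∘ φ.symm)) (σ w)) := fun j k => by
    rw [(hev2 j).wirtinger_eq]
    exact wirtinger_wirtinger_comp φ.open_target hh (φ.map_source hw')
      (transition_contDiffAt hφ hψ hw hw') j k
  have hmat := g.comp_transition hφ hψ hw hw'
  have hdet := g.det_comp_ne_zero hψ hw
  rw [hmat, Matrix.det_mul, Matrix.det_mul] at hdet
  have hJ : IsUnit (jacobian σ w).det :=
    isUnit_iff_ne_zero.2 (left_ne_zero_of_mul (left_ne_zero_of_mul hdet))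
  have hJ' : IsUnit (jacobian σ w).conjTranspose.det :=
    isUnit_iff_ne_zero.2 (right_ne_zero_of_mul hdet)
  -- The Laplacian is the trace of `G⁻¹ * T`, with `T` the matrix of mixed second derivatives. A
  -- change of coordinates turns `G` into `J G J*` and `T` into `J T J*`, and the factors cancel
  -- under the trace.
  have htrace : ∀ (χ : OpenPartialHomeomorph M (Fin d → ℂ)) (u : Fin d → ℂ)
      (T : Matrix (Fin d) (Fin d) ℂ),
      ∑ j, ∑ k, g.invComp χ j k u * T j k =
        ((Matrix.of fun a b => g.comp χ a b u)⁻¹ * T).trace := by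
    intro χ u T
    rw [Matrix.trace, Finset.sum_comm]
    simp only [Matrix.diag, Matrix.mul_apply]
    rfl
  change g.tensorLaplacian ψ (p := 0) (fun _ => h ∘ ψ.symm) Fin.elim0 w = _
  rw [tensorLaplacian_function]
  have hT : (Matrix.of fun j k => wirtinger (Sum.inr k) (wirtinger (Sum.inl j) (h ∘ ψ.symm)) w) =
      jacobian σ w * (Matrix.of fun a b =>
        wirtinger (Sum.inr b) (wirtinger (Sum.inl a) (h ∘ φ.symm)) z) *
        (jacobian σ w).conjTranspose := by
    ext j k
    rw [Matrix.of_apply, hWW, hσw']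
    simp only [Matrix.mul_apply, Matrix.of_apply, Matrix.conjTranspose_apply, Finset.sum_mul]
    rw [Finset.sum_comm]
    refine Finset.sum_congr rfl fun b _ => Finset.sum_congr rfl fun a _ => ?_
    rw [starRingEnd_apply]
    ring
  have e1 := htrace ψ w
    (Matrix.of fun j k => wirtinger (Sum.inr k) (wirtinger (Sum.inl j) (h ∘ ψ.symm)) w)
  have e2 := htrace φ z
    (Matrix.of fun j k => wirtinger (Sum.inr k) (wirtinger (Sum.inl j) (h ∘ φ.symm)) z)
  simp only [Matrix.of_apply] at e1 e2
  rw [e2]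
  refine e1.trans ?_
  rw [hT, hmat, hσw, Matrix.mul_inv_rev, Matrix.mul_inv_rev]
  set J := jacobian σ w
  set T := Matrix.of fun j k => wirtinger (Sum.inr k) (wirtinger (Sum.inl j) (h ∘ φ.symm)) z
  set G := Matrix.of fun a b => g.comp φ a b z
  calc (J.conjTranspose⁻¹ * (G⁻¹ * J⁻¹) * (J * T * J.conjTranspose)).trace
      = (J.conjTranspose⁻¹ * (G⁻¹ * (J⁻¹ * J) * T * J.conjTranspose)).trace := by
        simp only [Matrix.mul_assoc]
    _ = (G⁻¹ * (J⁻¹ * J) * T * (J.conjTranspose * J.conjTranspose⁻¹)).trace := by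
        rw [Matrix.trace_mul_comm, Matrix.mul_assoc _ J.conjTranspose]
    _ = (G⁻¹ * T).trace := by
        rw [Matrix.nonsing_inv_mul _ hJ, Matrix.mul_nonsing_inv _ hJ', Matrix.mul_one,
          Matrix.mul_one]

/-- Smoothness of `f` is read off in the preferred charts; another chart of the atlas differs by a
transition map that is analytic over ℂ, hence smooth over ℝ. -/
theorem contDiffOn_comp_symm [IsManifold 𝓘(ℂ, Fin d → ℂ) ω M]
    (hφ : φ ∈ IsManifold.maximalAtlas 𝓘(ℂ, Fin d → ℂ) ω M)
    {f : M → ℂ} (hf : ContMDiff 𝓘(ℝ, Fin d → ℂ) 𝓘(ℝ, ℂ) ∞ f) :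
    ContDiffOn ℝ ∞ (f ∘ φ.symm) φ.target := by
  intro z hz
  set y := φ.symm z with hy
  set ψ := chartAt (Fin d → ℂ) y with hψdef
  have hψ : ψ ∈ IsManifold.maximalAtlas 𝓘(ℂ, Fin d → ℂ) ω M :=
    IsManifold.chart_mem_maximalAtlas y
  have hyψ : y ∈ ψ.source := mem_chart_source _ y
  have h1 : ContDiffAt ℝ ∞ (f ∘ ψ.symm) (ψ y) := by
    have := (contMDiffAt_iff.1 (hf y)).2
    simpa [contDiffWithinAt_univ, hψdef, chartAt_self_eq, Function.comp_def] using this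
  have h2 : ContDiffAt ℝ ∞ (fun z => ψ (φ.symm z)) z :=
    ((transition_contDiffAt hψ hφ hz hyψ).restrict_scalars ℝ).of_le (by simp)
  have h3 : ContDiffAt ℝ ∞ ((f ∘ ψ.symm) ∘ fun z => ψ (φ.symm z)) z := ContDiffAt.comp z h1 h2
  refine (h3.congr_of_eventuallyEq ?_).contDiffWithinAt
  have h4 : ∀ᶠ z in nhds z, φ.symm z ∈ ψ.source :=
    (φ.continuousAt_symm hz).eventually_mem (ψ.open_source.mem_nhds hyψ)
  filter_upwards [h4] with z hz
  simp only [Function.comp_apply, ψ.left_inv hz]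

end KahlerMetric

/-! ### Units in the algebra of smooth functions -/

section SmoothAlgebraUnits

variable {d : ℕ} {U : TopologicalSpace.Opens (Fin d → ℂ)}

theorem smoothAlgebra_isUnit {F : smoothAlgebra U} (h : ∀ u, F.1 u ≠ 0) : IsUnit F := by
  have hs : ContDiffOn ℝ ∞ (extendZero U fun u => (F.1 u)⁻¹) U :=
    (ContDiffOn.inv (𝕜 := ℝ) F.2 fun z hz => by rw [extendZero_apply _ hz]; exact h _).congr
      fun z hz => by simp only [extendZero_apply _ hz, Pi.inv_apply]
  exact IsUnit.of_mul_eq_one ⟨_, hs⟩ (Subtype.ext (funext fun u => mul_inv_cancel₀ (h u)))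

end SmoothAlgebraUnits

/-! ### Derivatives of a matrix minus the identity -/

section IterDeriv

variable {A : Type*} [CommRing A] [Algebra ℂ A] {d : ℕ} (D : CIndex d → Derivation ℂ A A)

theorem iterDeriv_add (l : List (CIndex d)) (F G : A) :
    iterDeriv D l (F + G) = iterDeriv D l F + iterDeriv D l G := by
  induction l with
  | nil => rfl
  | cons α l ih => rw [iterDeriv_cons, ih, map_add]; rfl

theorem deriv_one_apply (α : CIndex d) (i j : Fin d) :
    D α ((1 : Matrix (Fin d) (Fin d) A) i j) = 0 := by
  rw [Matrix.one_apply]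
  split_ifs
  · exact (D α).map_one_eq_zero
  · exact map_zero _

theorem iterDeriv_one_apply {l : List (CIndex d)} (hl : l ≠ []) (i j : Fin d) :
    iterDeriv D l ((1 : Matrix (Fin d) (Fin d) A) i j) = 0 := by
  induction l with
  | nil => exact absurd rfl hl
  | cons α l ih =>
    rw [iterDeriv_cons]
    by_cases h : l = []
    · rw [h]
      exact deriv_one_apply D α i j
    · rw [ih h, map_zero]

theorem iterDeriv_sub_one {l : List (CIndex d)} (hl : l ≠ []) (G : Matrix (Fin d) (Fin d) A)
    (i j : Fin d) : iterDeriv D l ((G - 1) i j) = iterDeriv D l (G i j) := by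
  have h := iterDeriv_add D l ((G - 1) i j) ((1 : Matrix (Fin d) (Fin d) A) i j)
  rw [iterDeriv_one_apply D hl, add_zero, Matrix.sub_apply, sub_add_cancel] at h
  exact h.symm

end IterDeriv

/-! ### Bounding the degrees by the weight -/

namespace PointedGraph

variable {V E : Type} [Fintype V] [Fintype E] {Γ : PointedGraph V E}

/-- The other |V| vertices take at least one each of the total |V| + k. -/
theorem le_of_sum_eq_card_add {δ : Option V → ℕ} (h1 : ∀ a, 1 ≤ δ a) {k : ℕ}
    (h : ∑ a, δ a = Fintype.card V + k) (a : Option V) : δ a ≤ k := by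
  classical
  have h2 : Fintype.card V ≤ ∑ b ∈ Finset.univ.erase a, δ b := by
    calc Fintype.card V = ∑ _b ∈ Finset.univ.erase a, 1 := by
          simp [Finset.card_erase_of_mem]
      _ ≤ _ := Finset.sum_le_sum fun b _ => h1 b
  have h3 := Finset.add_sum_erase Finset.univ δ (Finset.mem_univ a)
  omega

theorem IsStronglyConnected.outDegree_le [Nonempty V] (h : Γ.IsStronglyConnected) {k : ℕ}
    (hk : Fintype.card E = Fintype.card V + k) (a : Option V) : Γ.outDegree a ≤ k :=
  le_of_sum_eq_card_add h.one_le_outDegree (Γ.sum_outDegree.trans hk) a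

theorem IsStronglyConnected.inDegree_le [Nonempty V] (h : Γ.IsStronglyConnected) {k : ℕ}
    (hk : Fintype.card E = Fintype.card V + k) (a : Option V) : Γ.inDegree a ≤ k :=
  le_of_sum_eq_card_add h.one_le_inDegree (Γ.sum_inDegree.trans hk) a

end PointedGraph

/-! ### The algebra of smooth functions of a coordinate system -/

namespace KahlerMetric

variable {d : ℕ} {M : Type*} [TopologicalSpace M] [ChartedSpace (Fin d → ℂ) M]
  (g : KahlerMetric d M) {φ : OpenPartialHomeomorph M (Fin d → ℂ)}

/-- The target of a coordinate system. -/
def targetOpens (φ : OpenPartialHomeomorph M (Fin d → ℂ)) :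
    TopologicalSpace.Opens (Fin d → ℂ) := ⟨φ.target, φ.open_target⟩

/-- The matrix of the smooth functions `g_{i j̄}`. -/
def compMatrix (hφ : φ ∈ IsManifold.maximalAtlas 𝓘(ℂ, Fin d → ℂ) ω M) :
    Matrix (Fin d) (Fin d) (smoothAlgebra (targetOpens φ)) :=
  Matrix.of fun i j => smoothRestrict (g.comp φ i j) (g.smooth φ hφ i j)

variable (hφ : φ ∈ IsManifold.maximalAtlas 𝓘(ℂ, Fin d → ℂ) ω M)

theorem deriv_compMatrix (α : CIndex d) (i j : Fin d) (u : targetOpens φ) :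
    (wirtingerDerivation (targetOpens φ) α (g.compMatrix hφ i j)).1 u =
      wirtinger α (g.comp φ i j) u :=
  iterDeriv_wirtingerDerivation [α] _ (g.smooth φ hφ i j) u

theorem wirtinger_inr_comp_eq (i j k : Fin d) {z : Fin d → ℂ} (hz : z ∈ φ.target)
    (hφ : φ ∈ IsManifold.maximalAtlas 𝓘(ℂ, Fin d → ℂ) ω M) :
    wirtinger (Sum.inr k) (g.comp φ i j) z =
      starRingEnd ℂ (wirtinger (Sum.inl k) (g.comp φ j i) z) := by
  have h : g.comp φ i j = fun z => starRingEnd ℂ (g.comp φ j i z) :=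
    funext fun z => (g.conj_symm _ _ _).symm
  rw [h, wirtinger_star]
  exact ((g.smooth φ hφ j i).contDiffAt (φ.open_target.mem_nhds hz)).differentiableAt (by simp)

theorem isKahlerMatrix_compMatrix :
    IsKahlerMatrix (wirtingerDerivation (targetOpens φ)) (g.compMatrix hφ) where
  comm := wirtingerDerivation_comm
  unbarred i j k := Subtype.ext <| funext fun u => by
    rw [deriv_compMatrix, deriv_compMatrix]
    exact g.kahler φ hφ u u.2 i j k
  barred i j k := Subtype.ext <| funext fun u => by
    rw [deriv_compMatrix, deriv_compMatrix, g.wirtinger_inr_comp_eq _ _ _ u.2 hφ,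
      g.wirtinger_inr_comp_eq _ _ _ u.2 hφ]
    exact congrArg _ (g.kahler φ hφ u u.2 j i k)

theorem isKahlerMatrix_compMatrix_sub_one :
    IsKahlerMatrix (wirtingerDerivation (targetOpens φ)) (g.compMatrix hφ - 1) where
  comm := wirtingerDerivation_comm
  unbarred i j k := by
    simpa only [Matrix.sub_apply, map_sub, deriv_one_apply, sub_zero] using
      (g.isKahlerMatrix_compMatrix hφ).unbarred i j k
  barred i j k := by
    simpa only [Matrix.sub_apply, map_sub, deriv_one_apply, sub_zero] using
      (g.isKahlerMatrix_compMatrix hφ).barred i j k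

theorem eval_compMatrix (u : targetOpens φ) :
    (smoothEval (targetOpens φ) u).mapMatrix (g.compMatrix hφ) =
      Matrix.of fun i j => g.comp φ i j u := rfl

theorem eval_iterDeriv_compMatrix (l : List (CIndex d)) (i j : Fin d) (u : targetOpens φ) :
    smoothEval (targetOpens φ) u
      (iterDeriv (wirtingerDerivation (targetOpens φ)) l (g.compMatrix hφ i j)) =
      iterWirtinger l (g.comp φ i j) u :=
  iterDeriv_wirtingerDerivation l _ (g.smooth φ hφ i j) u

theorem isUnit_det_compMatrix : IsUnit (g.compMatrix hφ).det := by
  refine smoothAlgebra_isUnit fun u => ?_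
  rw [← smoothEval_apply, AlgHom.map_det, eval_compMatrix]
  exact g.det_comp_ne_zero hφ u.2

theorem eval_compMatrix_inv (i j : Fin d) (u : targetOpens φ) :
    ((g.compMatrix hφ)⁻¹ j i).1 u = g.invComp φ i j u := by
  have h : (smoothEval (targetOpens φ) u).mapMatrix (g.compMatrix hφ)⁻¹ *
      (Matrix.of fun i j => g.comp φ i j u) = 1 := by
    rw [← g.eval_compMatrix hφ, ← map_mul, Matrix.nonsing_inv_mul _ (g.isUnit_det_compMatrix hφ),
      map_one]
  exact (congrFun (congrFun (Matrix.inv_eq_left_inv h) j) i).symm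

variable [IsManifold 𝓘(ℂ, Fin d → ℂ) ω M]

theorem laplacian_eq_boxOperator {h : M → ℂ} {X : smoothAlgebra (targetOpens φ)}
    (hX : ∀ u : targetOpens φ, h (φ.symm u) = X.1 u) (u : targetOpens φ) :
    g.laplacian h (φ.symm u) =
      (boxOperator (wirtingerDerivation (targetOpens φ)) (g.compMatrix hφ)⁻¹ X).1 u := by
  have hh : ContDiffOn ℝ ∞ (h ∘ φ.symm) φ.target := ContDiffOn.congr X.2 fun z hz => by
    rw [extendZero_apply _ hz]
    exact hX ⟨z, hz⟩
  obtain rfl : X = smoothRestrict (U := targetOpens φ) (h ∘ φ.symm) hh :=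
    Subtype.ext (funext fun u => (hX u).symm)
  rw [g.laplacian_eq hφ h hh u.2, ← smoothEval_apply, boxOperator, map_sum]
  refine Finset.sum_congr rfl fun j _ => ?_
  rw [map_sum]
  refine Finset.sum_congr rfl fun k _ => ?_
  rw [map_mul, smoothEval_apply, smoothEval_apply, eval_compMatrix_inv]
  congr 1
  exact (iterDeriv_wirtingerDerivation [Sum.inr k, Sum.inl j] _ hh u).symm

/-- The induction needs the equation on the whole coordinate domain, because the next Laplacian
differentiates. -/
theorem iterate_laplacian_eq {f : M → ℂ} {X : smoothAlgebra (targetOpens φ)}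
    (hX : ∀ u : targetOpens φ, f (φ.symm u) = X.1 u) (k : ℕ) (u : targetOpens φ) :
    (g.laplacian^[k] f) (φ.symm u) =
      ((boxOperator (wirtingerDerivation (targetOpens φ)) (g.compMatrix hφ)⁻¹)^[k] X).1 u := by
  induction k generalizing u with
  | zero => exact hX u
  | succ k ih =>
    rw [Function.iterate_succ_apply', Function.iterate_succ_apply']
    exact g.laplacian_eq_boxOperator hφ ih u

end KahlerMetric

/-! ### Graphs in normal coordinates -/

namespace KahlerMetric.IsNormalAt

variable {d : ℕ} {M : Type*} [TopologicalSpace M] [ChartedSpace (Fin d → ℂ) M]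
  {g : KahlerMetric d M} {φ : OpenPartialHomeomorph M (Fin d → ℂ)} {N : ℕ} {x : M}

/-- The coordinates of the centre. -/
def center (hφ : g.IsNormalAt φ N x) : targetOpens φ := ⟨φ x, φ.map_source hφ.mem_source⟩

variable (hφ : g.IsNormalAt φ N x)

/-- The evaluation at the centre. -/
def eval : smoothAlgebra (targetOpens φ) →ₐ[ℂ] ℂ := smoothEval (targetOpens φ) hφ.center

/-- The matrix of the functions `g_{i j̄} - δᵢⱼ`. -/
def deviation : Matrix (Fin d) (Fin d) (smoothAlgebra (targetOpens φ)) :=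
  g.compMatrix hφ.mem_atlas - 1

theorem eval_deviation (i j : Fin d) : hφ.eval (hφ.deviation i j) = 0 := by
  have h1 : hφ.eval (g.compMatrix hφ.mem_atlas i j) = if i = j then 1 else 0 := hφ.eq_delta i j
  rw [deviation, Matrix.sub_apply, map_sub, h1, Matrix.one_apply, apply_ite hφ.eval, map_one,
    map_zero, sub_self]

theorem eval_iterDeriv_deviation {l : List (CIndex d)} (hl : l ≠ []) (i j : Fin d) :
    hφ.eval (iterDeriv (wirtingerDerivation (targetOpens φ)) l (hφ.deviation i j)) =
      iterWirtinger l (g.comp φ i j) (φ x) := by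
  rw [deviation, iterDeriv_sub_one _ hl]
  exact g.eval_iterDeriv_compMatrix hφ.mem_atlas l i j hφ.center

/-- With at most one unbarred or at most one barred index, the jet is an entry of the deviation or a
derivative in directions of one type only. One index of each list belongs to the matrix entry, so
length at most `N + 1` means order at most `N`. -/
theorem eval_matrixJet_eq_zero {a b : List (Fin d)} (h : a.length ≤ 1 ∨ b.length ≤ 1)
    (ha : a.length ≤ N + 1) (hb : b.length ≤ N + 1) :
    hφ.eval (matrixJet (wirtingerDerivation (targetOpens φ)) hφ.deviation a b) = 0 := by
  match a, b with
  | [], _ => exact map_zero _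
  | _ :: _, [] => exact map_zero _
  | i :: k, j :: l =>
    simp only [List.length_cons] at h ha hb
    change hφ.eval (iterDeriv _ (k.map Sum.inl ++ l.map Sum.inr) _) = 0
    by_cases hkl : k.map Sum.inl ++ l.map Sum.inr = ([] : List (CIndex d))
    · rw [hkl]
      exact hφ.eval_deviation i j
    · rw [hφ.eval_iterDeriv_deviation hkl]
      rcases h with h | h
      · obtain rfl : k = [] := List.length_eq_zero_iff.1 (by omega)
        refine hφ.barred_eq_zero i j l (List.length_pos_iff.2 ?_) (by omega)
        rintro rfl
        exact hkl rfl
      · obtain rfl : l = [] := List.length_eq_zero_iff.1 (by omega)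
        rw [List.map_nil, List.append_nil]
        refine hφ.unbarred_eq_zero i j k (List.length_pos_iff.2 ?_) (by omega)
        rintro rfl
        exact hkl rfl

/-- Two unbarred indices mean at least one derivative, which removes the constant matrix by which
the deviation differs from the metric. -/
theorem eval_matrixJet {a b : List (Fin d)} (h : 2 ≤ a.length) :
    hφ.eval (matrixJet (wirtingerDerivation (targetOpens φ)) hφ.deviation a b) =
      g.metricJet φ a b (φ x) := by
  match a, b with
  | [], _ => exact map_zero _
  | _ :: _, [] => exact map_zero _
  | i :: k, j :: l =>
    refine hφ.eval_iterDeriv_deviation (fun h0 => ?_) i j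
    have := (List.append_eq_nil_iff.1 h0).1
    rw [List.map_eq_nil_iff] at this
    simp [this] at h

theorem invComp_center (hφ : g.IsNormalAt φ N x) (i j : Fin d) :
    g.invComp φ i j (φ x) = if i = j then 1 else 0 := by
  have h : (Matrix.of fun a b => g.comp φ a b (φ x)) = 1 := by
    ext a b
    rw [Matrix.of_apply, hφ.eq_delta, Matrix.one_apply]
  rw [invComp, h, inv_one, Matrix.one_apply]
  exact if_congr eq_comm rfl rfl

variable {V E : Type} [Fintype V] [Fintype E]

/-- The factor of an unstable vertex vanishes for every labelling. The degrees are at most `k ≤ N +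
1`; this is where the order of normality enters. -/
theorem eval_graphValue_eq_zero {Γ : PointedGraph V E} (h : Γ.IsStronglyConnected)
    {k : ℕ} (hk : Fintype.card E = Fintype.card V + k) (hN : k ≤ N + 1) (hs : ¬ Γ.IsStable)
    (F : smoothAlgebra (targetOpens φ)) :
    hφ.eval (Γ.graphValue (wirtingerDerivation (targetOpens φ)) hφ.deviation F) = 0 := by
  classical
  rw [PointedGraph.IsStable, not_forall] at hs
  obtain ⟨v, hv⟩ := hs
  have : Nonempty V := ⟨v⟩
  rw [PointedGraph.graphValue, map_sum]
  refine Finset.sum_eq_zero fun p _ => ?_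
  rw [map_prod]
  refine Finset.prod_eq_zero (Finset.mem_univ (some v)) (hφ.eval_matrixJet_eq_zero ?_ ?_ ?_)
  · rw [Γ.length_outLabels, Γ.length_inLabels]
    omega
  · rw [Γ.length_outLabels]
    exact (h.outDegree_le hk _).trans hN
  · rw [Γ.length_inLabels]
    exact (h.inDegree_le hk _).trans hN

/-- At the centre the inverse metric is the identity, so only `b = a` survives of the two labels on
each edge. -/
theorem eval_graphValue {Γ : PointedGraph V E} (hs : Γ.IsStable) {F : (Fin d → ℂ) → ℂ}
    (hF : ContDiffOn ℝ ∞ F (targetOpens φ)) :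
    hφ.eval (Γ.graphValue (wirtingerDerivation (targetOpens φ)) hφ.deviation
      (smoothRestrict F hF)) = g.graphOperator φ Γ F (φ x) := by
  classical
  rw [PointedGraph.graphValue, map_sum, graphOperator]
  refine Finset.sum_congr rfl fun a _ => ?_
  rw [Finset.sum_eq_single_of_mem a (Finset.mem_univ a)]
  · have h1 : ∏ e : E, g.invComp φ (a e) (a e) (φ x) = 1 :=
      Finset.prod_eq_one fun e _ => by rw [hφ.invComp_center, if_pos rfl]
    rw [map_prod, Fintype.prod_option, mul_comm, h1, one_mul]
    · congr 1
      · refine Finset.prod_congr rfl fun v _ => ?_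
        refine (hφ.eval_matrixJet ?_).trans ?_
        · rw [Γ.length_outLabels]
          exact (hs v).2
        · rfl
      · refine (iterDeriv_wirtingerDerivation _ F hF hφ.center).trans ?_
        rw [PointedGraph.outLabels, PointedGraph.inLabels, List.map_map, List.map_map]
        rfl
  · intro b _ hb
    obtain ⟨e, he⟩ := Function.ne_iff.1 hb
    rw [Finset.prod_eq_zero (Finset.mem_univ e), zero_mul, zero_mul]
    rw [hφ.invComp_center, if_neg (Ne.symm he)]

end KahlerMetric.IsNormalAt

theorem proposition2p9 (d : ℕ) {M : Type*} [TopologicalSpace M]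
    [ChartedSpace (Fin d → ℂ) M] [IsManifold 𝓘(ℂ, Fin d → ℂ) ω M]
    (g : KahlerMetric d M) (k N : ℕ) (hN : k ≤ N + 1)
    (x : M) (φ : OpenPartialHomeomorph M (Fin d → ℂ)) (hφ : g.IsNormalAt φ N x)
    (f : M → ℂ) (hf : ContMDiff 𝓘(ℝ, Fin d → ℂ) 𝓘(ℝ, ℂ) ∞ f) :
    (g.laplacian^[k] f) x =
      ∑ c ∈ (PointedGraph.finite_strongStable k).toFinset,
        (-1 : ℂ) ^ (c.rep.numVertices - 1) * ((c.rep.phi : ℂ) / (c.rep.autCard : ℂ)) *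
          g.graphOperator φ c.rep (f ∘ φ.symm) (φ x) := by
  have hF : ContDiffOn ℝ ∞ (f ∘ φ.symm) (KahlerMetric.targetOpens φ) :=
    KahlerMetric.contDiffOn_comp_symm hφ.mem_atlas hf
  have h1 := g.iterate_laplacian_eq hφ.mem_atlas (X := smoothRestrict (f ∘ φ.symm) hF)
    (fun _ => rfl) k hφ.center
  rw [show φ.symm hφ.center = x from φ.left_inv hφ.mem_source] at h1
  have hK := g.isKahlerMatrix_compMatrix_sub_one hφ.mem_atlas
  -- The truncation order is `B = 2 * k + 1`: two derivations for each Laplacian, and one power of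
  -- the ideal left over.
  have h2 := eval_iterate_boxOperator hK hφ.eval hφ.eval_deviation
    (P := (g.compMatrix hφ.mem_atlas)⁻¹)
    (by rw [add_sub_cancel]; exact Matrix.nonsing_inv_mul _ (g.isUnit_det_compMatrix hφ.mem_atlas))
    (Nat.lt_succ_self (2 * k)) (smoothRestrict (f ∘ φ.symm) hF)
  refine h1.trans (h2.trans ?_)
  rw [PointedGraph.sum_ears_eq_sum_strongStable (Nat.le_succ _)]
  · refine Finset.sum_congr rfl fun c hc => ?_
    rw [Set.Finite.mem_toFinset] at hc
    have h3 := hφ.eval_graphValue hc.2.1 hF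
    rw [PointedGraph.numVertices, Fintype.card_option, Nat.add_sub_cancel, ← h3,
      KahlerMetric.IsNormalAt.deviation]
    ring
  · intro S T σ
    rw [σ.graphValue_eq _ hK, Fintype.card_congr σ.vert]
  · intro T hT hs
    have h4 := hφ.eval_graphValue_eq_zero (PointedGraph.FinGraph.isStronglyConnected_of_mem_ears hT)
      (PointedGraph.FinGraph.card_edges_of_mem_ears hT) hN hs (smoothRestrict (f ∘ φ.symm) hF)
    rw [KahlerMetric.IsNormalAt.deviation] at h4
    rw [h4, mul_zero]

end
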